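/- Let $\mathbb D$ be the open unit disc, $H(\mathbb D)$ the space of analytic functions on $\mathbb D$, and $p,q\in(0,\infty)$. Let $\phi$ be a normal function: $\phi:[0,1)\to(0,\infty)$ is continuous and there are constants $b>a>0$ such that on $[0,1)$ the function $\phi(r)/(1-r)^a$ is non-increasing and tends to $0$ as $r\to1^-$, while $\phi(r)/(1-r)^b$ is non-decreasing and tends to $\infty$ as $r\to1^-$. The mixed-norm space $H(p,q,\phi)$ consists of all $f\in H(\mathbb D)$ with $$\|f\|_{p,q,\phi}=\left(\int_0^1 M_q(f,r)^p\,\frac{\phi(r)^p}{1-r}\,dr\right)^{1/p}<\infty,\qquad M_q(f,r)=\left(\frac1{2\pi}\int_0^{2\pi}|f(re^{i\theta})|^q\,d\theta\right)^{1/q}.$$ For a weight $\mu$ (a positive continuous function on $\mathbb D$), the Zygmund-type space $\mathcal Z_\mu$ consists of all $f\in H(\mathbb D)$ with $\sup_{z\in\mathbb D}\mu(|z|)|f''(z)|<\infty$, with norm $\|f\|_{\mathcal Z_\mu}=|f(0)|+|f'(0)|+\sup_{z\in\mathbb D}\mu(|z|)|f''(z)|$. For a linear operator $T:H(p,q,\phi)\to\mathcal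 Z_\mu$ put $\|T\|=\sup\{\|Tf\|_{\mathcal Z_\mu}:\|f\|_{p,q,\phi}\le1\}$; $T$ is bounded if $\|Tf\|_{\mathcal Z_\mu}\le M\|f\|_{p,q,\phi}$ for some $M$ and all $f$, and compact if it maps the unit ball of $H(p,q,\phi)$ to a relatively compact subset of $\mathcal Z_\mu$. The essential norm is $\|T\|_e=\inf\{\|T-S\|: S:H(p,q,\phi)\to\mathcal Z_\mu\text{ a compact linear operator}\}$. Corollary. There are constants $c,C>0$, depending only on $p$, $q$ and $\phi$, such that the following holds for every weight $\mu$ and every analytic map $\varphi:\mathbb D\to\mathbb D$. If the composition operator $C_\varphi f=f\circ\varphi$ maps $H(p,q,\phi)$ into $\mathcal Z_\mu$ and $C_\varphi:H(p,q,\phi)\to\mathcal Z_\mu$ is bounded, then $$c\,\max\{A,B\}\le\|C_\varphi\|_e\le C\,\max\{A,B\},$$ where $$A=\limsup_{|\varphi(z)|\to1}\frac{\mu(|z|)\,|\varphi'(z)|^2}{\phi(|\varphi(z)|)\,(1-|\varphi(z)|^2)^{1/q+2}},\qquad B=\limsup_{|\varphi(z)|\to1}\frac{\mu(|z|)\,|\varphi''(z)|}{\phi(|\varphi(z)|)\,(1-|\varphi(z)|^2)^{1/q+1}}$$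 (both are read as $0$ if $\sup_{z\in\mathbb D}|\varphi(z)|<1$). As a result, $C_\varphi:H(p,q,\phi)\to\mathcal Z_\mu$ is compact if and only if $A=0$ and $B=0$. -/

import Mathlib

open Filter Topology MeasureTheory
open scoped ENNReal

noncomputable section

namespace CompOp

/-- The open unit disc of `ℂ`. -/
abbrev disc : Set ℂ := Metric.ball (0 : ℂ) 1

/-- The space `H(𝔻)` of analytic functions on the open unit disc. A function on the disc is
represented by its extension by `0` to all of `ℂ`, so that two elements are equal if and only if
they agree on the disc. -/
def holDisc : Submodule ℂ (ℂ → ℂ) where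
  carrier := {f | DifferentiableOn ℂ f disc ∧ ∀ z ∉ disc, f z = 0}
  add_mem' := by
    rintro f g ⟨hf, hf0⟩ ⟨hg, hg0⟩
    exact ⟨hf.add hg, fun z hz => by simp [hf0 z hz, hg0 z hz]⟩
  zero_mem' := ⟨differentiableOn_const 0, fun _ _ => rfl⟩
  smul_mem' := by
    rintro c f ⟨hf, hf0⟩
    exact ⟨hf.const_smul c, fun z hz => by simp [hf0 z hz]⟩

/-- A normal function on `[0,1)`. -/
structure IsNormal (ϕ : ℝ → ℝ) : Prop where
  pos : ∀ r ∈ Set.Ico (0 : ℝ) 1, 0 < ϕ r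
  cont : ContinuousOn ϕ (Set.Ico 0 1)
  exists_exponents : ∃ a b : ℝ, 0 < a ∧ a < b ∧
    AntitoneOn (fun r => ϕ r / (1 - r) ^ a) (Set.Ico 0 1) ∧
    Tendsto (fun r => ϕ r / (1 - r) ^ a) (𝓝[<] 1) (𝓝 0) ∧
    MonotoneOn (fun r => ϕ r / (1 - r) ^ b) (Set.Ico 0 1) ∧
    Tendsto (fun r => ϕ r / (1 - r) ^ b) (𝓝[<] 1) atTop

/-- The integral mean `M_q(f,r) = ((1/2π) ∫_0^{2π} |f(r e^{iθ})|^q dθ)^{1/q}`. -/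
def integralMean (q : ℝ) (f : ℂ → ℂ) (r : ℝ) : ℝ≥0∞ :=
  (ENNReal.ofReal (1 / (2 * Real.pi)) *
    ∫⁻ θ in Set.Ioo (0 : ℝ) (2 * Real.pi),
      ‖f ((r : ℂ) * Complex.exp ((θ : ℂ) * Complex.I))‖ₑ ^ q) ^ (1 / q)

/-- The mixed (quasi-)norm `(∫_0^1 M_q(f,r)^p ϕ(r)^p / (1-r) dr)^{1/p}`, with values in
`[0,∞]`. -/
def mixedNorm (p q : ℝ) (ϕ : ℝ → ℝ) (f : ℂ → ℂ) : ℝ≥0∞ :=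
  (∫⁻ r in Set.Ioo (0 : ℝ) 1,
    integralMean q f r ^ p * ENNReal.ofReal (ϕ r ^ p / (1 - r))) ^ (1 / p)

lemma add_rpow_le {s : ℝ} (hs : 0 ≤ s) (x y : ℝ≥0∞) :
    (x + y) ^ s ≤ 2 ^ s * (x ^ s + y ^ s) := by
  rcases le_total x y with h | h
  · calc (x + y) ^ s ≤ (2 * y) ^ s := by
          gcongr; rw [two_mul]; gcongr
      _ = 2 ^ s * y ^ s := ENNReal.mul_rpow_of_nonneg _ _ hs
      _ ≤ _ := by gcongr; exact le_add_self
  · calc (x + y) ^ s ≤ (2 * x) ^ s := by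
          gcongr; rw [two_mul]; gcongr
      _ = 2 ^ s * x ^ s := ENNReal.mul_rpow_of_nonneg _ _ hs
      _ ≤ _ := by gcongr; exact le_self_add

lemma measurable_of_mem {f : ℂ → ℂ} (hf : f ∈ holDisc) : Measurable f := by
  classical
  have h : f = disc.piecewise f (fun _ => 0) := by
    funext z
    by_cases hz : z ∈ disc
    · simp only [Set.piecewise, hz, if_true]
    · simp only [Set.piecewise, hz, if_false]; exact hf.2 z hz
  rw [h]
  exact hf.1.continuousOn.measurable_piecewise continuousOn_const Metric.isOpen_ball.measurableSet

lemma measurable_circle_enorm (q : ℝ) {f : ℂ → ℂ} (hf : f ∈ holDisc) :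
    Measurable (fun x : ℝ × ℝ =>
      ‖f ((x.1 : ℂ) * Complex.exp ((x.2 : ℂ) * Complex.I))‖ₑ ^ q) := by
  have h1 : Continuous (fun x : ℝ × ℝ => (x.1 : ℂ) * Complex.exp ((x.2 : ℂ) * Complex.I)) := by
    fun_prop
  exact ((measurable_of_mem hf).comp h1.measurable).enorm.pow_const q

lemma measurable_integralMean (q : ℝ) {f : ℂ → ℂ} (hf : f ∈ holDisc) :
    Measurable (integralMean q f) := by
  unfold integralMean
  exact ((measurable_circle_enorm q hf).lintegral_prod_right'.const_mul _).pow_const _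

lemma integralMean_add_le {q : ℝ} (hq : 0 < q) {f g : ℂ → ℂ} (hf : f ∈ holDisc) (r : ℝ) :
    integralMean q (f + g) r ≤
      (2 ^ q) ^ (1 / q) * 2 ^ (1 / q) * (integralMean q f r + integralMean q g r) := by
  have h1q : 0 ≤ 1 / q := by positivity
  unfold integralMean
  set c := ENNReal.ofReal (1 / (2 * Real.pi))
  set F := fun (f : ℂ → ℂ) (θ : ℝ) => ‖f ((r : ℂ) * Complex.exp ((θ : ℂ) * Complex.I))‖ₑ ^ q
    with hF
  have hm : Measurable (F f) := (measurable_circle_enorm q hf).comp measurable_prodMk_left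
  have h2 : (2 : ℝ≥0∞) ^ q ≠ ⊤ := ENNReal.rpow_ne_top_of_nonneg hq.le (by simp)
  have key : c * ∫⁻ θ in Set.Ioo (0 : ℝ) (2 * Real.pi), F (f + g) θ ≤
      2 ^ q * ((c * ∫⁻ θ in Set.Ioo (0 : ℝ) (2 * Real.pi), F f θ) +
        c * ∫⁻ θ in Set.Ioo (0 : ℝ) (2 * Real.pi), F g θ) := by
    calc c * ∫⁻ θ in Set.Ioo (0 : ℝ) (2 * Real.pi), F (f + g) θ
        ≤ c * ∫⁻ θ in Set.Ioo (0 : ℝ) (2 * Real.pi), 2 ^ q * (F f θ + F g θ) := by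
          gcongr with θ
          refine le_trans ?_ (add_rpow_le hq.le _ _)
          simp only [hF, Pi.add_apply]
          gcongr
          exact enorm_add_le _ _
      _ = _ := by
          rw [lintegral_const_mul' _ _ h2, lintegral_add_left hm]
          ring
  calc _ ≤ (2 ^ q * ((c * ∫⁻ θ in Set.Ioo (0 : ℝ) (2 * Real.pi), F f θ) +
        c * ∫⁻ θ in Set.Ioo (0 : ℝ) (2 * Real.pi), F g θ)) ^ (1 / q) := by gcongr
    _ ≤ _ := by
        rw [ENNReal.mul_rpow_of_nonneg _ _ h1q, mul_assoc]
        gcongr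
        exact add_rpow_le h1q _ _

lemma mixedNorm_add_lt_top {p q : ℝ} (hp : 0 < p) (hq : 0 < q) {ϕ : ℝ → ℝ} (hϕ : IsNormal ϕ)
    {f g : ℂ → ℂ} (hf : f ∈ holDisc)
    (hf' : mixedNorm p q ϕ f < ⊤) (hg' : mixedNorm p q ϕ g < ⊤) :
    mixedNorm p q ϕ (f + g) < ⊤ := by
  have h1p : 0 < 1 / p := by positivity
  unfold mixedNorm at *
  rw [ENNReal.rpow_lt_top_iff_of_pos h1p] at *
  set K : ℝ≥0∞ := (2 ^ q) ^ (1 / q) * 2 ^ (1 / q) with hKdef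
  have hK : K ≠ ⊤ := by
    refine ENNReal.mul_ne_top ?_ ?_
    · exact ENNReal.rpow_ne_top_of_nonneg (by positivity)
        (ENNReal.rpow_ne_top_of_nonneg hq.le (by simp))
    · exact ENNReal.rpow_ne_top_of_nonneg (by positivity) (by simp)
  have hK' : K ^ p * 2 ^ p ≠ ⊤ :=
    ENNReal.mul_ne_top (ENNReal.rpow_ne_top_of_nonneg hp.le hK)
      (ENNReal.rpow_ne_top_of_nonneg hp.le (by simp))
  have hw : AEMeasurable (fun r : ℝ => ENNReal.ofReal (ϕ r ^ p / (1 - r)))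
      (volume.restrict (Set.Ioo 0 1)) := by
    have hc : ContinuousOn ϕ (Set.Ioo 0 1) := hϕ.cont.mono Set.Ioo_subset_Ico_self
    have : AEMeasurable ϕ (volume.restrict (Set.Ioo 0 1)) := hc.aemeasurable measurableSet_Ioo
    exact ((this.pow_const p).div (by fun_prop)).ennreal_ofReal
  calc _ ≤ ∫⁻ r in Set.Ioo (0 : ℝ) 1, (K ^ p * 2 ^ p) *
        (integralMean q f r ^ p * ENNReal.ofReal (ϕ r ^ p / (1 - r)) +
          integralMean q g r ^ p * ENNReal.ofReal (ϕ r ^ p / (1 - r))) := by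
        refine lintegral_mono fun r => ?_
        simp only [← add_mul, ← mul_assoc]
        gcongr ?_ * _
        calc _ ≤ (K * (integralMean q f r + integralMean q g r)) ^ p := by
              gcongr; exact integralMean_add_le hq hf r
          _ = K ^ p * (integralMean q f r + integralMean q g r) ^ p :=
              ENNReal.mul_rpow_of_nonneg _ _ hp.le
          _ ≤ _ := by
              rw [mul_assoc]; gcongr; exact add_rpow_le hp.le _ _
    _ = (K ^ p * 2 ^ p) * (_ + _) := by
        rw [lintegral_const_mul' _ _ hK',
          lintegral_add_left' (f := fun r =>
            integralMean q f r ^ p * ENNReal.ofReal (ϕ r ^ p / (1 - r)))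
            (((measurable_integralMean q hf).pow_const p).aemeasurable.mul hw)]
    _ < ⊤ := ENNReal.mul_lt_top hK'.lt_top (ENNReal.add_lt_top.2 ⟨hf', hg'⟩)

lemma integralMean_smul {q : ℝ} (hq : 0 < q) (c : ℂ) (f : ℂ → ℂ) (r : ℝ) :
    integralMean q (c • f) r = ‖c‖ₑ * integralMean q f r := by
  have h1q : 0 ≤ 1 / q := by positivity
  unfold integralMean
  simp only [Pi.smul_apply, enorm_smul, ENNReal.mul_rpow_of_nonneg _ _ hq.le]
  rw [lintegral_const_mul' _ _ (ENNReal.rpow_ne_top_of_nonneg hq.le enorm_ne_top),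
    mul_left_comm, ENNReal.mul_rpow_of_nonneg _ _ h1q, ← ENNReal.rpow_mul,
    mul_one_div_cancel hq.ne', ENNReal.rpow_one]

lemma mixedNorm_smul {p q : ℝ} (hp : 0 < p) (hq : 0 < q) (ϕ : ℝ → ℝ) (c : ℂ) (f : ℂ → ℂ) :
    mixedNorm p q ϕ (c • f) = ‖c‖ₑ * mixedNorm p q ϕ f := by
  have h1p : 0 ≤ 1 / p := by positivity
  unfold mixedNorm
  simp only [integralMean_smul hq, ENNReal.mul_rpow_of_nonneg _ _ hp.le, mul_assoc]
  rw [lintegral_const_mul' _ _ (ENNReal.rpow_ne_top_of_nonneg hp.le enorm_ne_top),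
    ENNReal.mul_rpow_of_nonneg _ _ h1p, ← ENNReal.rpow_mul,
    mul_one_div_cancel hp.ne', ENNReal.rpow_one]

/-- The mixed-norm space `H(p,q,ϕ)`. -/
def MixedNormSpace {p q : ℝ} (hp : 0 < p) (hq : 0 < q) {ϕ : ℝ → ℝ} (hϕ : IsNormal ϕ) :
    Submodule ℂ (ℂ → ℂ) where
  carrier := {f | f ∈ holDisc ∧ mixedNorm p q ϕ f < ⊤}
  add_mem' := fun hf hg =>
    ⟨holDisc.add_mem hf.1 hg.1, mixedNorm_add_lt_top hp hq hϕ hf.1 hf.2 hg.2⟩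
  zero_mem' := by
    refine ⟨holDisc.zero_mem, ?_⟩
    have h := mixedNorm_smul hp hq ϕ 0 0
    rw [zero_smul, enorm_zero, zero_mul] at h
    rw [h]
    exact ENNReal.zero_lt_top
  smul_mem' := fun c f hf => by
    refine ⟨holDisc.smul_mem c hf.1, ?_⟩
    rw [mixedNorm_smul hp hq]
    exact ENNReal.mul_lt_top enorm_lt_top hf.2

/-- A weight: a positive continuous function on the disc. -/
structure IsWeight (μ : ℂ → ℝ) : Prop where
  pos : ∀ z ∈ disc, 0 < μ z
  cont : ContinuousOn μ disc

lemma IsWeight.pos_norm {μ : ℂ → ℝ} (hμ : IsWeight μ) {z : ℂ} (hz : z ∈ disc) :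
    0 < μ (‖z‖ : ℂ) := by
  apply hμ.pos
  simpa using hz

/-- The function `z ↦ μ(|z|) |f''(z)|` on the disc. -/
def zygFun (μ : ℂ → ℝ) (f : ℂ → ℂ) (z : disc) : ℝ :=
  μ (‖(z : ℂ)‖ : ℂ) * ‖deriv (deriv f) z‖

lemma hol_deriv {f : ℂ → ℂ} (hf : f ∈ holDisc) : DifferentiableOn ℂ (deriv f) disc :=
  hf.1.deriv Metric.isOpen_ball

lemma deriv_add_of_mem {f g : ℂ → ℂ} (hf : f ∈ holDisc) (hg : g ∈ holDisc) {z : ℂ}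
    (hz : z ∈ disc) : deriv (f + g) z = deriv f z + deriv g z := by
  have hn := Metric.isOpen_ball.mem_nhds hz
  exact deriv_add (hf.1.differentiableAt hn) (hg.1.differentiableAt hn)

lemma deriv2_add_of_mem {f g : ℂ → ℂ} (hf : f ∈ holDisc) (hg : g ∈ holDisc) {z : ℂ}
    (hz : z ∈ disc) :
    deriv (deriv (f + g)) z = deriv (deriv f) z + deriv (deriv g) z := by
  have hn := Metric.isOpen_ball.mem_nhds hz
  have h : deriv (f + g) =ᶠ[𝓝 z] deriv f + deriv g := by
    filter_upwards [hn] with w hw using deriv_add_of_mem hf hg hw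
  rw [h.deriv_eq]
  exact deriv_add ((hol_deriv hf).differentiableAt hn) ((hol_deriv hg).differentiableAt hn)

lemma deriv2_smul (c : ℂ) (f : ℂ → ℂ) (z : ℂ) :
    deriv (deriv (c • f)) z = c * deriv (deriv f) z := by
  have h : deriv (c • f) = c • deriv f := by
    funext w; simp [deriv_const_smul_field]
  rw [h]; simp [deriv_const_smul_field]

lemma zygFun_nonneg {μ : ℂ → ℝ} (hμ : IsWeight μ) (f : ℂ → ℂ) (z : disc) : 0 ≤ zygFun μ f z :=
  mul_nonneg (hμ.pos_norm z.2).le (norm_nonneg _)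

lemma zygFun_add_le {μ : ℂ → ℝ} (hμ : IsWeight μ) {f g : ℂ → ℂ} (hf : f ∈ holDisc)
    (hg : g ∈ holDisc) (z : disc) : zygFun μ (f + g) z ≤ zygFun μ f z + zygFun μ g z := by
  unfold zygFun
  rw [deriv2_add_of_mem hf hg z.2, ← mul_add]
  exact mul_le_mul_of_nonneg_left (norm_add_le _ _) (hμ.pos_norm z.2).le

lemma zygFun_smul (μ : ℂ → ℝ) (c : ℂ) (f : ℂ → ℂ) (z : disc) :
    zygFun μ (c • f) z = ‖c‖ * zygFun μ f z := by
  unfold zygFun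
  rw [deriv2_smul, norm_mul]; ring

/-- The Zygmund-type space `Z_μ` as a space of functions: the analytic `f` on the disc with
`sup_z μ(|z|) |f''(z)| < ∞`. -/
def zygmundSubmodule {μ : ℂ → ℝ} (hμ : IsWeight μ) : Submodule ℂ (ℂ → ℂ) where
  carrier := {f | f ∈ holDisc ∧ BddAbove (Set.range (zygFun μ f))}
  add_mem' := by
    rintro f g ⟨hf, A, hA⟩ ⟨hg, B, hB⟩
    refine ⟨holDisc.add_mem hf hg, A + B, ?_⟩
    rintro _ ⟨z, rfl⟩
    exact (zygFun_add_le hμ hf hg z).trans (add_le_add (hA ⟨z, rfl⟩) (hB ⟨z, rfl⟩))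
  zero_mem' := by
    refine ⟨holDisc.zero_mem, 0, ?_⟩
    rintro _ ⟨z, rfl⟩
    have h := zygFun_smul μ 0 0 z
    rw [zero_smul, norm_zero, zero_mul] at h
    exact h.le
  smul_mem' := by
    rintro c f ⟨hf, A, hA⟩
    refine ⟨holDisc.smul_mem c hf, ‖c‖ * A, ?_⟩
    rintro _ ⟨z, rfl⟩
    rw [zygFun_smul]
    exact mul_le_mul_of_nonneg_left (hA ⟨z, rfl⟩) (norm_nonneg c)

/-- The Zygmund-type space `Z_μ`. It is a type of its own, so that its only topology is the one
of the norm below. -/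
def ZygmundSpace {μ : ℂ → ℝ} (hμ : IsWeight μ) : Type := zygmundSubmodule hμ

namespace ZygmundSpace

variable {μ : ℂ → ℝ} {hμ : IsWeight μ}

/-- The underlying function of an element of `Z_μ`. -/
def toFun (f : ZygmundSpace hμ) : ℂ → ℂ := f.1

instance instNormed : NormedAddCommGroup (ZygmundSpace hμ) :=
  letI : AddCommGroup (ZygmundSpace hμ) := inferInstanceAs (AddCommGroup (zygmundSubmodule hμ))
  AddGroupNorm.toNormedAddCommGroup
    { toFun := fun f => ‖f.toFun 0‖ + ‖deriv f.toFun 0‖ + ⨆ z : disc, zygFun μ f.toFun z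
      map_zero' := by
        have h0 : (0 : ZygmundSpace hμ).toFun = fun _ => 0 := rfl
        simp [h0, zygFun]
      add_le' := by
        intro f g
        have h0 : (f + g).toFun = f.toFun + g.toFun := rfl
        have m0 : (0 : ℂ) ∈ disc := by simp
        have : Nonempty disc := ⟨⟨0, m0⟩⟩
        rw [h0, deriv_add_of_mem (f := f.toFun) (g := g.toFun) f.2.1 g.2.1 m0, Pi.add_apply]
        have h1 : ⨆ z : disc, zygFun μ (f.toFun + g.toFun) z ≤
            (⨆ z : disc, zygFun μ f.toFun z) + ⨆ z : disc, zygFun μ g.toFun z :=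
          ciSup_le fun z => (zygFun_add_le hμ f.2.1 g.2.1 z).trans
            (add_le_add (le_ciSup f.2.2 z) (le_ciSup g.2.2 z))
        linarith [norm_add_le (f.toFun 0) (g.toFun 0),
          norm_add_le (deriv f.toFun 0) (deriv g.toFun 0)]
      neg' := by
        intro f
        have h0 : (-f).toFun = (-1 : ℂ) • f.toFun := by
          rw [neg_one_smul]; rfl
        have h1 : ∀ z, zygFun μ ((-1 : ℂ) • f.toFun) z = zygFun μ f.toFun z := fun z => by
          rw [zygFun_smul]; simp
        rw [h0]
        simp only [h1]
        simp [deriv.neg]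
      eq_zero_of_map_eq_zero' := by
        intro f hf
        have m0 : (0 : ℂ) ∈ disc := by simp
        have hs0 : 0 ≤ ⨆ z : disc, zygFun μ f.toFun z :=
          Real.iSup_nonneg fun z => zygFun_nonneg hμ _ z
        have e0 : f.toFun 0 = 0 := norm_eq_zero.1 (by
          linarith [norm_nonneg (f.toFun 0), norm_nonneg (deriv f.toFun 0)])
        have e1 : deriv f.toFun 0 = 0 := norm_eq_zero.1 (by
          linarith [norm_nonneg (f.toFun 0), norm_nonneg (deriv f.toFun 0)])
        have es : ⨆ z : disc, zygFun μ f.toFun z = 0 := by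
          linarith [norm_nonneg (f.toFun 0), norm_nonneg (deriv f.toFun 0)]
        have d2 : ∀ z ∈ disc, deriv (deriv f.toFun) z = 0 := by
          intro z hz
          have h := le_ciSup f.2.2 (⟨z, hz⟩ : disc)
          have h' : zygFun μ f.toFun ⟨z, hz⟩ = 0 :=
            le_antisymm (h.trans es.le) (zygFun_nonneg hμ _ _)
          exact norm_eq_zero.1 ((mul_eq_zero.1 h').resolve_left (hμ.pos_norm hz).ne')
        have hpre : IsPreconnected disc := (convex_ball (0 : ℂ) 1).isPreconnected
        have d1 : ∀ z ∈ disc, deriv f.toFun z = 0 := by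
          intro z hz
          exact (Metric.isOpen_ball.is_const_of_deriv_eq_zero hpre (hol_deriv f.2.1) d2 hz m0).trans
            e1
        apply Subtype.ext
        funext z
        by_cases hz : z ∈ disc
        · exact (Metric.isOpen_ball.is_const_of_deriv_eq_zero hpre f.2.1.1 d1 hz m0).trans e0
        · exact f.2.1.2 z hz }

instance instModule : Module ℂ (ZygmundSpace hμ) :=
  inferInstanceAs (Module ℂ (zygmundSubmodule hμ))

lemma norm_def (f : ZygmundSpace hμ) :
    ‖f‖ = ‖f.toFun 0‖ + ‖deriv f.toFun 0‖ +
      ⨆ z : disc, μ (‖(z : ℂ)‖ : ℂ) * ‖deriv (deriv f.toFun) z‖ := rfl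

instance instNormedSpace : NormedSpace ℂ (ZygmundSpace hμ) where
  norm_smul_le c f := by
    have h0 : (c • f).toFun = c • f.toFun := rfl
    have h1 : ∀ z, zygFun μ (c • f.toFun) z = ‖c‖ * zygFun μ f.toFun z := zygFun_smul μ c f.toFun
    change ‖(c • f).toFun 0‖ + ‖deriv (c • f).toFun 0‖ + (⨆ z : disc, zygFun μ (c • f).toFun z) ≤
      ‖c‖ * (‖f.toFun 0‖ + ‖deriv f.toFun 0‖ + ⨆ z : disc, zygFun μ f.toFun z)
    rw [h0]
    simp only [h1, ← Real.mul_iSup_of_nonneg (norm_nonneg c)]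
    simp [deriv_const_smul_field, mul_add]

end ZygmundSpace

section Operators

variable {p q : ℝ} {hp : 0 < p} {hq : 0 < q} {ϕ : ℝ → ℝ} {hϕ : IsNormal ϕ}
  {μ : ℂ → ℝ} {hμ : IsWeight μ}

/-- Boundedness of a linear operator `H(p,q,ϕ) → Z_μ`. -/
def IsBoundedOp (T : MixedNormSpace hp hq hϕ →ₗ[ℂ] ZygmundSpace hμ) : Prop :=
  ∃ M : ℝ, ∀ f : MixedNormSpace hp hq hϕ, ‖T f‖ ≤ M * (mixedNorm p q ϕ f.1).toReal

/-- Compactness of a linear operator `H(p,q,ϕ) → Z_μ`: the image of the closed unit ball is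
relatively compact. -/
def IsCompactOp (T : MixedNormSpace hp hq hϕ →ₗ[ℂ] ZygmundSpace hμ) : Prop :=
  IsCompact (closure (T '' {f | mixedNorm p q ϕ f.1 ≤ 1}))

/-- The operator norm `sup {‖T f‖ : ‖f‖ ≤ 1}`, with values in `[0,∞]`. -/
def opNorm (T : MixedNormSpace hp hq hϕ →ₗ[ℂ] ZygmundSpace hμ) : ℝ≥0∞ :=
  ⨆ (f : MixedNormSpace hp hq hϕ) (_ : mixedNorm p q ϕ f.1 ≤ 1), ‖T f‖ₑ

/-- The essential norm: the distance, in operator norm, to the compact operators. -/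
def essNorm (T : MixedNormSpace hp hq hϕ →ₗ[ℂ] ZygmundSpace hμ) : ℝ≥0∞ :=
  ⨅ (S : MixedNormSpace hp hq hϕ →ₗ[ℂ] ZygmundSpace hμ) (_ : IsCompactOp S), opNorm (T - S)

end Operators

/-- The function `f ∘ φ` on the disc (extended by `0`). -/
def comp (φ f : ℂ → ℂ) : ℂ → ℂ := disc.indicator (f ∘ φ)

/-- The composition operator `C_φ : H(p,q,ϕ) → Z_μ`, `f ↦ f ∘ φ`, for a symbol `φ` such that
`f ∘ φ` is in `Z_μ` for every `f` in `H(p,q,ϕ)`. -/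
def compositionOperator {p q : ℝ} (hp : 0 < p) (hq : 0 < q) {ϕ : ℝ → ℝ} (hϕ : IsNormal ϕ)
    {μ : ℂ → ℝ} (hμ : IsWeight μ) (φ : ℂ → ℂ)
    (h : ∀ f ∈ MixedNormSpace hp hq hϕ, comp φ f ∈ zygmundSubmodule hμ) :
    MixedNormSpace hp hq hϕ →ₗ[ℂ] ZygmundSpace hμ where
  toFun f := ⟨comp φ f.1, h f.1 f.2⟩
  map_add' f g := Subtype.ext (by
    change disc.indicator ((f.1 + g.1) ∘ φ) =
      disc.indicator (f.1 ∘ φ) + disc.indicator (g.1 ∘ φ)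
    rw [← Set.indicator_add']; rfl)
  map_smul' c f := Subtype.ext (by
    change disc.indicator ((c • f.1) ∘ φ) = c • disc.indicator (f.1 ∘ φ)
    funext z
    by_cases hz : z ∈ disc <;> simp [Set.indicator, hz])

/-- The filter `|φ(z)| → 1`, `z` in the disc. It is trivial if `sup |φ| < 1`, and a limit superior
along it of a function with values in `[0,∞]` is then `0`. -/
def toBoundary (φ : ℂ → ℂ) : Filter ℂ :=
  comap (fun z => ‖φ z‖) (𝓝 1) ⊓ 𝓟 disc

/-- `limsup_{|φ(z)| → 1} μ(|z|) |φ'(z)|² / (ϕ(|φ(z)|) (1 - |φ(z)|²)^{1/q + 2})`. -/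
def limsupFirst (q : ℝ) (ϕ : ℝ → ℝ) (μ : ℂ → ℝ) (φ : ℂ → ℂ) : ℝ≥0∞ :=
  limsup (fun z => ENNReal.ofReal (μ (‖z‖ : ℂ) * ‖deriv φ z‖ ^ 2 /
    (ϕ ‖φ z‖ * (1 - ‖φ z‖ ^ 2) ^ (1 / q + 2)))) (toBoundary φ)

/-- `limsup_{|φ(z)| → 1} μ(|z|) |φ''(z)| / (ϕ(|φ(z)|) (1 - |φ(z)|²)^{1/q + 1})`. -/
def limsupSecond (q : ℝ) (ϕ : ℝ → ℝ) (μ : ℂ → ℝ) (φ : ℂ → ℂ) : ℝ≥0∞ :=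
  limsup (fun z => ENNReal.ofReal (μ (‖z‖ : ℂ) * ‖deriv (deriv φ) z‖ /
    (ϕ ‖φ z‖ * (1 - ‖φ z‖ ^ 2) ^ (1 / q + 1)))) (toBoundary φ)

end CompOp

end

/-!
The essential norm of `C_φ : H(p,q,ϕ) → Z_μ` is governed by the second derivative
`(f ∘ φ)'' = f''(φ) φ'² + f'(φ) φ''`, and by the sharp size of `f'` and `f''` on the unit ball of
`H(p,q,ϕ)`: near `|z| = t` the `k`-th derivative is at most a constant times
`growth q ϕ k t = 1 / (ϕ(t) (1 - t²)^{1/q + k})`.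

**Growth** (`exists_growth`, `exists_deriv_growth`). By Jensen's formula `log |f|` has the sub-mean
value property, hence so does `|f|^s` for every `s > 0` (`enorm_rpow_le_lintegral_ball`). It is
applied with `s = min p q` in the logarithmic coordinates `z = w e^{x + i y}`, in which the square
`|x|, |y| < (1 - |w|)/4` is a polar rectangle about the origin. Hölder's inequality in `y` and in
`x` then brings in the mixed norm. No monotonicity of the integral means is needed. The derivatives
follow from Cauchy's estimates.

**Lower bound** (`exists_le_essNorm`). The functions
`kernel q ϕ N w z = (1 - |w|²)^{N - 1/q} / (ϕ(|w|) (1 - w̄ z)^N)` with a large integer `N` are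
bounded in `H(p,q,ϕ)` uniformly in `w` (`exists_mixedNorm_kernel_le`), tend to `0` locally uniformly
as `|w| → 1`, and attain the growth rates at `z = w`. Combining the exponents `N` and `N + 1`
isolates either `f'(w)` or `f''(w)`. For a compact `S`, the images under `S` of such functions have
a convergent subsequence, so that `S` is negligible on differences of them, whereas `C_φ` is not
(`le_opNorm_sub_of_frequently`).

**Upper bound** (`exists_essNorm_le`). Let `P f` be a Taylor polynomial of a dilation of `f`. The
operator `C_φ ∘ P` has finite rank, and `f - P f` is small on compact sets and bounded by a multiple
of the growth function everywhere (`exists_taylorDilation_approx`). The part of the norm of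
`C_φ (f - P f)` coming from `|φ(z)| ≤ δ` is thus small, and the part from `|φ(z)| > δ` is
controlled by the two limits superior.

The criterion for compactness follows, since `Z_μ` is complete and a norm limit of compact
operators into a complete space is compact (`isCompactOp_of_essNorm_eq_zero`).
-/

namespace CompOp

/-! ### Sub-mean value properties of `|g|^s` -/

/-- Jensen's formula gives the sub-mean value property of `log |g|`. It passes to `|g|^s` by
Jensen's inequality for the exponential, here in the form of a tangent line bound. -/
lemma norm_rpow_le_circleAverage {s : ℝ} (hs : 0 < s) {g : ℂ → ℂ} {c : ℂ} {R : ℝ} (hR : 0 < R)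
    (hg : AnalyticOnNhd ℂ g (Metric.closedBall c R)) :
    ‖g c‖ ^ s ≤ Real.circleAverage (fun z => ‖g z‖ ^ s) c R := by
  have hRabs : |R| = R := abs_of_pos hR
  rcases eq_or_ne (g c) 0 with h0 | h0
  · rw [h0, norm_zero, Real.zero_rpow hs.ne']
    exact Real.circleAverage_nonneg_of_nonneg fun z _ => by positivity
  have hgR : AnalyticOnNhd ℂ g (Metric.closedBall c |R|) := by rwa [hRabs]
  set m := Real.log ‖g c‖ with hm
  have hlog : m ≤ Real.circleAverage (fun z => Real.log ‖g z‖) c R := by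
    have h := hgR.circleAverage_log_norm hR.ne' h0
    rw [h, hm]
    refine le_add_of_nonneg_left (finsum_nonneg fun u => ?_)
    by_cases hu : u ∈ Metric.closedBall c |R|
    · refine mul_nonneg (mod_cast MeromorphicOn.AnalyticOnNhd.divisor_nonneg hgR u) ?_
      rcases eq_or_ne (c - u) 0 with hcu | hcu
      · simp [hcu]
      · apply Real.log_nonneg
        rw [← div_eq_mul_inv, one_le_div (by simpa using hcu)]
        rw [Metric.mem_closedBall, dist_comm, dist_eq_norm, hRabs] at hu
        exact hu
    · simp [hu]
  have hgs : AnalyticOnNhd ℂ g (Metric.sphere c |R|) := hgR.mono Metric.sphere_subset_closedBall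
  have hint : CircleIntegrable (fun z => Real.log ‖g z‖) c R :=
    hgs.meromorphicOn.circleIntegrable_log_norm
  have hcont : CircleIntegrable (fun z => ‖g z‖ ^ s) c R := by
    apply ContinuousOn.circleIntegrable hR.le
    rw [← hRabs]
    exact hgs.continuousOn.norm.rpow_const fun _ _ => Or.inr hs.le
  -- `A` is the tangent line of `exp` at `s * m`. At a zero of `g`, where `Real.log 0 = 0`, it need
  -- not lie below `|g|^s`. There `A'` is set to `0`, which does not affect the average.
  set A : ℂ → ℝ := fun z => (Real.exp (s * m) * (1 - s * m)) + (Real.exp (s * m) * s) *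
    Real.log ‖g z‖ with hA
  set A' : ℂ → ℝ := fun z => if g z = 0 then 0 else A z with hA'
  have hAint : CircleIntegrable A c R := by
    have h := (circleIntegrable_const (Real.exp (s * m) * (1 - s * m)) c R).add
      (hint.const_fun_smul (a := Real.exp (s * m) * s))
    exact h
  have hAA : A =ᶠ[codiscreteWithin (Metric.sphere c |R|)] A' := by
    have h1 : g ⁻¹' {0}ᶜ ∈ codiscreteWithin (Metric.closedBall c |R|) :=
      hgR.preimage_zero_mem_codiscreteWithin h0 (by simp)
        ((convex_closedBall _ _).isConnected (by simp))
    have h2 := codiscreteWithin_mono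
      (Metric.sphere_subset_closedBall (x := c) (ε := |R|)) h1
    filter_upwards [h2] with z hz
    have hz' : g z ≠ 0 := hz
    simp [hA', hz']
  have hle : ∀ z ∈ Metric.sphere c |R|, A' z ≤ ‖g z‖ ^ s := by
    intro z _
    by_cases hz : g z = 0
    · simp only [hA', hz, if_true]; positivity
    · simp only [hA', hz, if_false, hA]
      rw [Real.rpow_def_of_pos (norm_pos_iff.2 hz)]
      have h := Real.add_one_le_exp (Real.log ‖g z‖ * s - s * m)
      have h2 : Real.exp (Real.log ‖g z‖ * s) =
          Real.exp (s * m) * Real.exp (Real.log ‖g z‖ * s - s * m) := by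
        rw [← Real.exp_add]; congr 1; ring
      rw [h2]
      nlinarith [Real.exp_pos (s * m)]
  have h3 : Real.circleAverage A c R ≤ Real.circleAverage (fun z => ‖g z‖ ^ s) c R := by
    rw [Real.circleAverage_congr_codiscreteWithin hAA hR.ne']
    exact Real.circleAverage_mono (hAint.congr_codiscreteWithin hAA) hcont hle
  refine le_trans ?_ h3
  have h4 : Real.circleAverage A c R = Real.exp (s * m) * (1 - s * m) + (Real.exp (s * m) * s) *
      Real.circleAverage (fun z => Real.log ‖g z‖) c R := by
    have e := Real.circleAverage_add (circleIntegrable_const (Real.exp (s * m) * (1 - s * m)) c R)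
      (hint.const_fun_smul (a := Real.exp (s * m) * s))
    rw [Real.circleAverage_const, Real.circleAverage_fun_smul] at e
    exact e
  rw [h4, Real.rpow_def_of_pos (norm_pos_iff.2 h0), ← hm, mul_comm m s]
  nlinarith [mul_le_mul_of_nonneg_left hlog (mul_pos (Real.exp_pos (s * m)) hs).le]

lemma enorm_rpow_le_lintegral_circle {s : ℝ} (hs : 0 < s) {g : ℂ → ℂ} {c : ℂ} {R : ℝ} (hR : 0 < R)
    (hg : AnalyticOnNhd ℂ g (Metric.closedBall c R)) :
    ENNReal.ofReal (2 * Real.pi) * ‖g c‖ₑ ^ s ≤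
      ∫⁻ θ in Set.Ioo (-Real.pi) Real.pi, ‖g (circleMap c R θ)‖ₑ ^ s := by
  have h := norm_rpow_le_circleAverage hs hR hg
  have hpi := Real.pi_pos
  rw [Real.circleAverage_eq_integral_add (-Real.pi),
    intervalIntegral.integral_comp_add_right (fun θ => ‖g (circleMap c R θ)‖ ^ s), smul_eq_mul,
    inv_mul_eq_div, le_div_iff₀ (by positivity), zero_add,
    show 2 * Real.pi + -Real.pi = Real.pi by ring,
    intervalIntegral.integral_of_le (by linarith), integral_Ioc_eq_integral_Ioo] at h
  have hc : Continuous (fun θ => ‖g (circleMap c R θ)‖ ^ s) := by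
    refine (Continuous.norm ?_).rpow_const fun _ => Or.inr hs.le
    refine hg.continuousOn.comp_continuous (continuous_circleMap c R) fun θ => ?_
    exact circleMap_mem_closedBall c hR.le θ
  have hi : IntegrableOn (fun θ => ‖g (circleMap c R θ)‖ ^ s) (Set.Ioo (-Real.pi) Real.pi) :=
    (hc.integrableOn_Icc).mono_set Set.Ioo_subset_Icc_self
  have e : ∀ w : ℂ, ‖w‖ₑ ^ s = ENNReal.ofReal (‖w‖ ^ s) := fun w => by
    rw [← ofReal_norm, ENNReal.ofReal_rpow_of_nonneg (norm_nonneg _) hs.le]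
  simp only [e]
  rw [← ofReal_integral_eq_lintegral_ofReal hi (ae_of_all _ fun θ => by positivity),
    ← ENNReal.ofReal_mul (by positivity)]
  exact ENNReal.ofReal_le_ofReal (by linarith)

lemma enorm_rpow_le_lintegral_ball {s : ℝ} (hs : 0 < s) {g : ℂ → ℂ} (hgm : Measurable g) {c : ℂ}
    {R : ℝ} (hR : 0 < R) (hg : AnalyticOnNhd ℂ g (Metric.ball c R)) :
    ENNReal.ofReal (Real.pi * R ^ 2) * ‖g c‖ₑ ^ s ≤ ∫⁻ z in Metric.ball c R, ‖g z‖ₑ ^ s := by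
  set F : ℂ → ℝ≥0∞ := fun z => (Metric.ball c R).indicator (fun z => ‖g z‖ₑ ^ s) z with hF
  have hFm : Measurable F := (hgm.enorm.pow_const s).indicator Metric.isOpen_ball.measurableSet
  have h1 : ∫⁻ z in Metric.ball c R, ‖g z‖ₑ ^ s = ∫⁻ z, F (c + z) := by
    rw [lintegral_add_left_eq_self (μ := volume) F c,
      ← lintegral_indicator Metric.isOpen_ball.measurableSet]
  have hpol : ∀ p : ℝ × ℝ, c + Complex.polarCoord.symm p = circleMap c p.1 p.2 := by
    intro p
    simp [circleMap, Complex.exp_mul_I]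
  rw [h1, ← Complex.lintegral_comp_polarCoord_symm (fun z => F (c + z))]
  simp only [hpol, smul_eq_mul]
  have h2 : Set.Ioo (0 : ℝ) R ×ˢ Set.Ioo (-Real.pi) Real.pi ⊆ polarCoord.target := by
    rw [polarCoord_target]
    exact Set.prod_mono Set.Ioo_subset_Ioi_self le_rfl
  refine le_trans ?_ (lintegral_mono_set h2)
  have hmm : Measurable (fun p : ℝ × ℝ => ENNReal.ofReal p.1 * F (circleMap c p.1 p.2)) := by
    refine (by fun_prop : Measurable fun p : ℝ × ℝ => ENNReal.ofReal p.1).mul (hFm.comp ?_)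
    unfold circleMap
    fun_prop
  rw [Measure.volume_eq_prod, ← Measure.prod_restrict, lintegral_prod _ hmm.aemeasurable]
  calc ENNReal.ofReal (Real.pi * R ^ 2) * ‖g c‖ₑ ^ s
      = ∫⁻ t in Set.Ioo (0 : ℝ) R,
          ENNReal.ofReal t * (ENNReal.ofReal (2 * Real.pi) * ‖g c‖ₑ ^ s) := by
        rw [lintegral_mul_const _ (by fun_prop)]
        have : ∫⁻ t in Set.Ioo (0 : ℝ) R, ENNReal.ofReal t = ENNReal.ofReal (R ^ 2 / 2) := by
          rw [← ofReal_integral_eq_lintegral_ofReal]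
          · rw [← integral_Ioc_eq_integral_Ioo, ← intervalIntegral.integral_of_le hR.le,
              integral_id]
            simp
          · exact (continuous_id.integrableOn_Icc).mono_set Set.Ioo_subset_Icc_self
          · exact ae_restrict_of_forall_mem measurableSet_Ioo fun t ht => ht.1.le
        rw [this, ← mul_assoc, ← ENNReal.ofReal_mul (by positivity)]
        congr 2; ring
    _ ≤ _ := by
        refine setLIntegral_mono' measurableSet_Ioo fun t ht => ?_
        rw [lintegral_const_mul' _ _ ENNReal.ofReal_ne_top]
        gcongr
        have hsub : Metric.closedBall c t ⊆ Metric.ball c R :=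
          Metric.closedBall_subset_ball ht.2
        refine (enorm_rpow_le_lintegral_circle hs ht.1 (hg.mono hsub)).trans_eq ?_
        refine lintegral_congr fun θ => ?_
        simp only [hF]
        rw [Set.indicator_of_mem]
        exact hsub (circleMap_mem_closedBall c ht.1.le θ)

/-! ### Normal functions -/

/-- The two growth conditions on a normal function, as a comparison of its values at two points. -/
lemma IsNormal.exists_bounds {ϕ : ℝ → ℝ} (hϕ : IsNormal ϕ) :
    ∃ a b : ℝ, 0 < a ∧ 0 < b ∧ ∀ r s : ℝ, 0 ≤ r → r ≤ s → s < 1 →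
      ϕ s ≤ ϕ r * ((1 - s) / (1 - r)) ^ a ∧ ϕ r * ((1 - s) / (1 - r)) ^ b ≤ ϕ s := by
  obtain ⟨a, b, ha, hab, hanti, -, hmono, -⟩ := hϕ.exists_exponents
  refine ⟨a, b, ha, ha.trans hab, fun r s hr hrs hs => ?_⟩
  have hr' : r ∈ Set.Ico (0 : ℝ) 1 := ⟨hr, hrs.trans_lt hs⟩
  have hs' : s ∈ Set.Ico (0 : ℝ) 1 := ⟨hr.trans hrs, hs⟩
  have h1s : 0 < 1 - s := by linarith
  have h1r : 0 < 1 - r := by linarith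
  have h1 := hanti hr' hs' hrs
  have h2 := hmono hr' hs' hrs
  simp only at h1 h2
  have pa := Real.rpow_pos_of_pos h1s a
  have pb := Real.rpow_pos_of_pos h1s b
  rw [Real.div_rpow h1s.le h1r.le, Real.div_rpow h1s.le h1r.le]
  constructor
  · rw [div_le_iff₀ pa] at h1
    exact h1.trans_eq (by ring)
  · rw [le_div_iff₀ pb] at h2
    exact le_of_eq_of_le (by ring) h2

lemma IsNormal.antitoneOn {ϕ : ℝ → ℝ} (hϕ : IsNormal ϕ) : AntitoneOn ϕ (Set.Ico 0 1) := by
  obtain ⟨a, b, ha, hb, h⟩ := hϕ.exists_bounds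
  intro r hr s hs hrs
  refine (h r s hr.1 hrs hs.2).1.trans ?_
  refine mul_le_of_le_one_right (hϕ.pos r hr).le (Real.rpow_le_one ?_ ?_ ha.le)
  · exact div_nonneg (by linarith [hs.2]) (by linarith [hr.2])
  · rw [div_le_one (by linarith [hr.2])]; linarith

/-! ### Growth of functions in the mixed-norm space -/

/-- Hölder's inequality against the constant function. -/
lemma lintegral_rpow_le_rpow_lintegral {α : Type*} [MeasurableSpace α] {ν : Measure α} {s q : ℝ}
    (hs : 0 < s) (hsq : s ≤ q) {F : α → ℝ≥0∞} (hF : Measurable F) :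
    ∫⁻ x, F x ^ s ∂ν ≤ (∫⁻ x, F x ^ q ∂ν) ^ (s / q) * ν Set.univ ^ (1 - s / q) := by
  have h := eLpNorm'_le_eLpNorm'_mul_rpow_measure_univ (μ := ν) hs hsq
    hF.aestronglyMeasurable
  simp only [eLpNorm', enorm_eq_self] at h
  have h2 := ENNReal.rpow_le_rpow h hs.le
  have hq : 0 < q := hs.trans_le hsq
  rw [← ENNReal.rpow_mul, ENNReal.mul_rpow_of_nonneg _ _ hs.le, ← ENNReal.rpow_mul,
    ← ENNReal.rpow_mul] at h2
  convert h2 using 2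
  · field_simp; simp
  · congr 1; field_simp
  · congr 1; field_simp

/-- The integral mean may be computed over any period of the angle. -/
lemma lintegral_rotate {q : ℝ} (hq : 0 < q) (f : ℂ → ℂ) (r α : ℝ) :
    ∫⁻ y in Set.Ioc (-Real.pi) Real.pi,
      ‖f ((r : ℂ) * Complex.exp (((y + α : ℝ) : ℂ) * Complex.I))‖ₑ ^ q =
      ENNReal.ofReal (2 * Real.pi) * integralMean q f r ^ q := by
  have hpi := Real.pi_pos
  set F : ℝ → ℝ≥0∞ := fun y => ‖f ((r : ℂ) * Complex.exp (((y : ℝ) : ℂ) * Complex.I))‖ₑ ^ q with hF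
  have hper : ∀ (g : AddSubgroup.zmultiples (2 * Real.pi)) (x : ℝ), F (g +ᵥ x) = F x := by
    rintro ⟨_, n, rfl⟩ x
    have : Complex.exp (((n • (2 * Real.pi) + x : ℝ) : ℂ) * Complex.I) =
        Complex.exp ((x : ℂ) * Complex.I) := by
      rw [← Complex.exp_periodic.int_mul n ((x : ℂ) * Complex.I)]
      congr 1
      push_cast [zsmul_eq_mul]
      ring
    change F (n • (2 * Real.pi) + x) = F x
    simp only [hF, this]
  have h1 : ∫⁻ y in Set.Ioc (-Real.pi) Real.pi, F (y + α) =
      ∫⁻ y in Set.Ioc (-Real.pi + α) (-Real.pi + α + 2 * Real.pi), F y := by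
    rw [← lintegral_indicator measurableSet_Ioc, ← lintegral_indicator measurableSet_Ioc,
      ← lintegral_add_right_eq_self ((Set.Ioc (-Real.pi + α)
        (-Real.pi + α + 2 * Real.pi)).indicator F) α]
    refine lintegral_congr fun y => ?_
    simp only [Set.indicator, Set.mem_Ioc]
    congr 1
    refine propext ⟨fun h => ⟨by linarith [h.1], by linarith [h.2]⟩,
      fun h => ⟨by linarith [h.1], by linarith [h.2]⟩⟩
  have h2 := (isAddFundamentalDomain_Ioc (T := 2 * Real.pi) (by positivity)
    (-Real.pi + α)).setLIntegral_eq
      (isAddFundamentalDomain_Ioc (T := 2 * Real.pi) (by positivity) 0) F hper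
  change ∫⁻ y in Set.Ioc (-Real.pi) Real.pi, F (y + α) = _
  rw [h1, h2, zero_add]
  unfold integralMean
  rw [← ENNReal.rpow_mul, one_div_mul_cancel hq.ne', ENNReal.rpow_one, ← mul_assoc,
    ← ENNReal.ofReal_mul (by positivity), mul_one_div_cancel (by positivity), ENNReal.ofReal_one,
    one_mul]
  exact setLIntegral_congr Ioo_ae_eq_Ioc.symm

/-- Hölder's inequality on an arc of angle `2ρ` of the circle of radius `|w| e^x`. -/
lemma lintegral_arc_le {s q : ℝ} (hs : 0 < s) (hsq : s ≤ q) {f : ℂ → ℂ} (hf : f ∈ holDisc) (w : ℂ)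
    (x : ℝ) {ρ : ℝ} (hρπ : ρ ≤ Real.pi) :
    ∫⁻ y in Set.Ioo (-ρ) ρ, ‖f (w * Complex.exp ((x : ℂ) + (y : ℂ) * Complex.I))‖ₑ ^ s ≤
      ENNReal.ofReal (2 * Real.pi) ^ (s / q) * ENNReal.ofReal (2 * ρ) ^ (1 - s / q) *
        integralMean q f (‖w‖ * Real.exp x) ^ s := by
  have hq : 0 < q := hs.trans_le hsq
  have hm : Measurable fun y : ℝ => ‖f (w * Complex.exp ((x : ℂ) + (y : ℂ) * Complex.I))‖ₑ :=
    ((measurable_of_mem hf).comp (by fun_prop)).enorm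
  have hw : ∀ y : ℝ, w * Complex.exp ((x : ℂ) + (y : ℂ) * Complex.I) =
      ((‖w‖ * Real.exp x : ℝ) : ℂ) * Complex.exp (((y + w.arg : ℝ) : ℂ) * Complex.I) := by
    intro y
    conv_lhs => rw [← Complex.norm_mul_exp_arg_mul_I w]
    push_cast
    rw [mul_assoc, ← Complex.exp_add, mul_assoc, ← Complex.exp_add]
    congr 2; ring
  refine (lintegral_rpow_le_rpow_lintegral hs hsq hm).trans ?_
  have h1 : ∫⁻ y in Set.Ioo (-ρ) ρ,
      ‖f (w * Complex.exp ((x : ℂ) + (y : ℂ) * Complex.I))‖ₑ ^ q ≤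
      ENNReal.ofReal (2 * Real.pi) * integralMean q f (‖w‖ * Real.exp x) ^ q := by
    rw [← lintegral_rotate hq f _ w.arg]
    simp only [hw]
    refine lintegral_mono_set fun y hy => ⟨by linarith [hy.1], by linarith [hy.2]⟩
  have h2 : (volume.restrict (Set.Ioo (-ρ) ρ)) Set.univ = ENNReal.ofReal (2 * ρ) := by
    rw [Measure.restrict_apply_univ, Real.volume_Ioo]; congr 1; ring
  rw [h2]
  calc _ ≤ (ENNReal.ofReal (2 * Real.pi) * integralMean q f (‖w‖ * Real.exp x) ^ q) ^ (s / q) *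
        ENNReal.ofReal (2 * ρ) ^ (1 - s / q) := by gcongr
    _ = _ := by
      rw [ENNReal.mul_rpow_of_nonneg _ _ (by positivity), ← ENNReal.rpow_mul,
        mul_div_cancel₀ _ hq.ne']
      ring

/-- The sub-mean value property of `|f|^s` in the logarithmic coordinates `w * exp (x + i y)`. -/
lemma enorm_rpow_le_lintegral_log {s : ℝ} (hs : 0 < s) {f : ℂ → ℂ} (hf : f ∈ holDisc) {w : ℂ}
    {ρ : ℝ} (hρ : 0 < ρ) (hw : ‖w‖ * Real.exp ρ ≤ 1) :
    ENNReal.ofReal (Real.pi * ρ ^ 2) * ‖f w‖ₑ ^ s ≤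
      ∫⁻ x in Set.Ioo (-ρ) ρ, ∫⁻ y in Set.Ioo (-ρ) ρ,
        ‖f (w * Complex.exp ((x : ℂ) + (y : ℂ) * Complex.I))‖ₑ ^ s := by
  set g : ℂ → ℂ := fun ζ => f (w * Complex.exp ζ) with hg
  have hgm : Measurable g := (measurable_of_mem hf).comp (by fun_prop)
  have hre : ∀ ζ ∈ Metric.ball (0 : ℂ) ρ, |ζ.re| < ρ ∧ |ζ.im| < ρ := by
    intro ζ hζ
    rw [mem_ball_zero_iff] at hζ
    exact ⟨(Complex.abs_re_le_norm ζ).trans_lt hζ, (Complex.abs_im_le_norm ζ).trans_lt hζ⟩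
  have hmaps : Set.MapsTo (fun ζ => w * Complex.exp ζ) (Metric.ball 0 ρ) disc := by
    intro ζ hζ
    rw [mem_ball_zero_iff, norm_mul, Complex.norm_exp]
    rcases eq_or_ne w 0 with rfl | hw0
    · simp
    · refine lt_of_lt_of_le ?_ hw
      have := (abs_lt.1 (hre ζ hζ).1).2
      have hw1 : 0 < ‖w‖ := norm_pos_iff.2 hw0
      gcongr
  have hgd : DifferentiableOn ℂ g (Metric.ball 0 ρ) :=
    hf.1.comp (by fun_prop) hmaps
  have h := enorm_rpow_le_lintegral_ball hs hgm hρ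
    (hgd.analyticOnNhd Metric.isOpen_ball)
  have hg0 : g 0 = f w := by simp [hg]
  rw [hg0] at h
  refine h.trans ?_
  have hsub : Metric.ball (0 : ℂ) ρ ⊆ Complex.measurableEquivRealProd ⁻¹'
      (Set.Ioo (-ρ) ρ ×ˢ Set.Ioo (-ρ) ρ) := fun ζ hζ =>
    ⟨abs_lt.1 (hre ζ hζ).1, abs_lt.1 (hre ζ hζ).2⟩
  refine (lintegral_mono_set hsub).trans_eq ?_
  set G : ℝ × ℝ → ℝ≥0∞ := fun p =>
    ‖f (w * Complex.exp ((p.1 : ℂ) + (p.2 : ℂ) * Complex.I))‖ₑ ^ s with hG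
  have hGm : Measurable G := by
    refine (((measurable_of_mem hf).comp ?_).enorm).pow_const s
    fun_prop
  have e : ∀ ζ : ℂ, ‖g ζ‖ₑ ^ s = G (Complex.measurableEquivRealProd ζ) := by
    intro ζ
    simp [hG, hg, Complex.measurableEquivRealProd_apply, Complex.re_add_im]
  simp only [e]
  rw [Complex.volume_preserving_equiv_real_prod.setLIntegral_comp_preimage
    (measurableSet_Ioo.prod measurableSet_Ioo) hGm, Measure.volume_eq_prod,
    ← Measure.prod_restrict, lintegral_prod _ hGm.aemeasurable]

/-- The integral means of a function in the unit ball, over an annulus of width comparable to its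
distance from the unit circle. The weight `ϕ(r)^p / (1 - r)` is nearly constant there. -/
lemma integral_radial_le {p q : ℝ} (hp : 0 < p) {ϕ : ℝ → ℝ} (hϕ : IsNormal ϕ) {b : ℝ}
    (hb0 : 0 < b)
    (hb : ∀ r s : ℝ, 0 ≤ r → r ≤ s → s < 1 → ϕ r * ((1 - s) / (1 - r)) ^ b ≤ ϕ s)
    {f : ℂ → ℂ} (hf : mixedNorm p q ϕ f ≤ 1) {R : ℝ} (hR : 1 / 2 ≤ R) (hR1 : R < 1) :
    ∫⁻ x in Set.Ioo (-((1 - R) / 4)) ((1 - R) / 4), integralMean q f (R * Real.exp x) ^ p ≤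
      ENNReal.ofReal (20 * 2 ^ (b * p) * ((1 - R) / 4) / ϕ R ^ p) := by
  set ρ := (1 - R) / 4 with hρ
  have hρ0 : 0 < ρ := by rw [hρ]; linarith
  have hϕR : 0 < ϕ R := hϕ.pos R ⟨by linarith, hR1⟩
  have hexp : ∀ x ∈ Set.Ioo (-ρ) ρ, R * (1 - ρ) ≤ R * Real.exp x ∧
      1 / 4 ≤ R * Real.exp x ∧ R * Real.exp x ≤ R + 2 * ρ := by
    intro x hx
    have h1 : 1 - ρ ≤ Real.exp x := by linarith [Real.add_one_le_exp x, hx.1]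
    have h2 : Real.exp x ≤ 1 + 2 * ρ := by
      have h3 : (1 + 2 * ρ) * Real.exp (-x) ≥ 1 := by
        have h4 : 1 - ρ ≤ Real.exp (-x) := by linarith [Real.add_one_le_exp (-x), hx.2]
        nlinarith
      rw [Real.exp_neg, ge_iff_le, ← div_eq_mul_inv, le_div_iff₀ (Real.exp_pos x)] at h3
      linarith
    refine ⟨by gcongr, ?_, ?_⟩ <;> nlinarith
  set J : Set ℝ := (fun x => R * Real.exp x) '' Set.Ioo (-ρ) ρ with hJ
  have hJs : J ⊆ Set.Ioo 0 1 := by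
    rintro _ ⟨x, hx, rfl⟩
    obtain ⟨_, h2, h3⟩ := hexp x hx
    exact ⟨by simp only; linarith, by simp only; linarith⟩
  -- the weight is bounded below on the annulus
  set κ : ℝ := ϕ R ^ p / (2 ^ (b * p) * (5 * ρ)) with hκ
  have hκ0 : 0 < κ := by positivity
  have hwt : ∀ r ∈ J, κ ≤ ϕ r ^ p / (1 - r) := by
    intro r hr
    have hr1 : 0 < 1 - r := by linarith [(hJs hr).2]
    have hr0 : 0 < r := (hJs hr).1
    obtain ⟨x, hx, rfl⟩ := hr
    obtain ⟨h1, h2, h3⟩ := hexp x hx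
    simp only at hr1 hr0 ⊢
    set r := R * Real.exp x
    have h5 : 1 - r ≤ 5 * ρ := by nlinarith
    have h6 : ϕ R * (1 / 2) ^ b ≤ ϕ r := by
      rcases le_total R r with h | h
      · refine le_trans ?_ (hb R r (by linarith) h (by linarith))
        refine mul_le_mul_of_nonneg_left (Real.rpow_le_rpow (by norm_num) ?_ hb0.le) hϕR.le
        rw [le_div_iff₀ (by linarith)]; linarith
      · refine le_trans ?_ (hϕ.antitoneOn ⟨hr0.le, by linarith⟩ ⟨by linarith, hR1⟩ h)
        exact mul_le_of_le_one_right hϕR.le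
          (Real.rpow_le_one (by norm_num) (by norm_num) hb0.le)
    have h7 : ϕ R ^ p / 2 ^ (b * p) ≤ ϕ r ^ p := by
      refine le_trans (le_of_eq ?_) (Real.rpow_le_rpow (by positivity) h6 hp.le)
      rw [Real.mul_rpow hϕR.le (by positivity), ← Real.rpow_mul (by norm_num), one_div,
        Real.inv_rpow (by norm_num)]
      rfl
    rw [hκ, ← div_div]
    exact div_le_div₀ (le_trans (by positivity) h7) h7 hr1 h5
  have hM : ∫⁻ r in J, integralMean q f r ^ p ≤ ENNReal.ofReal κ⁻¹ := by
    have h1 : ENNReal.ofReal κ * ∫⁻ r in J, integralMean q f r ^ p ≤ 1 := by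
      have h2 : ∫⁻ r in Set.Ioo (0 : ℝ) 1,
          integralMean q f r ^ p * ENNReal.ofReal (ϕ r ^ p / (1 - r)) ≤ 1 := by
        unfold mixedNorm at hf
        rwa [← ENNReal.one_rpow (1 / p), ENNReal.rpow_le_rpow_iff (by positivity)] at hf
      refine le_trans ?_ h2
      rw [← lintegral_const_mul' _ _ ENNReal.ofReal_ne_top]
      refine le_trans ?_ (lintegral_mono_set hJs)
      have hJm : MeasurableSet J := by
        have hc : Continuous fun x => R * Real.exp x := by fun_prop
        exact (isPreconnected_Ioo.image _ hc.continuousOn).ordConnected.measurableSet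
      refine setLIntegral_mono' hJm fun r hr => ?_
      rw [mul_comm]
      gcongr
      exact hwt r hr
    rw [mul_comm, ← ENNReal.le_div_iff_mul_le
      (Or.inl (by simpa using hκ0)) (Or.inl ENNReal.ofReal_ne_top)] at h1
    rwa [ENNReal.ofReal_inv_of_pos hκ0, ← one_div]
  have hcv := lintegral_image_eq_lintegral_abs_deriv_mul (measurableSet_Ioo (a := -ρ) (b := ρ))
    (f := fun x => R * Real.exp x) (f' := fun x => R * Real.exp x)
    (fun x _ => ((Real.hasDerivAt_exp x).const_mul R).hasDerivWithinAt)
    (fun x _ y _ h => Real.exp_injective (mul_left_cancel₀ (by linarith : R ≠ 0) h))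
    (fun r => integralMean q f r ^ p)
  -- the substitution `r = R e^x`; the derivative is `r ≥ 1/4`
  have hq4 : ∫⁻ x in Set.Ioo (-ρ) ρ, integralMean q f (R * Real.exp x) ^ p ≤
      4 * ∫⁻ r in J, integralMean q f r ^ p := by
    rw [hcv, ← lintegral_const_mul' _ _ (by simp)]
    refine setLIntegral_mono' measurableSet_Ioo fun x hx => ?_
    rw [← mul_assoc]
    refine le_mul_of_one_le_left zero_le ?_
    have h4 : (4 : ℝ≥0∞) = ENNReal.ofReal 4 := by simp
    rw [h4, ← ENNReal.ofReal_mul (by norm_num), ENNReal.one_le_ofReal]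
    linarith [(hexp x hx).2.1, le_abs_self (R * Real.exp x)]
  refine hq4.trans ((mul_le_mul_right hM 4).trans_eq ?_)
  have h4 : (4 : ℝ≥0∞) = ENNReal.ofReal 4 := by simp
  rw [h4, ← ENNReal.ofReal_mul (by norm_num), hκ]
  congr 1
  field_simp
  ring

/-- Growth of the unit ball of `H(p,q,ϕ)` away from the origin. -/
lemma exists_growth_annulus {p q : ℝ} (hp : 0 < p) (hq : 0 < q) {ϕ : ℝ → ℝ} (hϕ : IsNormal ϕ) :
    ∃ C : ℝ, 0 < C ∧ ∀ f ∈ holDisc, mixedNorm p q ϕ f ≤ 1 → ∀ w ∈ disc, 1 / 2 ≤ ‖w‖ →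
      ‖f w‖ ≤ C / (ϕ ‖w‖ * (1 - ‖w‖) ^ (1 / q)) := by
  obtain ⟨a, b, ha, hb0, hab⟩ := hϕ.exists_bounds
  set s := min p q with hs
  have hs0 : 0 < s := lt_min hp hq
  have hsp : s ≤ p := min_le_left _ _
  have hsq : s ≤ q := min_le_right _ _
  have hpi := Real.pi_pos
  set K : ℝ := (2 * Real.pi) ^ (s / q) * 2 ^ (1 - s / q) * 2 ^ (1 - s / p) *
    (20 * 2 ^ (b * p)) ^ (s / p) / Real.pi with hK
  have hK0 : 0 < K := by positivity
  refine ⟨K ^ (1 / s) * 4 ^ (1 / q), by positivity, fun f hf hfn w hw hw2 => ?_⟩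
  have hw1 : ‖w‖ < 1 := by simpa using hw
  set R := ‖w‖ with hR
  set ρ := (1 - R) / 4 with hρ
  have hρ0 : 0 < ρ := by rw [hρ]; linarith
  have hϕR : 0 < ϕ R := hϕ.pos R ⟨by linarith, hw1⟩
  have hexpρ : R * Real.exp ρ ≤ 1 := by
    have h3 : 1 - ρ ≤ Real.exp (-ρ) := by linarith [Real.add_one_le_exp (-ρ)]
    rw [← div_one (Real.exp ρ), ← Real.exp_zero, show (0 : ℝ) = ρ - ρ by ring]
    have h4 : Real.exp ρ * Real.exp (-ρ) = 1 := by rw [← Real.exp_add]; simp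
    have h5 := Real.exp_pos ρ
    have h6 : Real.exp ρ * (1 - ρ) ≤ 1 := by nlinarith
    simp only [sub_self, Real.exp_zero, div_one]
    nlinarith
  have main : ENNReal.ofReal (Real.pi * ρ ^ 2) * ‖f w‖ₑ ^ s ≤
      ENNReal.ofReal (2 * Real.pi) ^ (s / q) * ENNReal.ofReal (2 * ρ) ^ (1 - s / q) *
        (ENNReal.ofReal (20 * 2 ^ (b * p) * ρ / ϕ R ^ p) ^ (s / p) *
          ENNReal.ofReal (2 * ρ) ^ (1 - s / p)) := by
    refine (enorm_rpow_le_lintegral_log hs0 hf hρ0 hexpρ).trans ?_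
    have h1 : ∀ x : ℝ, ∫⁻ y in Set.Ioo (-ρ) ρ,
        ‖f (w * Complex.exp ((x : ℂ) + (y : ℂ) * Complex.I))‖ₑ ^ s ≤
        ENNReal.ofReal (2 * Real.pi) ^ (s / q) * ENNReal.ofReal (2 * ρ) ^ (1 - s / q) *
        integralMean q f (R * Real.exp x) ^ s := fun x =>
      lintegral_arc_le hs0 hsq hf w x (by linarith [Real.pi_gt_three])
    refine (lintegral_mono h1).trans ?_
    have hsq1 : 0 ≤ 1 - s / q := by rw [sub_nonneg, div_le_one hq]; exact hsq
    rw [lintegral_const_mul' _ _ (ENNReal.mul_ne_top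
      (ENNReal.rpow_ne_top_of_nonneg (by positivity) ENNReal.ofReal_ne_top)
      (ENNReal.rpow_ne_top_of_nonneg hsq1 ENNReal.ofReal_ne_top))]
    gcongr
    have hm : Measurable fun x : ℝ => integralMean q f (R * Real.exp x) :=
      (measurable_integralMean q hf).comp (by fun_prop)
    refine (lintegral_rpow_le_rpow_lintegral hs0 hsp hm).trans ?_
    have h2 : (volume.restrict (Set.Ioo (-ρ) ρ)) Set.univ = ENNReal.ofReal (2 * ρ) := by
      rw [Measure.restrict_apply_univ, Real.volume_Ioo]; congr 1; ring
    rw [h2]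
    gcongr
    exact integral_radial_le hp hϕ hb0 (fun r s h1 h2 h3 => (hab r s h1 h2 h3).2) hfn hw2 hw1
  have hreal : Real.pi * ρ ^ 2 * ‖f w‖ ^ s ≤ (2 * Real.pi) ^ (s / q) * (2 * ρ) ^ (1 - s / q) *
        ((20 * 2 ^ (b * p) * ρ / ϕ R ^ p) ^ (s / p) * (2 * ρ) ^ (1 - s / p)) := by
    rw [← ofReal_norm, ENNReal.ofReal_rpow_of_nonneg (norm_nonneg _) hs0.le,
      ENNReal.ofReal_rpow_of_pos (by positivity), ENNReal.ofReal_rpow_of_pos (by positivity),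
      ENNReal.ofReal_rpow_of_pos (by positivity), ENNReal.ofReal_rpow_of_pos (by positivity),
      ← ENNReal.ofReal_mul (by positivity), ← ENNReal.ofReal_mul (by positivity),
      ← ENNReal.ofReal_mul (by positivity), ← ENNReal.ofReal_mul (by positivity)] at main
    exact (ENNReal.ofReal_le_ofReal_iff (by positivity)).1 main
  clear_value ρ
  have hρq : (1 - R) ^ (1 / q) = 4 ^ (1 / q) * ρ ^ (1 / q) := by
    rw [← Real.mul_rpow (by norm_num) hρ0.le, hρ]; congr 1; ring
  have hgoal : ‖f w‖ ^ s ≤ (K ^ (1 / s) / (ϕ R * ρ ^ (1 / q))) ^ s := by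
    rw [Real.div_rpow (by positivity) (by positivity), ← Real.rpow_mul hK0.le,
      one_div_mul_cancel hs0.ne', Real.rpow_one, Real.mul_rpow hϕR.le (by positivity),
      ← Real.rpow_mul hρ0.le]
    rw [Real.mul_rpow (by norm_num) hρ0.le, Real.mul_rpow (by norm_num) hρ0.le,
      Real.div_rpow (by positivity) (by positivity), Real.mul_rpow (by positivity) hρ0.le,
      ← Real.rpow_mul hϕR.le, mul_div_cancel₀ _ hp.ne'] at hreal
    have e2 : ρ ^ (1 - s / q) * ρ ^ (s / p) * ρ ^ (1 - s / p) * ρ ^ (1 / q * s) = ρ ^ 2 := by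
      rw [← Real.rpow_add hρ0, ← Real.rpow_add hρ0, ← Real.rpow_add hρ0, ← Real.rpow_natCast]
      congr 1
      push_cast
      ring
    have pz := Real.rpow_pos_of_pos hϕR s
    have pr := Real.rpow_pos_of_pos hρ0 (1 / q * s)
    rw [le_div_iff₀ (by positivity), hK, le_div_iff₀ hpi]
    refine le_of_mul_le_mul_left ?_ (pow_pos hρ0 2)
    calc ρ ^ 2 * (‖f w‖ ^ s * (ϕ R ^ s * ρ ^ (1 / q * s)) * Real.pi)
        = (Real.pi * ρ ^ 2 * ‖f w‖ ^ s) * (ϕ R ^ s * ρ ^ (1 / q * s)) := by ring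
      _ ≤ _ := mul_le_mul_of_nonneg_right hreal (by positivity)
      _ = (ρ ^ (1 - s / q) * ρ ^ (s / p) * ρ ^ (1 - s / p) * ρ ^ (1 / q * s)) *
          ((2 * Real.pi) ^ (s / q) * 2 ^ (1 - s / q) * 2 ^ (1 - s / p) *
          (20 * 2 ^ (b * p)) ^ (s / p)) := by field_simp
      _ = _ := by rw [e2]
  have h := (Real.rpow_le_rpow_iff (norm_nonneg _) (by positivity) hs0).1 hgoal
  refine h.trans_eq ?_
  rw [hρq]
  field_simp

/-- The growth function of order `k` attached to `H(p,q,ϕ)`: the size near `|z| = t` of the `k`-th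
derivatives of functions in the unit ball, up to a constant factor. -/
noncomputable def growth (q : ℝ) (ϕ : ℝ → ℝ) (k t : ℝ) : ℝ := (ϕ t * (1 - t ^ 2) ^ (1 / q + k))⁻¹

lemma growth_pos {q : ℝ} {ϕ : ℝ → ℝ} (hϕ : IsNormal ϕ) (k : ℝ) {t : ℝ} (ht0 : 0 ≤ t)
    (ht1 : t < 1) : 0 < growth q ϕ k t := by
  have h1 := hϕ.pos t ⟨ht0, ht1⟩
  have h2 : 0 < 1 - t ^ 2 := by nlinarith
  unfold growth
  positivity

lemma growth_mono {q : ℝ} (hq : 0 < q) {ϕ : ℝ → ℝ} (hϕ : IsNormal ϕ) {k : ℝ} (hk : 0 ≤ k)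
    {t u : ℝ} (ht0 : 0 ≤ t) (htu : t ≤ u) (hu1 : u < 1) :
    growth q ϕ k t ≤ growth q ϕ k u := by
  have h1 := hϕ.pos u ⟨ht0.trans htu, hu1⟩
  have h2 : 0 < 1 - u ^ 2 := by nlinarith
  have h3 := hϕ.antitoneOn ⟨ht0, htu.trans_lt hu1⟩ ⟨ht0.trans htu, hu1⟩ htu
  have h4 := h1.le.trans h3
  unfold growth
  gcongr

/-- Growth of the unit ball of `H(p,q,ϕ)`. -/
lemma exists_growth {p q : ℝ} (hp : 0 < p) (hq : 0 < q) {ϕ : ℝ → ℝ} (hϕ : IsNormal ϕ) :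
    ∃ C : ℝ, 0 < C ∧ ∀ f ∈ holDisc, mixedNorm p q ϕ f ≤ 1 → ∀ w ∈ disc,
      ‖f w‖ ≤ C * growth q ϕ 0 ‖w‖ := by
  obtain ⟨C, hC, hmain⟩ := exists_growth_annulus hp hq hϕ
  have hann : ∀ f ∈ holDisc, mixedNorm p q ϕ f ≤ 1 → ∀ w ∈ disc, 1 / 2 ≤ ‖w‖ →
      ‖f w‖ ≤ C * 2 ^ (1 / q) * growth q ϕ 0 ‖w‖ := by
    intro f hf hfn w hw hw2
    have hw1 : ‖w‖ < 1 := by simpa using hw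
    have hϕw := hϕ.pos ‖w‖ ⟨norm_nonneg _, hw1⟩
    refine (hmain f hf hfn w hw hw2).trans ?_
    have h0 : 0 < 1 - ‖w‖ := by linarith
    have h1 : (1 - ‖w‖ ^ 2) ^ (1 / q) ≤ 2 ^ (1 / q) * (1 - ‖w‖) ^ (1 / q) := by
      rw [← Real.mul_rpow (by norm_num) h0.le]
      have : 0 < 1 - ‖w‖ ^ 2 := by nlinarith
      gcongr
      nlinarith
    have h2 : 0 < 1 - ‖w‖ ^ 2 := by nlinarith
    unfold growth
    rw [add_zero, div_eq_mul_inv, mul_assoc]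
    gcongr
    rw [← div_eq_mul_inv, le_div_iff₀ (by positivity), inv_mul_eq_div, div_le_iff₀ (by positivity)]
    calc _ ≤ ϕ ‖w‖ * (2 ^ (1 / q) * (1 - ‖w‖) ^ (1 / q)) := by gcongr
      _ = _ := by ring
  set G0 := growth q ϕ 0 0
  set Gh := growth q ϕ 0 (1 / 2)
  have hG0 : 0 < G0 := growth_pos hϕ 0 le_rfl one_pos
  have hGh : 0 < Gh := growth_pos hϕ 0 (by norm_num) (by norm_num)
  have hG : G0 ≤ Gh := growth_mono hq hϕ le_rfl le_rfl (by norm_num) (by norm_num)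
  refine ⟨C * 2 ^ (1 / q) * (Gh / G0), by positivity, fun f hf hfn w hw => ?_⟩
  have hw1 : ‖w‖ < 1 := by simpa using hw
  have hGw : G0 ≤ growth q ϕ 0 ‖w‖ := growth_mono hq hϕ le_rfl le_rfl (norm_nonneg _) hw1
  have hGwpos := hG0.trans_le hGw
  rcases le_or_gt (1 / 2) ‖w‖ with h | h
  · refine (hann f hf hfn w hw h).trans ?_
    refine mul_le_mul_of_nonneg_right ?_ hGwpos.le
    exact le_mul_of_one_le_right (by positivity) ((one_le_div hG0).2 hG)
  -- near the origin, where logarithmic coordinates degenerate, by the maximum principle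
  · have hb : ‖f w‖ ≤ C * 2 ^ (1 / q) * Gh := by
      refine Complex.norm_le_of_forall_mem_frontier_norm_le (U := Metric.ball 0 (1 / 2))
        Metric.isBounded_ball ?_ ?_ (subset_closure (by simpa using h))
      · refine DifferentiableOn.diffContOnCl (hf.1.mono ?_)
        refine Metric.closure_ball_subset_closedBall.trans
          (Metric.closedBall_subset_ball (by norm_num))
      · intro z hz
        rw [frontier_ball _ (by norm_num), mem_sphere_zero_iff_norm] at hz
        have := hann f hf hfn z (by rw [mem_ball_zero_iff, hz]; norm_num) hz.ge
        rwa [hz] at this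
    refine hb.trans ?_
    calc C * 2 ^ (1 / q) * Gh = C * 2 ^ (1 / q) * (Gh / G0) * G0 := by field_simp
      _ ≤ _ := by gcongr

lemma norm_deriv_le_of_forall_closedBall {E : ℂ → ℂ} (hE : DifferentiableOn ℂ E disc) {w : ℂ}
    {ρ M : ℝ} (hρ : 0 < ρ) (hw : ‖w‖ + ρ < 1) (hM : ∀ z, ‖z‖ ≤ ‖w‖ + ρ → ‖E z‖ ≤ M) :
    ‖deriv E w‖ ≤ M / ρ ∧ ‖deriv (deriv E) w‖ ≤ 2 * M / ρ ^ 2 := by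
  have hsub : closure (Metric.ball w ρ) ⊆ disc := by
    refine Metric.closure_ball_subset_closedBall.trans fun z hz => ?_
    rw [mem_closedBall_iff_norm] at hz
    rw [mem_ball_zero_iff]
    linarith [norm_le_norm_add_norm_sub' z w]
  have hd : DiffContOnCl ℂ E (Metric.ball w ρ) := (hE.mono hsub).diffContOnCl
  have hs : ∀ z ∈ Metric.sphere w ρ, ‖E z‖ ≤ M := by
    intro z hz
    rw [mem_sphere_iff_norm] at hz
    exact hM z (by linarith [norm_le_norm_add_norm_sub' z w])
  have h1 := Complex.norm_iteratedDeriv_le_of_forall_mem_sphere_norm_le 1 hρ hd hs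
  have h2 := Complex.norm_iteratedDeriv_le_of_forall_mem_sphere_norm_le 2 hρ hd hs
  rw [iteratedDeriv_one] at h1
  rw [iteratedDeriv_succ, iteratedDeriv_one] at h2
  exact ⟨by simpa using h1, by simpa using h2⟩

lemma growth_add {q : ℝ} {ϕ : ℝ → ℝ} (k : ℝ) (n : ℕ) {t : ℝ} (ht : 0 < 1 - t ^ 2) :
    growth q ϕ (k + n) t = growth q ϕ k t / (1 - t ^ 2) ^ n := by
  unfold growth
  rw [← add_assoc, Real.rpow_add_natCast ht.ne', ← mul_assoc, mul_inv,
    ← div_eq_mul_inv]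

/-- A bound by the growth function passes to the first two derivatives, by Cauchy's estimates. -/
lemma exists_deriv_growth {q : ℝ} (hq : 0 < q) {ϕ : ℝ → ℝ} (hϕ : IsNormal ϕ) :
    ∃ c : ℝ, 0 < c ∧ ∀ (E : ℂ → ℂ) (K : ℝ), DifferentiableOn ℂ E disc →
      (∀ z ∈ disc, ‖E z‖ ≤ K * growth q ϕ 0 ‖z‖) → ∀ w ∈ disc,
        ‖deriv E w‖ ≤ c * K * growth q ϕ 1 ‖w‖ ∧
        ‖deriv (deriv E) w‖ ≤ c * K * growth q ϕ 2 ‖w‖ := by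
  obtain ⟨a, b, ha, hb0, hab⟩ := hϕ.exists_bounds
  refine ⟨32 * (2 ^ b * 4 ^ (1 / q)), by positivity, fun E K hE hK w hw => ?_⟩
  have hw1 : ‖w‖ < 1 := by simpa using hw
  have hw0 := norm_nonneg w
  set t := ‖w‖
  have hK0 : 0 ≤ K := by
    have h := (norm_nonneg _).trans (hK 0 (by simp))
    rw [norm_zero] at h
    exact nonneg_of_mul_nonneg_left h (growth_pos hϕ 0 le_rfl one_pos)
  set u := (1 + t) / 2 with hu
  have hu0 : 0 ≤ u := by positivity
  have hu1 : u < 1 := by rw [hu]; linarith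
  have h1t : 0 < 1 - t ^ 2 := by nlinarith
  have h1u : (1 - t ^ 2) / 4 ≤ 1 - u ^ 2 := by rw [hu]; nlinarith
  have hϕt := hϕ.pos t ⟨hw0, hw1⟩
  have hgu : growth q ϕ 0 u ≤ 2 ^ b * 4 ^ (1 / q) * growth q ϕ 0 t := by
    unfold growth
    rw [add_zero]
    have h2 : ϕ t * (1 / 2) ^ b ≤ ϕ u := by
      refine le_trans (le_of_eq ?_) (hab t u hw0 (by rw [hu]; linarith) hu1).2
      congr 2
      rw [eq_div_iff (by linarith), hu]; ring
    have h4 : 0 < ϕ u := hϕ.pos u ⟨hu0, hu1⟩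
    have h3 : ((1 - t ^ 2) / 4) ^ (1 / q) ≤ (1 - u ^ 2) ^ (1 / q) := by gcongr
    calc (ϕ u * (1 - u ^ 2) ^ (1 / q))⁻¹
        ≤ ((ϕ t * (1 / 2) ^ b) * ((1 - t ^ 2) / 4) ^ (1 / q))⁻¹ := by gcongr
      _ = _ := by
        rw [Real.div_rpow h1t.le (by norm_num), Real.div_rpow (by norm_num) (by norm_num),
          Real.one_rpow]
        field_simp
  have hM : ∀ z, ‖z‖ ≤ t + (1 - t) / 2 →
      ‖E z‖ ≤ K * (2 ^ b * 4 ^ (1 / q) * growth q ϕ 0 t) := by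
    intro z hz
    have hzu : ‖z‖ ≤ u := by rw [hu]; linarith
    refine (hK z (by rw [mem_ball_zero_iff]; linarith)).trans ?_
    exact mul_le_mul_of_nonneg_left
      ((growth_mono hq hϕ le_rfl (norm_nonneg z) hzu hu1).trans hgu) hK0
  have hC := norm_deriv_le_of_forall_closedBall hE (w := w) (ρ := (1 - t) / 2)
    (by linarith) (show t + _ < 1 by linarith) hM
  have hg0 := growth_pos (q := q) hϕ 0 hw0 hw1
  set D : ℝ := 2 ^ b * 4 ^ (1 / q) with hD
  have hD0 : 0 < D := by positivity
  have e1 := growth_add (q := q) (ϕ := ϕ) 0 1 h1t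
  have e2 := growth_add (q := q) (ϕ := ϕ) 0 2 h1t
  norm_num at e1 e2
  rw [e1, e2]
  have hρ : (1 - t ^ 2) / 4 ≤ (1 - t) / 2 := by nlinarith
  refine ⟨hC.1.trans ?_, hC.2.trans ?_⟩
  · calc K * (D * growth q ϕ 0 t) / ((1 - t) / 2)
        ≤ K * (D * growth q ϕ 0 t) / ((1 - t ^ 2) / 4) := by gcongr
      _ = 4 * (D * K * (growth q ϕ 0 t / (1 - t ^ 2))) := by field_simp
      _ ≤ 32 * (D * K * (growth q ϕ 0 t / (1 - t ^ 2))) := by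
        gcongr; norm_num
      _ = _ := by ring
  · calc 2 * (K * (D * growth q ϕ 0 t)) / ((1 - t) / 2) ^ 2
        ≤ 2 * (K * (D * growth q ϕ 0 t)) / ((1 - t ^ 2) / 4) ^ 2 := by gcongr
      _ = _ := by field_simp; ring

/-! ### Norm estimates for the test functions -/

lemma lintegral_Ioi_rpow {c κ : ℝ} (hc : 0 < c) (hκ : 0 < κ) :
    ∫⁻ y in Set.Ioi c, ENNReal.ofReal (y ^ (-κ - 1)) = ENNReal.ofReal (c ^ (-κ) / κ) := by
  rw [← ofReal_integral_eq_lintegral_ofReal (integrableOn_Ioi_rpow_of_lt (by linarith) hc)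
    (ae_restrict_of_forall_mem measurableSet_Ioi fun y hy =>
      Real.rpow_nonneg (hc.trans hy).le _), integral_Ioi_rpow_of_lt (by linarith) hc]
  congr 1
  rw [sub_add_cancel, neg_div_neg_eq]

lemma lintegral_Ioc_rpow {c κ : ℝ} (hc : 0 < c) (hκ : 0 < κ) :
    ∫⁻ y in Set.Ioc 0 c, ENNReal.ofReal (y ^ (κ - 1)) = ENNReal.ofReal (c ^ κ / κ) := by
  have hi := intervalIntegral.intervalIntegrable_rpow' (a := 0) (b := c) (r := κ - 1)
    (by linarith)
  rw [intervalIntegrable_iff_integrableOn_Ioc_of_le hc.le] at hi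
  rw [← ofReal_integral_eq_lintegral_ofReal hi
    (ae_restrict_of_forall_mem measurableSet_Ioc fun y hy => Real.rpow_nonneg hy.1.le _),
    ← intervalIntegral.integral_of_le hc.le, integral_rpow (Or.inl (by linarith))]
  congr 1
  rw [sub_add_cancel, Real.zero_rpow hκ.ne', sub_zero]

lemma le_norm_one_sub_mul_exp {x : ℝ} (hx0 : 0 ≤ x) (hx1 : x < 1) {y : ℝ} (hy : |y| ≤ Real.pi) :
    1 - x ≤ ‖1 - (x : ℂ) * Complex.exp (y * Complex.I)‖ ∧
      |y| / Real.pi ≤ ‖1 - (x : ℂ) * Complex.exp (y * Complex.I)‖ := by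
  have hpi := Real.pi_pos
  have he : ‖Complex.exp (y * Complex.I)‖ = 1 := Complex.norm_exp_ofReal_mul_I y
  have h1 : 1 - x ≤ ‖1 - (x : ℂ) * Complex.exp (y * Complex.I)‖ := by
    have h := norm_sub_norm_le (1 : ℂ) ((x : ℂ) * Complex.exp (y * Complex.I))
    rwa [norm_one, norm_mul, he, Complex.norm_real, Real.norm_of_nonneg hx0, mul_one] at h
  refine ⟨h1, ?_⟩
  have h2 : 2 * (|y| / Real.pi) ≤ ‖1 - Complex.exp (y * Complex.I)‖ := by
    have h3 : ‖1 - Complex.exp (y * Complex.I)‖ = ‖2 * Real.sin (y / 2)‖ := by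
      rw [norm_sub_rev, mul_comm (y : ℂ), Complex.norm_exp_I_mul_ofReal_sub_one]
    rw [h3, norm_mul, Real.norm_eq_abs, Real.norm_eq_abs, abs_two]
    have h4 : |Real.sin (y / 2)| = Real.sin (|y| / 2) := by
      have : |y| / 2 = |y / 2| := by rw [abs_div, abs_two]
      rw [this]
      exact (Real.abs_sin_eq_sin_abs_of_abs_le_pi (by rw [abs_div, abs_two]; linarith))
    rw [h4]
    have h5 := Real.mul_le_sin (x := |y| / 2) (by positivity) (by linarith)
    have h6 : 2 / Real.pi * (|y| / 2) = |y| / Real.pi := by field_simp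
    linarith
  have h7 : ‖1 - Complex.exp (y * Complex.I)‖ ≤
      ‖1 - (x : ℂ) * Complex.exp (y * Complex.I)‖ + (1 - x) := by
    have e : 1 - Complex.exp (y * Complex.I) = (1 - (x : ℂ) * Complex.exp (y * Complex.I)) -
      ((1 - x : ℝ) : ℂ) * Complex.exp (y * Complex.I) := by push_cast; ring
    rw [e]
    refine (norm_sub_le _ _).trans ?_
    rw [norm_mul, he, Complex.norm_real, Real.norm_of_nonneg (by linarith), mul_one]
  linarith

/-- The integrals of negative powers of `|1 - x e^{iy}|` over the circle. -/
lemma lintegral_circle_kernel_le {s : ℝ} (hs : 1 < s) {x : ℝ} (hx0 : 0 ≤ x) (hx1 : x < 1) :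
    ∫⁻ y in Set.Ioc (-Real.pi) Real.pi,
      ENNReal.ofReal (‖1 - (x : ℂ) * Complex.exp (y * Complex.I)‖ ^ (-s)) ≤
      ENNReal.ofReal ((2 + 2 * Real.pi ^ s / (s - 1)) * (1 - x) ^ (1 - s)) := by
  have hpi := Real.pi_pos
  set c := 1 - x with hc
  have hc0 : 0 < c := by rw [hc]; linarith
  set A : ℝ → ℝ≥0∞ := (Set.Icc (-c) c).indicator fun _ => ENNReal.ofReal (c ^ (-s)) with hA
  set B : ℝ → ℝ≥0∞ := (Set.Ioi c).indicator
    fun y => ENNReal.ofReal (Real.pi ^ s) * ENNReal.ofReal (y ^ (-(s - 1) - 1)) with hB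
  have hAm : Measurable A := measurable_const.indicator measurableSet_Icc
  have hBm : Measurable B := by
    refine Measurable.indicator ?_ measurableSet_Ioi
    fun_prop
  have hpt : ∀ y ∈ Set.Ioc (-Real.pi) Real.pi,
      ENNReal.ofReal (‖1 - (x : ℂ) * Complex.exp (y * Complex.I)‖ ^ (-s)) ≤
        A y + (B y + B (-y)) := by
    intro y hy
    obtain ⟨h1, h2⟩ := le_norm_one_sub_mul_exp hx0 hx1 (abs_le.2 ⟨hy.1.le, hy.2⟩)
    by_cases hyc : |y| ≤ c
    · refine le_add_of_le_of_nonneg ?_ zero_le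
      rw [hA, Set.indicator_of_mem (show y ∈ Set.Icc (-c) c from abs_le.1 hyc)]
      exact ENNReal.ofReal_le_ofReal (Real.rpow_le_rpow_of_nonpos hc0 h1 (by linarith))
    · push Not at hyc
      have hBy : ENNReal.ofReal (‖1 - (x : ℂ) * Complex.exp (y * Complex.I)‖ ^ (-s)) ≤ B |y| := by
        rw [hB, Set.indicator_of_mem (by exact hyc), ← ENNReal.ofReal_mul (by positivity)]
        refine ENNReal.ofReal_le_ofReal ?_
        have hy0 : 0 < |y| := hc0.trans hyc
        refine (Real.rpow_le_rpow_of_nonpos (by positivity) h2 (by linarith)).trans_eq ?_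
        rw [Real.div_rpow (abs_nonneg y) hpi.le, Real.rpow_neg hpi.le,
          show -(s - 1) - 1 = -s by ring]
        field_simp
      refine hBy.trans (le_add_of_nonneg_of_le zero_le ?_)
      rcases abs_choice y with h | h <;> rw [h]
      · exact le_self_add
      · exact le_add_self
  have hBi : ∫⁻ y, B y = ENNReal.ofReal (Real.pi ^ s * (c ^ (1 - s) / (s - 1))) := by
    rw [hB, lintegral_indicator measurableSet_Ioi, lintegral_const_mul' _ _ ENNReal.ofReal_ne_top,
      lintegral_Ioi_rpow hc0 (by linarith), ← ENNReal.ofReal_mul (by positivity), neg_sub]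
  have hAi : ∫⁻ y, A y = ENNReal.ofReal (2 * c ^ (1 - s)) := by
    rw [hA, lintegral_indicator measurableSet_Icc, setLIntegral_const, Real.volume_Icc,
      ← ENNReal.ofReal_mul (by positivity)]
    congr 1
    rw [show (1 - s) = -s + 1 by ring, Real.rpow_add_one hc0.ne']
    ring
  have hBn : ∫⁻ y, B (-y) = ∫⁻ y, B y := lintegral_neg_eq_self B
  have hs1 : 0 < s - 1 := by linarith
  calc _ ≤ ∫⁻ y in Set.Ioc (-Real.pi) Real.pi, (A y + (B y + B (-y))) :=
        setLIntegral_mono' measurableSet_Ioc hpt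
    _ ≤ ∫⁻ y, (A y + (B y + B (-y))) := setLIntegral_le_lintegral _ _
    _ = ENNReal.ofReal (2 * c ^ (1 - s)) + (ENNReal.ofReal (Real.pi ^ s * (c ^ (1 - s) / (s - 1)))
          + ENNReal.ofReal (Real.pi ^ s * (c ^ (1 - s) / (s - 1)))) := by
        rw [lintegral_add_left hAm, lintegral_add_left hBm, hBn, hAi, hBi]
    _ = _ := by
        rw [← ENNReal.ofReal_add (by positivity) (by positivity),
          ← ENNReal.ofReal_add (by positivity) (by positivity)]
        congr 1
        ring

/-- The radial integral that governs the norms of the test functions. -/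
lemma lintegral_radial_kernel_le {p : ℝ} (hp : 0 < p) {ϕ : ℝ → ℝ} (hϕ : IsNormal ϕ) {a b t : ℝ}
    (ha : 0 < a) (hbt : b < t) (ht : 0 < t)
    (hab : ∀ r s : ℝ, 0 ≤ r → r ≤ s → s < 1 →
      ϕ s ≤ ϕ r * ((1 - s) / (1 - r)) ^ a ∧ ϕ r * ((1 - s) / (1 - r)) ^ b ≤ ϕ s)
    {R : ℝ} (hR0 : 0 ≤ R) (hR1 : R < 1) :
    ∫⁻ r in Set.Ioo (0 : ℝ) 1, ENNReal.ofReal ((1 - r * R) ^ (-(t * p)) * (ϕ r ^ p / (1 - r))) ≤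
      ENNReal.ofReal ((1 / ((t - b) * p) + 1 / (a * p)) * (ϕ R ^ p * (1 - R) ^ (-(t * p)))) := by
  set c := 1 - R with hc
  have hc0 : 0 < c := by rw [hc]; linarith
  have hϕR := hϕ.pos R ⟨hR0, hR1⟩
  have hκ : 0 < (t - b) * p := mul_pos (by linarith) hp
  have hap : 0 < a * p := mul_pos ha hp
  set k1 := ϕ R ^ p * c ^ (-(b * p)) with hk1
  set k2 := ϕ R ^ p * c ^ (-(a * p) - t * p) with hk2
  set H1 : ℝ → ℝ≥0∞ := (Set.Ioi c).indicator
    fun y => ENNReal.ofReal k1 * ENNReal.ofReal (y ^ (-((t - b) * p) - 1)) with hH1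
  set H2 : ℝ → ℝ≥0∞ := (Set.Ioc 0 c).indicator
    fun y => ENNReal.ofReal k2 * ENNReal.ofReal (y ^ (a * p - 1)) with hH2
  have hH1m : Measurable H1 := by
    refine Measurable.indicator ?_ measurableSet_Ioi
    fun_prop
  have hpt : ∀ r ∈ Set.Ioo (0 : ℝ) 1,
      ENNReal.ofReal ((1 - r * R) ^ (-(t * p)) * (ϕ r ^ p / (1 - r))) ≤
        H1 (1 - r) + H2 (1 - r) := by
    intro r hr
    have hr1 : 0 < 1 - r := by linarith [hr.2]
    have hϕr := hϕ.pos r ⟨hr.1.le, hr.2⟩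
    have htp : -(t * p) ≤ 0 := by have := mul_pos ht hp; linarith
    rcases lt_or_ge r R with h | h
    · refine le_add_of_le_of_nonneg ?_ zero_le
      rw [hH1, Set.indicator_of_mem (show 1 - r ∈ Set.Ioi c from by
        rw [Set.mem_Ioi, hc]; linarith),
        ← ENNReal.ofReal_mul (by positivity)]
      refine ENNReal.ofReal_le_ofReal ?_
      have h1 : (1 - r * R) ^ (-(t * p)) ≤ (1 - r) ^ (-(t * p)) :=
        Real.rpow_le_rpow_of_nonpos hr1 (by nlinarith [hr.1]) htp
      have h2 : ϕ r ≤ ϕ R * ((1 - r) / c) ^ b := by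
        have h3 := (hab r R hr.1.le h.le hR1).2
        rw [Real.div_rpow hc0.le hr1.le] at h3
        rw [Real.div_rpow hr1.le hc0.le, ← mul_div_assoc, le_div_iff₀ (by positivity)]
        rwa [← mul_div_assoc, div_le_iff₀ (by positivity)] at h3
      have h4 : ϕ r ^ p ≤ ϕ R ^ p * ((1 - r) ^ (b * p) * c ^ (-(b * p))) := by
        refine (Real.rpow_le_rpow hϕr.le h2 hp.le).trans_eq ?_
        rw [Real.mul_rpow hϕR.le (by positivity), ← Real.rpow_mul (by positivity),
          Real.div_rpow hr1.le hc0.le, Real.rpow_neg hc0.le, div_eq_mul_inv]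
      have hrR : 0 < 1 - r * R := by nlinarith [hr.1]
      calc (1 - r * R) ^ (-(t * p)) * (ϕ r ^ p / (1 - r))
          ≤ (1 - r) ^ (-(t * p)) *
            (ϕ R ^ p * ((1 - r) ^ (b * p) * c ^ (-(b * p))) / (1 - r)) := by gcongr
        _ = k1 * ((1 - r) ^ (-(t * p)) * (1 - r) ^ (b * p) * (1 - r) ^ (-1 : ℝ)) := by
            rw [hk1, Real.rpow_neg_one]; ring
        _ = _ := by
            rw [← Real.rpow_add hr1, ← Real.rpow_add hr1]
            congr 2; ring
    · refine le_add_of_nonneg_of_le zero_le ?_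
      rw [hH2, Set.indicator_of_mem (show 1 - r ∈ Set.Ioc 0 c from ⟨hr1, by rw [hc]; linarith⟩),
        ← ENNReal.ofReal_mul (by positivity)]
      refine ENNReal.ofReal_le_ofReal ?_
      have h1 : (1 - r * R) ^ (-(t * p)) ≤ c ^ (-(t * p)) :=
        Real.rpow_le_rpow_of_nonpos hc0 (by rw [hc]; nlinarith [hr.2]) htp
      have h4 : ϕ r ^ p ≤ ϕ R ^ p * ((1 - r) ^ (a * p) * c ^ (-(a * p))) := by
        refine (Real.rpow_le_rpow hϕr.le (hab R r hR0 h hr.2).1 hp.le).trans_eq ?_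
        rw [Real.mul_rpow hϕR.le (by positivity), ← Real.rpow_mul (by positivity),
          Real.div_rpow hr1.le hc0.le, Real.rpow_neg hc0.le, div_eq_mul_inv]
      have hrR : 0 < 1 - r * R := by nlinarith [hr.1, hr.2]
      calc (1 - r * R) ^ (-(t * p)) * (ϕ r ^ p / (1 - r))
          ≤ c ^ (-(t * p)) *
            (ϕ R ^ p * ((1 - r) ^ (a * p) * c ^ (-(a * p))) / (1 - r)) := by gcongr
        _ = (ϕ R ^ p * (c ^ (-(a * p)) * c ^ (-(t * p)))) *
            ((1 - r) ^ (a * p) * (1 - r) ^ (-1 : ℝ)) := by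
            rw [Real.rpow_neg_one]; ring
        _ = _ := by
            rw [← Real.rpow_add hr1, ← Real.rpow_add hc0, hk2]
            rfl
  have hH1i : ∫⁻ y, H1 y = ENNReal.ofReal (k1 * (c ^ (-((t - b) * p)) / ((t - b) * p))) := by
    rw [hH1, lintegral_indicator measurableSet_Ioi, lintegral_const_mul' _ _ ENNReal.ofReal_ne_top,
      lintegral_Ioi_rpow hc0 hκ, ← ENNReal.ofReal_mul (by positivity)]
  have hH2i : ∫⁻ y, H2 y = ENNReal.ofReal (k2 * (c ^ (a * p) / (a * p))) := by
    rw [hH2, lintegral_indicator measurableSet_Ioc, lintegral_const_mul' _ _ ENNReal.ofReal_ne_top,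
      lintegral_Ioc_rpow hc0 hap, ← ENNReal.ofReal_mul (by positivity)]
  calc _ ≤ ∫⁻ r in Set.Ioo (0 : ℝ) 1, (H1 (1 - r) + H2 (1 - r)) :=
        setLIntegral_mono' measurableSet_Ioo hpt
    _ ≤ ∫⁻ r, (H1 (1 - r) + H2 (1 - r)) := setLIntegral_le_lintegral _ _
    _ = ∫⁻ y, (H1 y + H2 y) := lintegral_sub_left_eq_self (fun y => H1 y + H2 y) 1
    _ = _ := by
        rw [lintegral_add_left hH1m, hH1i, hH2i, ← ENNReal.ofReal_add (by positivity)
          (by positivity)]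
        congr 1
        have e1 : c ^ (-(b * p)) * c ^ (-((t - b) * p)) = c ^ (-(t * p)) := by
          rw [← Real.rpow_add hc0]; congr 1; ring
        have e2 : c ^ (-(a * p) - t * p) * c ^ (a * p) = c ^ (-(t * p)) := by
          rw [← Real.rpow_add hc0]; congr 1; ring
        rw [hk1, hk2]
        calc _ = ϕ R ^ p * (c ^ (-(b * p)) * c ^ (-((t - b) * p))) / ((t - b) * p) +
              ϕ R ^ p * (c ^ (-(a * p) - t * p) * c ^ (a * p)) / (a * p) := by ring
          _ = _ := by rw [e1, e2]; ring

/-- The coefficient `(1 - |w|²)^{N - 1/q} / ϕ(|w|)` of the test functions. -/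
noncomputable def kernelCoeff (q : ℝ) (ϕ : ℝ → ℝ) (N : ℕ) (w : ℂ) : ℝ :=
  (1 - ‖w‖ ^ 2) ^ ((N : ℝ) - 1 / q) / ϕ ‖w‖

/-- The test function `z ↦ (1 - |w|²)^{N - 1/q} / (ϕ(|w|) (1 - w̄ z)^N)` on the disc. The exponent
`N` is an integer, so that no branch of a complex power is needed. -/
noncomputable def kernel (q : ℝ) (ϕ : ℝ → ℝ) (N : ℕ) (w : ℂ) : ℂ → ℂ :=
  disc.indicator fun z => (kernelCoeff q ϕ N w : ℂ) * ((1 - starRingEnd ℂ w * z) ^ N)⁻¹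

lemma one_sub_norm_le {w z : ℂ} (hw : ‖w‖ ≤ 1) :
    1 - ‖z‖ ≤ ‖1 - starRingEnd ℂ w * z‖ := by
  have h := norm_sub_norm_le (1 : ℂ) (starRingEnd ℂ w * z)
  rw [norm_one, norm_mul, RCLike.norm_conj] at h
  nlinarith [norm_nonneg z]

lemma one_sub_conj_mul_ne_zero {w z : ℂ} (hw : ‖w‖ ≤ 1) (hz : z ∈ disc) :
    1 - starRingEnd ℂ w * z ≠ 0 := by
  rw [mem_ball_zero_iff] at hz
  rw [← norm_pos_iff]
  linarith [one_sub_norm_le (z := z) hw]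

lemma hasDerivAt_inv_pow_one_sub {l z : ℂ} (n : ℕ) (h : 1 - l * z ≠ 0) :
    HasDerivAt (fun z => ((1 - l * z) ^ n)⁻¹) (n * l * ((1 - l * z) ^ (n + 1))⁻¹) z := by
  have h1 : HasDerivAt (fun z : ℂ => 1 - l * z) (-l) z := by
    simpa using ((hasDerivAt_id z).const_mul l).const_sub 1
  have h2 := (h1.fun_pow n).fun_inv (pow_ne_zero n h)
  refine h2.congr_deriv ?_
  rcases n with _ | n
  · simp
  · simp only [Nat.add_sub_cancel]
    field_simp
    ring

lemma kernel_mem_holDisc (q : ℝ) (ϕ : ℝ → ℝ) (N : ℕ) {w : ℂ} (hw : w ∈ disc) :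
    kernel q ϕ N w ∈ holDisc := by
  rw [mem_ball_zero_iff] at hw
  refine ⟨?_, fun z hz => Set.indicator_of_notMem hz _⟩
  refine DifferentiableOn.congr (f := fun z =>
    (kernelCoeff q ϕ N w : ℂ) * ((1 - starRingEnd ℂ w * z) ^ N)⁻¹) ?_
    fun z hz => Set.indicator_of_mem hz _
  intro z hz
  exact ((hasDerivAt_inv_pow_one_sub N (one_sub_conj_mul_ne_zero hw.le hz)).const_mul
    _).differentiableAt.differentiableWithinAt

lemma deriv_kernel {q : ℝ} {ϕ : ℝ → ℝ} {N : ℕ} {w z : ℂ} (hw : w ∈ disc) (hz : z ∈ disc) :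
    deriv (kernel q ϕ N w) z = (kernelCoeff q ϕ N w : ℂ) *
      (N * starRingEnd ℂ w * ((1 - starRingEnd ℂ w * z) ^ (N + 1))⁻¹) := by
  rw [mem_ball_zero_iff] at hw
  have h : kernel q ϕ N w =ᶠ[𝓝 z] fun z =>
      (kernelCoeff q ϕ N w : ℂ) * ((1 - starRingEnd ℂ w * z) ^ N)⁻¹ := by
    filter_upwards [Metric.isOpen_ball.mem_nhds hz] with y hy using Set.indicator_of_mem hy _
  rw [h.deriv_eq]
  exact ((hasDerivAt_inv_pow_one_sub N (one_sub_conj_mul_ne_zero hw.le hz)).const_mul _).deriv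

lemma deriv2_kernel {q : ℝ} {ϕ : ℝ → ℝ} {N : ℕ} {w z : ℂ} (hw : w ∈ disc) (hz : z ∈ disc) :
    deriv (deriv (kernel q ϕ N w)) z = (kernelCoeff q ϕ N w : ℂ) *
      (N * (N + 1) * starRingEnd ℂ w ^ 2 * ((1 - starRingEnd ℂ w * z) ^ (N + 2))⁻¹) := by
  have h : deriv (kernel q ϕ N w) =ᶠ[𝓝 z] fun z => (kernelCoeff q ϕ N w : ℂ) *
      (N * starRingEnd ℂ w * ((1 - starRingEnd ℂ w * z) ^ (N + 1))⁻¹) := by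
    filter_upwards [Metric.isOpen_ball.mem_nhds hz] with y hy using deriv_kernel hw hy
  rw [h.deriv_eq]
  rw [mem_ball_zero_iff] at hw
  rw [(((hasDerivAt_inv_pow_one_sub (N + 1)
    (one_sub_conj_mul_ne_zero hw.le hz)).const_mul _).const_mul _).deriv]
  push_cast
  ring

lemma kernelCoeff_nonneg {q : ℝ} {ϕ : ℝ → ℝ} (hϕ : IsNormal ϕ) (N : ℕ) {w : ℂ} (hw : w ∈ disc) :
    0 ≤ kernelCoeff q ϕ N w := by
  rw [mem_ball_zero_iff] at hw
  have h1 := hϕ.pos ‖w‖ ⟨norm_nonneg _, hw⟩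
  have h2 : 0 < 1 - ‖w‖ ^ 2 := by nlinarith [norm_nonneg w]
  unfold kernelCoeff
  positivity

lemma integralMean_kernel_le {q : ℝ} (hq : 0 < q) {ϕ : ℝ → ℝ} (hϕ : IsNormal ϕ) {N : ℕ}
    (hN : 1 < N * q) {w : ℂ} (hw : w ∈ disc) {r : ℝ} (hr : r ∈ Set.Ioo (0 : ℝ) 1) :
    integralMean q (kernel q ϕ N w) r ≤
      ENNReal.ofReal ((2 + 2 * Real.pi ^ (N * q) / (N * q - 1)) ^ (1 / q) *
        (kernelCoeff q ϕ N w * (1 - r * ‖w‖) ^ (-((N : ℝ) - 1 / q)))) := by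
  have hpi := Real.pi_pos
  have hA := kernelCoeff_nonneg (q := q) hϕ N hw
  rw [mem_ball_zero_iff] at hw
  set A := kernelCoeff q ϕ N w with hAdef
  set x := r * ‖w‖ with hx
  have hx0 : 0 ≤ x := mul_nonneg hr.1.le (norm_nonneg _)
  have hx1 : x < 1 := by rw [hx]; nlinarith [hr.1, hr.2, norm_nonneg w]
  set D := 2 + 2 * Real.pi ^ (N * q) / (N * q - 1) with hD
  have hD0 : 0 < D := by have : 0 < N * q - 1 := by linarith
                         positivity
  have hpt : ∀ y : ℝ, ‖kernel q ϕ N w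
      ((r : ℂ) * Complex.exp (((y + w.arg : ℝ) : ℂ) * Complex.I))‖ₑ ^ q =
      ENNReal.ofReal (A ^ q) *
        ENNReal.ofReal (‖1 - (x : ℂ) * Complex.exp (y * Complex.I)‖ ^ (-(N * q))) := by
    intro y
    have hmem : (r : ℂ) * Complex.exp (((y + w.arg : ℝ) : ℂ) * Complex.I) ∈ disc := by
      rw [mem_ball_zero_iff, norm_mul, Complex.norm_exp_ofReal_mul_I, mul_one, Complex.norm_real,
        Real.norm_of_nonneg hr.1.le]
      exact hr.2
    have hcw : starRingEnd ℂ w * ((r : ℂ) * Complex.exp (((y + w.arg : ℝ) : ℂ) * Complex.I)) =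
        (x : ℂ) * Complex.exp (y * Complex.I) := by
      have e1 : starRingEnd ℂ w = ‖w‖ * Complex.exp (-(w.arg * Complex.I)) := by
        conv_lhs => rw [← Complex.norm_mul_exp_arg_mul_I w]
        rw [map_mul, Complex.conj_ofReal, ← Complex.exp_conj, map_mul, Complex.conj_ofReal,
          Complex.conj_I, mul_neg]
      rw [e1, hx]
      have e2 : Complex.exp (y * Complex.I) = Complex.exp (-(w.arg * Complex.I)) *
          Complex.exp (((y + w.arg : ℝ) : ℂ) * Complex.I) := by
        rw [← Complex.exp_add]; congr 1; push_cast; ring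
      rw [e2]; push_cast; ring
    rw [kernel, Set.indicator_of_mem hmem, hcw, ← ofReal_norm,
      ENNReal.ofReal_rpow_of_nonneg (norm_nonneg _) hq.le, ← ENNReal.ofReal_mul (by positivity)]
    congr 1
    rw [norm_mul, Complex.norm_real, Real.norm_of_nonneg hA, Real.mul_rpow hA (norm_nonneg _),
      norm_inv, norm_pow, Real.inv_rpow (by positivity), ← Real.rpow_natCast_mul (norm_nonneg _),
      Real.rpow_neg (norm_nonneg _)]
  have h1 : ENNReal.ofReal (2 * Real.pi) * integralMean q (kernel q ϕ N w) r ^ q ≤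
      ENNReal.ofReal (A ^ q * (D * (1 - x) ^ (1 - N * q))) := by
    rw [← lintegral_rotate hq _ r w.arg]
    simp only [hpt]
    rw [lintegral_const_mul' _ _ ENNReal.ofReal_ne_top, ENNReal.ofReal_mul (by positivity)]
    gcongr
    exact lintegral_circle_kernel_le hN hx0 hx1
  have h2 : integralMean q (kernel q ϕ N w) r ^ q ≤
      ENNReal.ofReal (A ^ q * (D * (1 - x) ^ (1 - N * q))) := by
    refine le_trans ?_ h1
    refine le_mul_of_one_le_left zero_le ?_
    rw [ENNReal.one_le_ofReal]
    linarith [Real.pi_gt_three]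
  have h3 : A ^ q * (D * (1 - x) ^ (1 - N * q)) =
      (D ^ (1 / q) * (A * (1 - x) ^ (-((N : ℝ) - 1 / q)))) ^ q := by
    have h1x : 0 < 1 - x := by linarith
    rw [Real.mul_rpow (by positivity) (by positivity), Real.mul_rpow hA (by positivity),
      ← Real.rpow_mul hD0.le, one_div_mul_cancel hq.ne', Real.rpow_one, ← Real.rpow_mul h1x.le]
    have : -((N : ℝ) - 1 / q) * q = 1 - N * q := by field_simp; ring
    rw [this]; ring
  have h1x : 0 < 1 - x := by linarith
  rw [h3, ← ENNReal.ofReal_rpow_of_nonneg (by positivity) hq.le,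
    ENNReal.rpow_le_rpow_iff hq] at h2
  exact h2

/-- The test functions are uniformly bounded in `H(p,q,ϕ)`, as soon as `N` is large. -/
lemma exists_mixedNorm_kernel_le {p q : ℝ} (hp : 0 < p) (hq : 0 < q) {ϕ : ℝ → ℝ}
    (hϕ : IsNormal ϕ) {a b : ℝ} (ha : 0 < a) (hb : 0 < b)
    (hab : ∀ r s : ℝ, 0 ≤ r → r ≤ s → s < 1 →
      ϕ s ≤ ϕ r * ((1 - s) / (1 - r)) ^ a ∧ ϕ r * ((1 - s) / (1 - r)) ^ b ≤ ϕ s)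
    {N : ℕ} (hN : b + 1 / q < N) :
    ∃ C : ℝ, ∀ w ∈ disc, mixedNorm p q ϕ (kernel q ϕ N w) ≤ ENNReal.ofReal C := by
  set t := (N : ℝ) - 1 / q with ht
  have hbt : b < t := by rw [ht]; linarith
  have ht0 : 0 < t := hb.trans hbt
  have hNq : 1 < N * q := by
    have h1 : 1 / q < N := by linarith
    rwa [div_lt_iff₀ hq] at h1
  set D := (2 + 2 * Real.pi ^ (N * q) / (N * q - 1)) ^ (1 / q) with hD
  have hD0 : 0 ≤ D := by
    have : 0 < N * q - 1 := by linarith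
    positivity
  set L := 1 / ((t - b) * p) + 1 / (a * p) with hL
  have hL0 : 0 ≤ L := by
    have : 0 < t - b := by linarith
    positivity
  refine ⟨(D ^ p * (L * 2 ^ (t * p))) ^ (1 / p), fun w hw => ?_⟩
  have hA := kernelCoeff_nonneg (q := q) hϕ N hw
  have hw1 : ‖w‖ < 1 := by simpa using hw
  have hϕw := hϕ.pos ‖w‖ ⟨norm_nonneg _, hw1⟩
  have h1w : 0 < 1 - ‖w‖ := by linarith
  unfold mixedNorm
  rw [← ENNReal.ofReal_rpow_of_nonneg (by positivity) (by positivity)]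
  refine ENNReal.rpow_le_rpow ?_ (by positivity)
  set A := kernelCoeff q ϕ N w with hAdef
  calc ∫⁻ r in Set.Ioo (0 : ℝ) 1,
        integralMean q (kernel q ϕ N w) r ^ p * ENNReal.ofReal (ϕ r ^ p / (1 - r))
      ≤ ∫⁻ r in Set.Ioo (0 : ℝ) 1, ENNReal.ofReal (D ^ p * A ^ p) *
          ENNReal.ofReal ((1 - r * ‖w‖) ^ (-(t * p)) * (ϕ r ^ p / (1 - r))) := by
        refine setLIntegral_mono' measurableSet_Ioo fun r hr => ?_
        have h1x : 0 < 1 - r * ‖w‖ := by nlinarith [hr.1, hr.2, norm_nonneg w]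
        have h1r : 0 < 1 - r := by linarith [hr.2]
        have hϕr := hϕ.pos r ⟨hr.1.le, hr.2⟩
        calc _ ≤ ENNReal.ofReal (D * (A * (1 - r * ‖w‖) ^ (-t))) ^ p *
              ENNReal.ofReal (ϕ r ^ p / (1 - r)) := by
              gcongr
              exact integralMean_kernel_le hq hϕ hNq hw hr
          _ = _ := by
              rw [ENNReal.ofReal_rpow_of_nonneg (by positivity) hp.le,
                ← ENNReal.ofReal_mul (by positivity), ← ENNReal.ofReal_mul (by positivity)]
              congr 1
              rw [Real.mul_rpow hD0 (by positivity), Real.mul_rpow hA (by positivity),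
                ← Real.rpow_mul h1x.le, neg_mul]
              ring
    _ = ENNReal.ofReal (D ^ p * A ^ p) * ∫⁻ r in Set.Ioo (0 : ℝ) 1,
          ENNReal.ofReal ((1 - r * ‖w‖) ^ (-(t * p)) * (ϕ r ^ p / (1 - r))) :=
        lintegral_const_mul' _ _ ENNReal.ofReal_ne_top
    _ ≤ ENNReal.ofReal (D ^ p * A ^ p) *
          ENNReal.ofReal (L * (ϕ ‖w‖ ^ p * (1 - ‖w‖) ^ (-(t * p)))) := by
        gcongr
        exact lintegral_radial_kernel_le hp hϕ ha hbt ht0 hab (norm_nonneg _) hw1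
    _ ≤ _ := by
        rw [← ENNReal.ofReal_mul (by positivity)]
        refine ENNReal.ofReal_le_ofReal ?_
        have hA1 : A ^ p * ϕ ‖w‖ ^ p ≤ 2 ^ (t * p) * (1 - ‖w‖) ^ (t * p) := by
          rw [← Real.mul_rpow hA hϕw.le, hAdef, kernelCoeff, div_mul_cancel₀ _ hϕw.ne',
            ← Real.rpow_mul (by nlinarith [norm_nonneg w]), ← Real.mul_rpow (by norm_num) h1w.le]
          refine Real.rpow_le_rpow ?_ ?_ (by positivity)
          · nlinarith [norm_nonneg w]
          · nlinarith [norm_nonneg w]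
        have hc : (1 - ‖w‖) ^ (t * p) * (1 - ‖w‖) ^ (-(t * p)) = 1 := by
          rw [← Real.rpow_add h1w]; simp
        calc D ^ p * A ^ p * (L * (ϕ ‖w‖ ^ p * (1 - ‖w‖) ^ (-(t * p))))
            = D ^ p * L * (1 - ‖w‖) ^ (-(t * p)) * (A ^ p * ϕ ‖w‖ ^ p) := by ring
          _ ≤ D ^ p * L * (1 - ‖w‖) ^ (-(t * p)) * (2 ^ (t * p) * (1 - ‖w‖) ^ (t * p)) := by
              gcongr
          _ = D ^ p * (L * 2 ^ (t * p)) * ((1 - ‖w‖) ^ (t * p) * (1 - ‖w‖) ^ (-(t * p))) := by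
              ring
          _ = _ := by rw [hc, mul_one]

/-- The quasi-triangle inequality in `H(p,q,ϕ)`. -/
lemma exists_mixedNorm_add_le {p q : ℝ} (hp : 0 < p) (hq : 0 < q) {ϕ : ℝ → ℝ}
    (hϕ : IsNormal ϕ) :
    ∃ K : ℝ, 0 ≤ K ∧ ∀ f ∈ holDisc, ∀ g, mixedNorm p q ϕ (f + g) ≤
      ENNReal.ofReal K * (mixedNorm p q ϕ f + mixedNorm p q ϕ g) := by
  have h1p : 0 ≤ 1 / p := by positivity
  set K : ℝ≥0∞ := (2 ^ q) ^ (1 / q) * 2 ^ (1 / q) with hKdef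
  have hK : K ≠ ⊤ := by
    refine ENNReal.mul_ne_top ?_ ?_
    · exact ENNReal.rpow_ne_top_of_nonneg (by positivity)
        (ENNReal.rpow_ne_top_of_nonneg hq.le (by simp))
    · exact ENNReal.rpow_ne_top_of_nonneg (by positivity) (by simp)
  have hK' : K ^ p * 2 ^ p ≠ ⊤ :=
    ENNReal.mul_ne_top (ENNReal.rpow_ne_top_of_nonneg hp.le hK)
      (ENNReal.rpow_ne_top_of_nonneg hp.le (by simp))
  have hw : AEMeasurable (fun r : ℝ => ENNReal.ofReal (ϕ r ^ p / (1 - r)))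
      (volume.restrict (Set.Ioo 0 1)) := by
    have hc : ContinuousOn ϕ (Set.Ioo 0 1) := hϕ.cont.mono Set.Ioo_subset_Ico_self
    have : AEMeasurable ϕ (volume.restrict (Set.Ioo 0 1)) := hc.aemeasurable measurableSet_Ioo
    exact ((this.pow_const p).div (by fun_prop)).ennreal_ofReal
  set L : ℝ≥0∞ := (K ^ p * 2 ^ p) ^ (1 / p) * 2 ^ (1 / p) with hL
  have hLtop : L ≠ ⊤ := ENNReal.mul_ne_top (ENNReal.rpow_ne_top_of_nonneg h1p hK')
    (ENNReal.rpow_ne_top_of_nonneg h1p (by simp))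
  refine ⟨L.toReal, ENNReal.toReal_nonneg, fun f hf g => ?_⟩
  rw [ENNReal.ofReal_toReal hLtop]
  unfold mixedNorm
  set I : (ℂ → ℂ) → ℝ → ℝ≥0∞ := fun f r =>
    integralMean q f r ^ p * ENNReal.ofReal (ϕ r ^ p / (1 - r)) with hI
  have key : ∫⁻ r in Set.Ioo (0 : ℝ) 1, I (f + g) r ≤ (K ^ p * 2 ^ p) *
      ((∫⁻ r in Set.Ioo (0 : ℝ) 1, I f r) + ∫⁻ r in Set.Ioo (0 : ℝ) 1, I g r) := by
    calc _ ≤ ∫⁻ r in Set.Ioo (0 : ℝ) 1, (K ^ p * 2 ^ p) * (I f r + I g r) := by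
          refine lintegral_mono fun r => ?_
          simp only [hI, ← add_mul, ← mul_assoc]
          gcongr ?_ * _
          calc _ ≤ (K * (integralMean q f r + integralMean q g r)) ^ p := by
                gcongr; exact integralMean_add_le hq hf r
            _ = K ^ p * (integralMean q f r + integralMean q g r) ^ p :=
                ENNReal.mul_rpow_of_nonneg _ _ hp.le
            _ ≤ _ := by
                rw [mul_assoc]; gcongr; exact add_rpow_le hp.le _ _
      _ = _ := by
          rw [lintegral_const_mul' _ _ hK', lintegral_add_left' (f := I f)
            (((measurable_integralMean q hf).pow_const p).aemeasurable.mul hw)]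
  calc _ ≤ ((K ^ p * 2 ^ p) * ((∫⁻ r in Set.Ioo (0 : ℝ) 1, I f r) +
        ∫⁻ r in Set.Ioo (0 : ℝ) 1, I g r)) ^ (1 / p) := by gcongr
    _ ≤ _ := by
        rw [ENNReal.mul_rpow_of_nonneg _ _ h1p, hL, mul_assoc]
        gcongr
        exact add_rpow_le h1p _ _

/-! ### Composition with the symbol -/

lemma hasDerivAt_comp_symbol {f φ : ℂ → ℂ} (hf : DifferentiableOn ℂ f disc)
    (hφ : DifferentiableOn ℂ φ disc) (hmaps : Set.MapsTo φ disc disc) {z : ℂ} (hz : z ∈ disc) :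
    HasDerivAt (f ∘ φ) (deriv f (φ z) * deriv φ z) z :=
  HasDerivAt.comp z
    (hf.differentiableAt (Metric.isOpen_ball.mem_nhds (hmaps hz))).hasDerivAt
    (hφ.differentiableAt (Metric.isOpen_ball.mem_nhds hz)).hasDerivAt

lemma deriv_comp_symbol {f φ : ℂ → ℂ} (hf : DifferentiableOn ℂ f disc)
    (hφ : DifferentiableOn ℂ φ disc) (hmaps : Set.MapsTo φ disc disc) {z : ℂ} (hz : z ∈ disc) :
    deriv (comp φ f) z = deriv f (φ z) * deriv φ z := by
  have h : comp φ f =ᶠ[𝓝 z] f ∘ φ := by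
    filter_upwards [Metric.isOpen_ball.mem_nhds hz] with y hy using Set.indicator_of_mem hy _
  rw [h.deriv_eq, (hasDerivAt_comp_symbol hf hφ hmaps hz).deriv]

lemma deriv2_comp_symbol {f φ : ℂ → ℂ} (hf : DifferentiableOn ℂ f disc)
    (hφ : DifferentiableOn ℂ φ disc) (hmaps : Set.MapsTo φ disc disc) {z : ℂ} (hz : z ∈ disc) :
    deriv (deriv (comp φ f)) z =
      deriv (deriv f) (φ z) * deriv φ z ^ 2 + deriv f (φ z) * deriv (deriv φ) z := by
  have h : deriv (comp φ f) =ᶠ[𝓝 z] fun y => (deriv f ∘ φ) y * deriv φ y := by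
    filter_upwards [Metric.isOpen_ball.mem_nhds hz] with y hy using
      deriv_comp_symbol hf hφ hmaps hy
  have h1 := hasDerivAt_comp_symbol (hf.deriv Metric.isOpen_ball) hφ hmaps hz
  have h2 := ((hφ.deriv Metric.isOpen_ball).differentiableAt
    (Metric.isOpen_ball.mem_nhds hz)).hasDerivAt
  rw [h.deriv_eq, (h1.fun_mul h2).deriv]
  simp only [Function.comp]
  ring

lemma ZygmundSpace.zygFun_le_norm {μ : ℂ → ℝ} {hμ : IsWeight μ} (f : ZygmundSpace hμ) (z : disc) :
    zygFun μ f.toFun z ≤ ‖f‖ := by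
  rw [ZygmundSpace.norm_def]
  have h := le_ciSup f.2.2 z
  have h1 := norm_nonneg (f.toFun 0)
  have h2 := norm_nonneg (deriv f.toFun 0)
  change zygFun μ f.toFun z ≤ _ + _ + ⨆ z : disc, zygFun μ f.toFun z
  change zygFun μ f.toFun z ≤ ⨆ z : disc, zygFun μ f.toFun z at h
  linarith

/-! ### Lower bound for the essential norm -/

/-- Combinations of two consecutive test functions. Suitable coefficients make the first or the
second derivative at `w` vanish. -/
noncomputable def testFun (q : ℝ) (ϕ : ℝ → ℝ) (N : ℕ) (α β w : ℂ) : ℂ → ℂ :=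
  α • kernel q ϕ N w + β • kernel q ϕ (N + 1) w

lemma testFun_mem_holDisc (q : ℝ) (ϕ : ℝ → ℝ) (N : ℕ) (α β : ℂ) {w : ℂ} (hw : w ∈ disc) :
    testFun q ϕ N α β w ∈ holDisc :=
  holDisc.add_mem (holDisc.smul_mem α (kernel_mem_holDisc q ϕ N hw))
    (holDisc.smul_mem β (kernel_mem_holDisc q ϕ (N + 1) hw))

lemma deriv_testFun {q : ℝ} {ϕ : ℝ → ℝ} {N : ℕ} {α β w z : ℂ} (hw : w ∈ disc) (hz : z ∈ disc) :
    deriv (testFun q ϕ N α β w) z =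
      α * deriv (kernel q ϕ N w) z + β * deriv (kernel q ϕ (N + 1) w) z := by
  unfold testFun
  rw [deriv_add_of_mem (holDisc.smul_mem α (kernel_mem_holDisc q ϕ N hw))
    (holDisc.smul_mem β (kernel_mem_holDisc q ϕ (N + 1) hw)) hz]
  simp [deriv_const_smul_field]

lemma deriv2_testFun {q : ℝ} {ϕ : ℝ → ℝ} {N : ℕ} {α β w z : ℂ} (hw : w ∈ disc) (hz : z ∈ disc) :
    deriv (deriv (testFun q ϕ N α β w)) z =
      α * deriv (deriv (kernel q ϕ N w)) z + β * deriv (deriv (kernel q ϕ (N + 1) w)) z := by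
  unfold testFun
  rw [deriv2_add_of_mem (holDisc.smul_mem α (kernel_mem_holDisc q ϕ N hw))
    (holDisc.smul_mem β (kernel_mem_holDisc q ϕ (N + 1) hw)) hz, deriv2_smul, deriv2_smul]

lemma exists_mixedNorm_testFun_le {p q : ℝ} (hp : 0 < p) (hq : 0 < q) {ϕ : ℝ → ℝ}
    (hϕ : IsNormal ϕ) {a b : ℝ} (ha : 0 < a) (hb : 0 < b)
    (hab : ∀ r s : ℝ, 0 ≤ r → r ≤ s → s < 1 →
      ϕ s ≤ ϕ r * ((1 - s) / (1 - r)) ^ a ∧ ϕ r * ((1 - s) / (1 - r)) ^ b ≤ ϕ s)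
    {N : ℕ} (hN : b + 1 / q < N) (α β : ℂ) :
    ∃ C : ℝ, 0 < C ∧ ∀ w ∈ disc, ∀ w' ∈ disc,
      mixedNorm p q ϕ (testFun q ϕ N α β w) ≤ ENNReal.ofReal C ∧
      mixedNorm p q ϕ (testFun q ϕ N α β w - testFun q ϕ N α β w') ≤ ENNReal.ofReal C := by
  obtain ⟨C1, h1⟩ := exists_mixedNorm_kernel_le hp hq hϕ ha hb hab hN
  obtain ⟨C2, h2⟩ := exists_mixedNorm_kernel_le hp hq hϕ ha hb hab
    (N := N + 1) (by push_cast; linarith)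
  obtain ⟨K, hK, h3⟩ := exists_mixedNorm_add_le hp hq hϕ
  have hE : ∀ w ∈ disc, mixedNorm p q ϕ (testFun q ϕ N α β w) ≤
      ENNReal.ofReal K * (‖α‖ₑ * ENNReal.ofReal C1 + ‖β‖ₑ * ENNReal.ofReal C2) := by
    intro w hw
    refine (h3 _ (holDisc.smul_mem α (kernel_mem_holDisc q ϕ N hw)) _).trans ?_
    rw [mixedNorm_smul hp hq, mixedNorm_smul hp hq]
    gcongr
    · exact h1 w hw
    · exact h2 w hw
  set B := ENNReal.ofReal K * (‖α‖ₑ * ENNReal.ofReal C1 + ‖β‖ₑ * ENNReal.ofReal C2) with hB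
  have hBt : B ≠ ⊤ := by
    refine ENNReal.mul_ne_top ENNReal.ofReal_ne_top (ENNReal.add_ne_top.2 ⟨?_, ?_⟩) <;>
      exact ENNReal.mul_ne_top enorm_ne_top ENNReal.ofReal_ne_top
  have hD : ∀ w ∈ disc, ∀ w' ∈ disc,
      mixedNorm p q ϕ (testFun q ϕ N α β w - testFun q ϕ N α β w') ≤
        ENNReal.ofReal K * (B + B) := by
    intro w hw w' hw'
    rw [sub_eq_add_neg, ← neg_one_smul ℂ]
    refine (h3 _ (testFun_mem_holDisc q ϕ N α β hw) _).trans ?_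
    rw [mixedNorm_smul hp hq]
    gcongr
    · exact hE w hw
    · simpa using hE w' hw'
  set B' := B + ENNReal.ofReal K * (B + B) + 1 with hB'
  have hB't : B' ≠ ⊤ := ENNReal.add_ne_top.2 ⟨ENNReal.add_ne_top.2 ⟨hBt,
    ENNReal.mul_ne_top ENNReal.ofReal_ne_top (ENNReal.add_ne_top.2 ⟨hBt, hBt⟩)⟩, by simp⟩
  have hB'0 : B' ≠ 0 := by simp [hB']
  refine ⟨B'.toReal, ENNReal.toReal_pos hB'0 hB't, fun w hw w' hw' => ?_⟩
  rw [ENNReal.ofReal_toReal hB't]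
  exact ⟨(hE w hw).trans (le_add_right le_self_add),
    (hD w hw w' hw').trans (le_add_right le_add_self)⟩

lemma tendsto_kernelCoeff {q : ℝ} {ϕ : ℝ → ℝ} (hϕ : IsNormal ϕ) {b : ℝ} (hb : 0 < b)
    (hab : ∀ r s : ℝ, 0 ≤ r → r ≤ s → s < 1 → ϕ r * ((1 - s) / (1 - r)) ^ b ≤ ϕ s)
    {N : ℕ} (hN : b + 1 / q < N) {w : ℕ → ℂ} (hw : ∀ n, w n ∈ disc)
    (hw1 : Tendsto (fun n => ‖w n‖) atTop (𝓝 1)) :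
    Tendsto (fun n => kernelCoeff q ϕ N (w n)) atTop (𝓝 0) := by
  set t := (N : ℝ) - 1 / q with ht
  have hbt : 0 < t - b := by rw [ht]; linarith
  have ht0 : 0 < t := by linarith
  have hϕ0 := hϕ.pos 0 ⟨le_rfl, one_pos⟩
  have hle : ∀ n, kernelCoeff q ϕ N (w n) ≤ 2 ^ t / ϕ 0 * (1 - ‖w n‖) ^ (t - b) := by
    intro n
    have hn : ‖w n‖ < 1 := by simpa using hw n
    have h0 := norm_nonneg (w n)
    have h1 : 0 < 1 - ‖w n‖ := by linarith
    have h2 := hab 0 ‖w n‖ le_rfl h0 hn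
    rw [sub_zero, div_one] at h2
    have h3 : (1 - ‖w n‖ ^ 2) ^ t ≤ 2 ^ t * (1 - ‖w n‖) ^ t := by
      rw [← Real.mul_rpow (by norm_num) h1.le]
      exact Real.rpow_le_rpow (by nlinarith) (by nlinarith) ht0.le
    unfold kernelCoeff
    calc _ ≤ 2 ^ t * (1 - ‖w n‖) ^ t / (ϕ 0 * (1 - ‖w n‖) ^ b) := by gcongr
      _ = _ := by
          have e : (1 - ‖w n‖) ^ t = (1 - ‖w n‖) ^ b * (1 - ‖w n‖) ^ (t - b) := by
            rw [← Real.rpow_add h1, add_sub_cancel]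
          have h4 : 0 < (1 - ‖w n‖) ^ b := by positivity
          rw [e, div_mul_eq_mul_div, div_eq_div_iff (by positivity) hϕ0.ne']
          ring
  refine squeeze_zero (fun n => kernelCoeff_nonneg hϕ N (hw n)) hle ?_
  have h : Tendsto (fun n => 1 - ‖w n‖) atTop (𝓝 0) := by
    simpa using hw1.const_sub 1
  have h2 := (h.rpow_const (p := t - b) (Or.inr hbt.le)).const_mul (2 ^ t / ϕ 0)
  rwa [Real.zero_rpow hbt.ne', mul_zero] at h2

lemma tendsto_deriv_kernel {q : ℝ} {ϕ : ℝ → ℝ} (hϕ : IsNormal ϕ) {b : ℝ} (hb : 0 < b)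
    (hab : ∀ r s : ℝ, 0 ≤ r → r ≤ s → s < 1 → ϕ r * ((1 - s) / (1 - r)) ^ b ≤ ϕ s)
    {N : ℕ} (hN : b + 1 / q < N) {w : ℕ → ℂ} (hw : ∀ n, w n ∈ disc)
    (hw1 : Tendsto (fun n => ‖w n‖) atTop (𝓝 1)) {z : ℂ} (hz : z ∈ disc) :
    Tendsto (fun n => deriv (kernel q ϕ N (w n)) z) atTop (𝓝 0) ∧
    Tendsto (fun n => deriv (deriv (kernel q ϕ N (w n))) z) atTop (𝓝 0) := by
  have hc := tendsto_kernelCoeff hϕ hb hab hN hw hw1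
  have hz1 : 0 < 1 - ‖z‖ := by rw [mem_ball_zero_iff] at hz; linarith
  have hn : ∀ n, ‖w n‖ ≤ 1 := fun n => by
    have := hw n
    rw [mem_ball_zero_iff] at this
    exact this.le
  have hinv : ∀ n k : ℕ, ‖((1 - starRingEnd ℂ (w n) * z) ^ k)⁻¹‖ ≤ ((1 - ‖z‖) ^ k)⁻¹ := by
    intro n k
    rw [norm_inv, norm_pow]
    have h1 : (1 - ‖z‖) ^ k ≤ ‖1 - starRingEnd ℂ (w n) * z‖ ^ k :=
      pow_le_pow_left₀ hz1.le (one_sub_norm_le (hn n)) k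
    exact inv_anti₀ (by positivity) h1
  constructor
  · refine squeeze_zero_norm (a := fun n => kernelCoeff q ϕ N (w n) *
      (N * 1 * ((1 - ‖z‖) ^ (N + 1))⁻¹)) (fun n => ?_) (by simpa using hc.mul_const _)
    have hA := kernelCoeff_nonneg (q := q) hϕ N (hw n)
    rw [deriv_kernel (hw n) hz, norm_mul, norm_mul, norm_mul, Complex.norm_real,
      Real.norm_of_nonneg hA, RCLike.norm_conj, Complex.norm_natCast]
    gcongr
    · exact hn n
    · exact hinv n _
  · refine squeeze_zero_norm (a := fun n => kernelCoeff q ϕ N (w n) *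
      (N * (N + 1) * 1 ^ 2 * ((1 - ‖z‖) ^ (N + 2))⁻¹)) (fun n => ?_)
      (by simpa using hc.mul_const _)
    have hA := kernelCoeff_nonneg (q := q) hϕ N (hw n)
    have hN1 : ‖(N : ℂ) + 1‖ = N + 1 := by
      have : ((N : ℂ) + 1) = ((N + 1 : ℕ) : ℂ) := by push_cast; rfl
      rw [this, Complex.norm_natCast]; push_cast; rfl
    rw [deriv2_kernel (hw n) hz, norm_mul, norm_mul, norm_mul, norm_mul, norm_pow,
      Complex.norm_real, Real.norm_of_nonneg hA, RCLike.norm_conj, Complex.norm_natCast, hN1]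
    gcongr
    · exact hn n
    · exact hinv n _

section LowerBound

variable {p q : ℝ} {hp : 0 < p} {hq : 0 < q} {ϕ : ℝ → ℝ} {hϕ : IsNormal ϕ}
  {μ : ℂ → ℝ} {hμ : IsWeight μ} {φ : ℂ → ℂ}

/-- A compact operator is nearly constant along a subsequence of any bounded family of test
functions. The operator `C_φ - S` is therefore tested on differences of test functions: no weak
convergence is needed, and the argument covers the quasi-normed range of `p` and `q`. -/
lemma le_opNorm_sub_of_frequently
    (hφ : DifferentiableOn ℂ φ disc) (hmaps : Set.MapsTo φ disc disc)
    (h : ∀ f ∈ MixedNormSpace hp hq hϕ, comp φ f ∈ zygmundSubmodule hμ)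
    {S : MixedNormSpace hp hq hϕ →ₗ[ℂ] ZygmundSpace hμ} (hS : IsCompactOp S)
    {b : ℝ} (hb : 0 < b)
    (hab : ∀ r s : ℝ, 0 ≤ r → r ≤ s → s < 1 → ϕ r * ((1 - s) / (1 - r)) ^ b ≤ ϕ s)
    {N : ℕ} (hN : b + 1 / q < N) {α β : ℂ} {C : ℝ} (hC0 : 0 < C)
    (hC : ∀ w ∈ disc, ∀ w' ∈ disc,
      mixedNorm p q ϕ (testFun q ϕ N α β w) ≤ ENNReal.ofReal C ∧
      mixedNorm p q ϕ (testFun q ϕ N α β w - testFun q ϕ N α β w') ≤ ENNReal.ofReal C)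
    {m : ℝ} (hm : ∃ᶠ z in toBoundary φ,
      m ≤ μ (‖z‖ : ℂ) * ‖deriv (deriv (comp φ (testFun q ϕ N α β (φ z)))) z‖) :
    ENNReal.ofReal (m / C) ≤ opNorm (compositionOperator hp hq hϕ hμ φ h - S) := by
  set T := compositionOperator hp hq hϕ hμ φ h with hT
  rcases eq_or_ne (opNorm (T - S)) ⊤ with htop | htop
  · rw [htop]; exact le_top
  set L := (opNorm (T - S)).toReal with hL
  have hcg : (toBoundary φ).IsCountablyGenerated := by unfold toBoundary; infer_instance
  have hdisc : ∀ᶠ z in toBoundary φ, z ∈ disc := by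
    unfold toBoundary
    exact mem_inf_of_right (mem_principal_self _)
  obtain ⟨z₀, hz₀, hz₀m⟩ := exists_seq_forall_of_frequently (hm.and_eventually hdisc)
  -- the normalized test functions
  have hmem : ∀ w ∈ disc, (C : ℂ)⁻¹ • testFun q ϕ N α β w ∈ MixedNormSpace hp hq hϕ := fun w hw =>
    (MixedNormSpace hp hq hϕ).smul_mem _
      ⟨testFun_mem_holDisc q ϕ N α β hw, (hC w hw w hw).1.trans_lt ENNReal.ofReal_lt_top⟩
  set G₀ : ℕ → MixedNormSpace hp hq hϕ := fun k => ⟨_, hmem (φ (z₀ k)) (hmaps (hz₀m k).2)⟩ with hG₀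
  have hscale : ∀ f, mixedNorm p q ϕ f ≤ ENNReal.ofReal C →
      mixedNorm p q ϕ ((C : ℂ)⁻¹ • f) ≤ 1 := by
    intro f hf
    rw [mixedNorm_smul hp hq, ← ofReal_norm, norm_inv, Complex.norm_real,
      Real.norm_of_nonneg hC0.le]
    calc _ ≤ ENNReal.ofReal C⁻¹ * ENNReal.ofReal C := by gcongr
      _ = 1 := by rw [← ENNReal.ofReal_mul (by positivity), inv_mul_cancel₀ hC0.ne',
                    ENNReal.ofReal_one]
  obtain ⟨y, -, ψ, hψ, hy⟩ := hS.tendsto_subseq (x := fun k => S (G₀ k)) fun k =>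
    subset_closure ⟨G₀ k, hscale _ (hC _ (hmaps (hz₀m k).2) _ (hmaps (hz₀m k).2)).1, rfl⟩
  set z : ℕ → ℂ := z₀ ∘ ψ with hz
  set G : ℕ → MixedNormSpace hp hq hϕ := G₀ ∘ ψ with hG
  have hzd : ∀ k, z k ∈ disc := fun k => (hz₀m (ψ k)).2
  have hzm : ∀ k, m ≤ μ (‖z k‖ : ℂ) *
      ‖deriv (deriv (comp φ (testFun q ϕ N α β (φ (z k))))) (z k)‖ := fun k => (hz₀m (ψ k)).1
  have hφd : ∀ k, φ (z k) ∈ disc := fun k => hmaps (hzd k)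
  have hz1 : Tendsto (fun k => ‖φ (z k)‖) atTop (𝓝 1) := by
    have h1 : Tendsto (fun z => ‖φ z‖) (toBoundary φ) (𝓝 1) := by
      unfold toBoundary
      exact tendsto_comap.mono_left inf_le_left
    exact h1.comp (hz₀.comp hψ.tendsto_atTop)
  have hmain : ∀ ε > 0, m / C ≤ L + ε := by
    intro ε hε
    obtain ⟨k, hk⟩ := Metric.cauchySeq_iff.1 hy.cauchySeq ε hε
    have hder : ∀ j, deriv (deriv (T (G k - G j)).toFun) (z k) = (C : ℂ)⁻¹ *
        (deriv (deriv (comp φ (testFun q ϕ N α β (φ (z k))))) (z k) -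
          (deriv (deriv (testFun q ϕ N α β (φ (z j)))) (φ (z k)) * deriv φ (z k) ^ 2 +
            deriv (testFun q ϕ N α β (φ (z j))) (φ (z k)) * deriv (deriv φ) (z k))) := by
      intro j
      have e : (T (G k - G j)).toFun = (C : ℂ)⁻¹ • (comp φ (testFun q ϕ N α β (φ (z k))) +
          (-1 : ℂ) • comp φ (testFun q ϕ N α β (φ (z j)))) := by
        change disc.indicator (((C : ℂ)⁻¹ • testFun q ϕ N α β (φ (z k)) -
          (C : ℂ)⁻¹ • testFun q ϕ N α β (φ (z j))) ∘ φ) = _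
        funext x
        by_cases hx : x ∈ disc
        · simp [comp, hx, mul_add, sub_eq_add_neg]
        · simp [comp, hx]
      have hmem' : ∀ i, comp φ (testFun q ϕ N α β (φ (z i))) ∈ holDisc := fun i =>
        (h _ ⟨testFun_mem_holDisc q ϕ N α β (hφd i),
          (hC _ (hφd i) _ (hφd i)).1.trans_lt ENNReal.ofReal_lt_top⟩).1
      rw [e, deriv2_smul, deriv2_add_of_mem (hmem' k) (holDisc.smul_mem _ (hmem' j)) (hzd k),
        deriv2_smul, deriv2_comp_symbol (testFun_mem_holDisc q ϕ N α β (hφd j)).1 hφ hmaps (hzd k)]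
      ring
    -- the value at `z k` of the second derivative, as `φ (z j)` tends to the boundary
    have hlim : Tendsto (fun j => μ (‖z k‖ : ℂ) * ‖deriv (deriv (T (G k - G j)).toFun) (z k)‖)
        atTop (𝓝 (μ (‖z k‖ : ℂ) *
          ‖(C : ℂ)⁻¹ * deriv (deriv (comp φ (testFun q ϕ N α β (φ (z k))))) (z k)‖)) := by
      simp only [hder]
      have hN' : b + 1 / q < (N + 1 : ℕ) := by push_cast; linarith
      have t1 := tendsto_deriv_kernel hϕ hb hab hN hφd hz1 (hφd k)
      have t2 := tendsto_deriv_kernel hϕ hb hab hN' hφd hz1 (hφd k)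
      simp only [deriv2_testFun (hφd _) (hφd k), deriv_testFun (hφd _) (hφd k)]
      have t3 := (((t1.2.const_mul α).add (t2.2.const_mul β)).mul_const (deriv φ (z k) ^ 2)).add
        (((t1.1.const_mul α).add (t2.1.const_mul β)).mul_const (deriv (deriv φ) (z k)))
      simp only [mul_zero, add_zero, zero_mul] at t3
      have t4 := (((t3.const_sub
        (deriv (deriv (comp φ (testFun q ϕ N α β (φ (z k))))) (z k))).const_mul
          (C : ℂ)⁻¹).norm).const_mul (μ (‖z k‖ : ℂ))
      rwa [sub_zero] at t4
    have hle : ∀ᶠ j in atTop, μ (‖z k‖ : ℂ) * ‖deriv (deriv (T (G k - G j)).toFun) (z k)‖ ≤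
        L + ε := by
      filter_upwards [eventually_ge_atTop k] with j hj
      refine (ZygmundSpace.zygFun_le_norm (T (G k - G j)) ⟨z k, hzd k⟩).trans ?_
      have h1 : T (G k - G j) = (T - S) (G k - G j) + (S (G k) - S (G j)) := by
        rw [LinearMap.sub_apply, map_sub S]; abel
      rw [h1]
      refine (norm_add_le _ _).trans (add_le_add ?_ ?_)
      · have h2 : ‖(T - S) (G k - G j)‖ₑ ≤ opNorm (T - S) := by
          refine le_iSup₂_of_le (G k - G j) ?_ le_rfl
          have e : (G k - G j).1 = (C : ℂ)⁻¹ • (testFun q ϕ N α β (φ (z k)) -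
            testFun q ϕ N α β (φ (z j))) := (smul_sub _ _ _).symm
          rw [e]
          exact hscale _ (hC _ (hφd k) _ (hφd j)).2
        rw [← ofReal_norm, ← ENNReal.ofReal_toReal htop] at h2
        exact (ENNReal.ofReal_le_ofReal_iff ENNReal.toReal_nonneg).1 h2
      · have := hk k le_rfl j hj
        rw [dist_eq_norm] at this
        exact this.le
    have h3 := le_of_tendsto hlim hle
    refine le_trans ?_ h3
    rw [norm_mul, norm_inv, Complex.norm_real, Real.norm_of_nonneg hC0.le, div_eq_inv_mul,
      mul_left_comm]
    exact mul_le_mul_of_nonneg_left (hzm k) (by positivity)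
  rw [← ENNReal.ofReal_toReal htop]
  exact ENNReal.ofReal_le_ofReal (le_of_forall_pos_le_add hmain)

end LowerBound

lemma kernelCoeff_mul_inv_pow {q : ℝ} {ϕ : ℝ → ℝ} (N k : ℕ) {w : ℂ} (hw : w ∈ disc) :
    kernelCoeff q ϕ N w * ((1 - ‖w‖ ^ 2) ^ (N + k))⁻¹ = growth q ϕ k ‖w‖ := by
  rw [mem_ball_zero_iff] at hw
  have hu : 0 < 1 - ‖w‖ ^ 2 := by nlinarith [norm_nonneg w]
  unfold kernelCoeff growth
  rw [← Real.rpow_natCast (1 - ‖w‖ ^ 2), ← Real.rpow_neg hu.le, div_mul_eq_mul_div,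
    ← Real.rpow_add hu, mul_inv, ← Real.rpow_neg hu.le, div_eq_inv_mul]
  congr 2
  push_cast
  ring

lemma one_sub_conj_mul_self (w : ℂ) : 1 - starRingEnd ℂ w * w = ((1 - ‖w‖ ^ 2 : ℝ) : ℂ) := by
  rw [Complex.conj_mul']; push_cast; rfl

lemma deriv_kernel_self {q : ℝ} {ϕ : ℝ → ℝ} {N : ℕ} {w : ℂ} (hw : w ∈ disc) :
    deriv (kernel q ϕ N w) w = N * starRingEnd ℂ w * (growth q ϕ 1 ‖w‖ : ℝ) := by
  rw [deriv_kernel hw hw, one_sub_conj_mul_self]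
  have h := kernelCoeff_mul_inv_pow (q := q) (ϕ := ϕ) N 1 hw
  rw [Nat.cast_one] at h
  rw [← h]
  push_cast
  ring

lemma deriv2_kernel_self {q : ℝ} {ϕ : ℝ → ℝ} {N : ℕ} {w : ℂ} (hw : w ∈ disc) :
    deriv (deriv (kernel q ϕ N w)) w =
      N * (N + 1) * starRingEnd ℂ w ^ 2 * (growth q ϕ 2 ‖w‖ : ℝ) := by
  rw [deriv2_kernel hw hw, one_sub_conj_mul_self]
  have h := kernelCoeff_mul_inv_pow (q := q) (ϕ := ϕ) N 2 hw
  rw [Nat.cast_ofNat] at h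
  rw [← h]
  push_cast
  ring

section LowerBound

variable {p q : ℝ} {hp : 0 < p} {hq : 0 < q} {ϕ : ℝ → ℝ} {hϕ : IsNormal ϕ}
  {μ : ℂ → ℝ} {hμ : IsWeight μ} {φ : ℂ → ℂ}

lemma eventually_toBoundary (φ : ℂ → ℂ) : ∀ᶠ z in toBoundary φ, z ∈ disc ∧ 1 / 2 ≤ ‖φ z‖ := by
  have h1 : ∀ᶠ z in toBoundary φ, z ∈ disc := by
    unfold toBoundary
    exact mem_inf_of_right (mem_principal_self _)
  have h2 : Tendsto (fun z => ‖φ z‖) (toBoundary φ) (𝓝 1) := by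
    unfold toBoundary
    exact tendsto_comap.mono_left inf_le_left
  filter_upwards [h1, h2.eventually (le_mem_nhds (by norm_num : (1 / 2 : ℝ) < 1))] with z hz hz2
  exact ⟨hz, hz2⟩

/-- The passage from individual points to the limit superior, for a family of test functions whose
composition with `φ` has second derivative at least `v z / 4` at `z`. -/
lemma limsup_le_opNorm_sub
    (hφ : DifferentiableOn ℂ φ disc) (hmaps : Set.MapsTo φ disc disc)
    (h : ∀ f ∈ MixedNormSpace hp hq hϕ, comp φ f ∈ zygmundSubmodule hμ)
    {S : MixedNormSpace hp hq hϕ →ₗ[ℂ] ZygmundSpace hμ} (hS : IsCompactOp S)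
    {b : ℝ} (hb : 0 < b)
    (hab : ∀ r s : ℝ, 0 ≤ r → r ≤ s → s < 1 → ϕ r * ((1 - s) / (1 - r)) ^ b ≤ ϕ s)
    {N : ℕ} (hN : b + 1 / q < N) {α β : ℂ} {C : ℝ} (hC0 : 0 < C)
    (hC : ∀ w ∈ disc, ∀ w' ∈ disc,
      mixedNorm p q ϕ (testFun q ϕ N α β w) ≤ ENNReal.ofReal C ∧
      mixedNorm p q ϕ (testFun q ϕ N α β w - testFun q ϕ N α β w') ≤ ENNReal.ofReal C)
    {v : ℂ → ℝ} (hv : ∀ z ∈ disc, 1 / 2 ≤ ‖φ z‖ → v z / 4 ≤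
      μ (‖z‖ : ℂ) * ‖deriv (deriv (comp φ (testFun q ϕ N α β (φ z)))) z‖) :
    ENNReal.ofReal (1 / (4 * C)) * limsup (fun z => ENNReal.ofReal (v z)) (toBoundary φ) ≤
      opNorm (compositionOperator hp hq hϕ hμ φ h - S) := by
  have hc : 0 < 1 / (4 * C) := by positivity
  rw [mul_comm, ← ENNReal.le_div_iff_mul_le (Or.inl (by simpa using hC0))
    (Or.inl ENNReal.ofReal_ne_top)]
  refine le_of_forall_lt fun x hx => ?_
  obtain ⟨y, hxy, hy⟩ := exists_between hx
  refine hxy.trans_le ?_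
  rw [ENNReal.le_div_iff_mul_le (Or.inl (by simpa using hC0)) (Or.inl ENNReal.ofReal_ne_top)]
  have hytop : y ≠ ⊤ := (hy.trans_le le_top).ne
  have hf := (frequently_lt_of_lt_limsup (by isBoundedDefault) hy).and_eventually
    (eventually_toBoundary φ)
  have hm : ∃ᶠ z in toBoundary φ, y.toReal / 4 ≤
      μ (‖z‖ : ℂ) * ‖deriv (deriv (comp φ (testFun q ϕ N α β (φ z)))) z‖ := by
    refine hf.mono fun z hz => ?_
    refine le_trans ?_ (hv z hz.2.1 hz.2.2)
    have := (ENNReal.lt_ofReal_iff_toReal_lt hytop).1 hz.1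
    linarith
  refine le_trans (le_of_eq ?_) (le_opNorm_sub_of_frequently hφ hmaps h hS hb hab hN hC0 hC hm)
  rw [← ENNReal.ofReal_toReal hytop, ← ENNReal.ofReal_mul ENNReal.toReal_nonneg,
    ENNReal.toReal_ofReal ENNReal.toReal_nonneg]
  congr 1
  field_simp

end LowerBound

/-- The lower bound for the essential norm. The coefficients `(N + 1, -N)` and `(N + 2, -N)` of the
test functions make `f'(w)` and `f''(w)` vanish, respectively. -/
lemma exists_le_essNorm {p q : ℝ} (hp : 0 < p) (hq : 0 < q) {ϕ : ℝ → ℝ} (hϕ : IsNormal ϕ) :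
    ∃ c : ℝ, 0 < c ∧ ∀ (μ : ℂ → ℝ) (hμ : IsWeight μ) (φ : ℂ → ℂ), DifferentiableOn ℂ φ disc →
      Set.MapsTo φ disc disc →
      ∀ h : ∀ f ∈ MixedNormSpace hp hq hϕ, comp φ f ∈ zygmundSubmodule hμ,
        ENNReal.ofReal c * max (limsupFirst q ϕ μ φ) (limsupSecond q ϕ μ φ) ≤
          essNorm (compositionOperator hp hq hϕ hμ φ h) := by
  obtain ⟨a, b, ha, hb, hab⟩ := hϕ.exists_bounds
  have hab2 : ∀ r s : ℝ, 0 ≤ r → r ≤ s → s < 1 → ϕ r * ((1 - s) / (1 - r)) ^ b ≤ ϕ s :=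
    fun r s h1 h2 h3 => (hab r s h1 h2 h3).2
  obtain ⟨N, hN⟩ := exists_nat_gt (b + 1 / q)
  have hN1 : (1 : ℝ) ≤ N := by
    have h1 : (0 : ℝ) < N := lt_trans (by positivity) hN
    exact_mod_cast h1
  obtain ⟨C1, hC1, hb1⟩ := exists_mixedNorm_testFun_le hp hq hϕ ha hb hab hN (N + 1) (-N)
  obtain ⟨C2, hC2, hb2⟩ := exists_mixedNorm_testFun_le hp hq hϕ ha hb hab hN (N + 2) (-N)
  refine ⟨min (1 / (4 * C1)) (1 / (4 * C2)), by positivity, fun μ hμ φ hφ hmaps h => ?_⟩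
  refine le_iInf₂ fun S hS => ?_
  have hfirst := limsup_le_opNorm_sub hφ hmaps h hS hb hab2 hN hC1 hb1
    (v := fun z => μ (‖z‖ : ℂ) * ‖deriv φ z‖ ^ 2 /
      (ϕ ‖φ z‖ * (1 - ‖φ z‖ ^ 2) ^ (1 / q + 2))) (by
    intro z hz hz2
    have hw := hmaps hz
    have hg := growth_pos (q := q) hϕ 2 (norm_nonneg (φ z)) (mem_ball_zero_iff.1 hw)
    have hμz := hμ.pos_norm hz
    rw [deriv2_comp_symbol (testFun_mem_holDisc q ϕ N _ _ hw).1 hφ hmaps hz,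
      deriv_testFun hw hw, deriv2_testFun hw hw, deriv_kernel_self hw, deriv_kernel_self hw,
      deriv2_kernel_self hw, deriv2_kernel_self hw]
    have e : ((N : ℂ) + 1) * (N * (N + 1) * starRingEnd ℂ (φ z) ^ 2 * (growth q ϕ 2 ‖φ z‖ : ℝ)) +
        -(N : ℂ) * (((N + 1 : ℕ) : ℂ) * (((N + 1 : ℕ) : ℂ) + 1) * starRingEnd ℂ (φ z) ^ 2 *
          (growth q ϕ 2 ‖φ z‖ : ℝ)) =
        -((N * (N + 1) * growth q ϕ 2 ‖φ z‖ : ℝ) * starRingEnd ℂ (φ z) ^ 2) := by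
      push_cast; ring
    have e' : ((N : ℂ) + 1) * (N * starRingEnd ℂ (φ z) * (growth q ϕ 1 ‖φ z‖ : ℝ)) +
        -(N : ℂ) * (((N + 1 : ℕ) : ℂ) * starRingEnd ℂ (φ z) * (growth q ϕ 1 ‖φ z‖ : ℝ)) = 0 := by
      push_cast; ring
    rw [e, e', zero_mul, add_zero, norm_mul, norm_neg, norm_mul, norm_pow, norm_pow,
      RCLike.norm_conj, Complex.norm_real, Real.norm_of_nonneg (by positivity),
      div_eq_mul_inv _ (ϕ ‖φ z‖ * _)]
    change μ (‖z‖ : ℂ) * ‖deriv φ z‖ ^ 2 * growth q ϕ 2 ‖φ z‖ / 4 ≤ _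
    have h4 : 1 / 4 ≤ ‖φ z‖ ^ 2 := by nlinarith
    have h5 : 1 / 4 ≤ (N : ℝ) * (N + 1) * ‖φ z‖ ^ 2 := by
      have : (1 : ℝ) ≤ (N : ℝ) * (N + 1) := by nlinarith
      nlinarith
    calc _ = μ (‖z‖ : ℂ) * (‖deriv φ z‖ ^ 2 * growth q ϕ 2 ‖φ z‖) * (1 / 4) := by ring
      _ ≤ μ (‖z‖ : ℂ) * (‖deriv φ z‖ ^ 2 * growth q ϕ 2 ‖φ z‖) *
          ((N : ℝ) * (N + 1) * ‖φ z‖ ^ 2) := by gcongr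
      _ = _ := by ring)
  have hsecond := limsup_le_opNorm_sub hφ hmaps h hS hb hab2 hN hC2 hb2
    (v := fun z => μ (‖z‖ : ℂ) * ‖deriv (deriv φ) z‖ /
      (ϕ ‖φ z‖ * (1 - ‖φ z‖ ^ 2) ^ (1 / q + 1))) (by
    intro z hz hz2
    have hw := hmaps hz
    have hg := growth_pos (q := q) hϕ 1 (norm_nonneg (φ z)) (mem_ball_zero_iff.1 hw)
    have hμz := hμ.pos_norm hz
    rw [deriv2_comp_symbol (testFun_mem_holDisc q ϕ N _ _ hw).1 hφ hmaps hz,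
      deriv_testFun hw hw, deriv2_testFun hw hw, deriv_kernel_self hw, deriv_kernel_self hw,
      deriv2_kernel_self hw, deriv2_kernel_self hw]
    have e : ((N : ℂ) + 2) * (N * (N + 1) * starRingEnd ℂ (φ z) ^ 2 * (growth q ϕ 2 ‖φ z‖ : ℝ)) +
        -(N : ℂ) * (((N + 1 : ℕ) : ℂ) * (((N + 1 : ℕ) : ℂ) + 1) * starRingEnd ℂ (φ z) ^ 2 *
          (growth q ϕ 2 ‖φ z‖ : ℝ)) = 0 := by
      push_cast; ring
    have e' : ((N : ℂ) + 2) * (N * starRingEnd ℂ (φ z) * (growth q ϕ 1 ‖φ z‖ : ℝ)) +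
        -(N : ℂ) * (((N + 1 : ℕ) : ℂ) * starRingEnd ℂ (φ z) * (growth q ϕ 1 ‖φ z‖ : ℝ)) =
        (N * growth q ϕ 1 ‖φ z‖ : ℝ) * starRingEnd ℂ (φ z) := by
      push_cast; ring
    rw [e, e', zero_mul, zero_add, norm_mul, norm_mul,
      RCLike.norm_conj, Complex.norm_real, Real.norm_of_nonneg (by positivity),
      div_eq_mul_inv _ (ϕ ‖φ z‖ * _)]
    change μ (‖z‖ : ℂ) * ‖deriv (deriv φ) z‖ * growth q ϕ 1 ‖φ z‖ / 4 ≤ _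
    have h5 : 1 / 4 ≤ (N : ℝ) * ‖φ z‖ := by nlinarith
    calc _ = μ (‖z‖ : ℂ) * (‖deriv (deriv φ) z‖ * growth q ϕ 1 ‖φ z‖) * (1 / 4) := by ring
      _ ≤ μ (‖z‖ : ℂ) * (‖deriv (deriv φ) z‖ * growth q ϕ 1 ‖φ z‖) * ((N : ℝ) * ‖φ z‖) := by
          gcongr
      _ = _ := by ring)
  rw [mul_max]
  refine max_le (le_trans ?_ hfirst) (le_trans ?_ hsecond)
  · exact mul_le_mul_left (ENNReal.ofReal_le_ofReal (min_le_left _ _)) _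
  · exact mul_le_mul_left (ENNReal.ofReal_le_ofReal (min_le_right _ _)) _

/-! ### Finite-rank approximation of the identity -/

/-- The monomial `z^k` on the disc. -/
noncomputable def monom (k : ℕ) : ℂ → ℂ := disc.indicator fun z => z ^ k

lemma deriv_monom (k : ℕ) {z : ℂ} (hz : z ∈ disc) : deriv (monom k) z = k * z ^ (k - 1) := by
  have h : monom k =ᶠ[𝓝 z] fun z => z ^ k := by
    filter_upwards [Metric.isOpen_ball.mem_nhds hz] with y hy using Set.indicator_of_mem hy _
  rw [h.deriv_eq]
  simp

lemma deriv2_monom (k : ℕ) {z : ℂ} (hz : z ∈ disc) :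
    deriv (deriv (monom k)) z = k * ((k - 1 : ℕ) * z ^ (k - 1 - 1)) := by
  have h : deriv (monom k) =ᶠ[𝓝 z] fun z => k * z ^ (k - 1) := by
    filter_upwards [Metric.isOpen_ball.mem_nhds hz] with y hy using deriv_monom k hy
  rw [h.deriv_eq]
  simp

lemma mixedNorm_mono {p q : ℝ} (hp : 0 < p) (hq : 0 < q) {ϕ : ℝ → ℝ} {f g : ℂ → ℂ}
    (hfg : ∀ z, ‖f z‖ₑ ≤ ‖g z‖ₑ) : mixedNorm p q ϕ f ≤ mixedNorm p q ϕ g := by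
  unfold mixedNorm integralMean
  gcongr
  exact hfg _

lemma monom_mem {p q : ℝ} (hp : 0 < p) (hq : 0 < q) {ϕ : ℝ → ℝ} (hϕ : IsNormal ϕ) (k : ℕ) :
    monom k ∈ MixedNormSpace hp hq hϕ := by
  have h0 : (0 : ℂ) ∈ disc := by simp
  refine ⟨⟨?_, fun z hz => Set.indicator_of_notMem hz _⟩, ?_⟩
  · exact (differentiableOn_pow k).congr fun z hz => Set.indicator_of_mem hz _
  obtain ⟨a, b, ha, hb, hab⟩ := hϕ.exists_bounds
  obtain ⟨N, hN⟩ := exists_nat_gt (b + 1 / q)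
  obtain ⟨C, hC⟩ := exists_mixedNorm_kernel_le hp hq hϕ ha hb hab hN
  have hϕ0 := hϕ.pos 0 ⟨le_rfl, one_pos⟩
  have h1 : mixedNorm p q ϕ ((ϕ 0 : ℂ) • kernel q ϕ N 0) < ⊤ := by
    rw [mixedNorm_smul hp hq]
    exact ENNReal.mul_lt_top enorm_lt_top ((hC 0 h0).trans_lt ENNReal.ofReal_lt_top)
  refine (mixedNorm_mono hp hq fun z => ?_).trans_lt h1
  rw [enorm_le_iff_norm_le]
  by_cases hz : z ∈ disc
  · have e1 : monom k z = z ^ k := Set.indicator_of_mem hz _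
    have e2 : kernel q ϕ N 0 z = ((ϕ 0)⁻¹ : ℝ) := by
      rw [kernel, Set.indicator_of_mem hz]
      simp [kernelCoeff]
    rw [e1, Pi.smul_apply, e2, smul_eq_mul, ← Complex.ofReal_mul, mul_inv_cancel₀ hϕ0.ne', norm_pow]
    simpa using pow_le_one₀ (norm_nonneg z) (mem_ball_zero_iff.1 hz).le
  · rw [monom, Set.indicator_of_notMem hz, norm_zero]
    exact norm_nonneg _

section FiniteRank

variable {p q : ℝ} {hp : 0 < p} {hq : 0 < q} {ϕ : ℝ → ℝ} {hϕ : IsNormal ϕ}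

lemma contDiffAt_zero (f : MixedNormSpace hp hq hϕ) (k : ℕ) : ContDiffAt ℂ k f.1 0 :=
  (f.2.1.1.analyticAt (Metric.isOpen_ball.mem_nhds (by simp))).contDiffAt

/-- The `k`-th Taylor coefficient at the origin. -/
noncomputable def taylorCoeff (k : ℕ) : MixedNormSpace hp hq hϕ →ₗ[ℂ] ℂ where
  toFun f := (k.factorial : ℂ)⁻¹ * iteratedDeriv k f.1 0
  map_add' f g := by
    change (k.factorial : ℂ)⁻¹ * iteratedDeriv k (f.1 + g.1) 0 = _
    rw [iteratedDeriv_add (contDiffAt_zero f k) (contDiffAt_zero g k), mul_add]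
  map_smul' c f := by
    change (k.factorial : ℂ)⁻¹ * iteratedDeriv k (c • f.1) 0 = _
    rw [iteratedDeriv_const_smul_field]
    simp only [smul_eq_mul, RingHom.id_apply]
    ring

/-- The operator `f ↦ ∑_{k < n} a_k r^k z^k`, a Taylor polynomial of the dilation `f(r z)`. -/
noncomputable def taylorDilation (n : ℕ) (r : ℝ) :
    MixedNormSpace hp hq hϕ →ₗ[ℂ] MixedNormSpace hp hq hϕ :=
  ∑ k ∈ Finset.range n,
    ((r : ℂ) ^ k • taylorCoeff k).smulRight
      (⟨monom k, monom_mem hp hq hϕ k⟩ : MixedNormSpace hp hq hϕ)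

lemma taylorDilation_apply (n : ℕ) (r : ℝ) (f : MixedNormSpace hp hq hϕ) {z : ℂ} (hz : z ∈ disc) :
    (taylorDilation n r f).1 z = ∑ k ∈ Finset.range n,
      (k.factorial : ℂ)⁻¹ • (r * z - 0) ^ k • iteratedDeriv k f.1 0 := by
  have e : (taylorDilation n r f).1 = ∑ k ∈ Finset.range n,
      ((r : ℂ) ^ k * ((k.factorial : ℂ)⁻¹ * iteratedDeriv k f.1 0)) • monom k := by
    simp only [taylorDilation, LinearMap.sum_apply, LinearMap.smulRight_apply]
    rw [AddSubmonoidClass.coe_finsetSum]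
    rfl
  rw [e, Finset.sum_apply]
  refine Finset.sum_congr rfl fun k _ => ?_
  rw [Pi.smul_apply, monom, Set.indicator_of_mem hz]
  simp only [smul_eq_mul, sub_zero, mul_pow]
  ring

lemma norm_iteratedDeriv_zero_le {f : ℂ → ℂ} (hf : DifferentiableOn ℂ f disc) {R B : ℝ}
    (hR0 : 0 < R) (hR1 : R < 1) (hB : ∀ z, ‖z‖ = R → ‖f z‖ ≤ B) (k : ℕ) :
    ‖(k.factorial : ℂ)⁻¹ * iteratedDeriv k f 0‖ ≤ B / R ^ k := by
  have hd : DiffContOnCl ℂ f (Metric.ball 0 R) := (hf.mono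
    (Metric.closure_ball_subset_closedBall.trans
      (Metric.closedBall_subset_ball hR1))).diffContOnCl
  have h := Complex.norm_iteratedDeriv_le_of_forall_mem_sphere_norm_le k hR0 hd
    fun z hz => hB z (mem_sphere_zero_iff_norm.1 hz)
  rw [norm_mul, norm_inv, Complex.norm_natCast, inv_mul_le_iff₀ (by positivity), ← mul_div_assoc]
  exact h

/-- `T ∘ P` maps the unit ball into the image of a polydisc under a linear map of `ℂ^n`. -/
lemma isCompactOp_comp_taylorDilation {μ : ℂ → ℝ} {hμ : IsWeight μ}
    (T : MixedNormSpace hp hq hϕ →ₗ[ℂ] ZygmundSpace hμ) (n : ℕ) {r : ℝ} (hr0 : 0 < r)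
    (hr1 : r < 1) : IsCompactOp (T ∘ₗ taylorDilation n r) := by
  obtain ⟨C, hC, hgrow⟩ := exists_growth hp hq hϕ
  set B := C * growth q ϕ 0 r with hB
  set Φ : (Fin n → ℂ) → ZygmundSpace hμ := fun c =>
    ∑ k : Fin n, c k • T ⟨monom k, monom_mem hp hq hϕ k⟩ with hΦ
  have hΦc : Continuous Φ := by fun_prop
  have hK : IsCompact (Φ '' Metric.closedBall 0 |B|) := (isCompact_closedBall _ _).image hΦc
  refine hK.closure_of_subset ?_
  rintro _ ⟨f, hf, rfl⟩
  refine ⟨fun k => (r : ℂ) ^ (k : ℕ) * taylorCoeff (k : ℕ) f, ?_, ?_⟩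
  · rw [mem_closedBall_zero_iff, pi_norm_le_iff_of_nonneg (abs_nonneg _)]
    intro k
    have h := norm_iteratedDeriv_zero_le f.2.1.1 hr0 hr1 (B := B) (fun z hz => by
      have := hgrow f.1 f.2.1 hf z (by rw [mem_ball_zero_iff, hz]; exact hr1)
      rwa [hz] at this) k
    rw [norm_mul, norm_pow, Complex.norm_real, Real.norm_of_nonneg hr0.le]
    refine le_trans ?_ (le_abs_self B)
    rw [le_div_iff₀ (by positivity)] at h
    rw [mul_comm]
    exact h
  · simp only [hΦ, LinearMap.comp_apply, taylorDilation, LinearMap.sum_apply,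
      LinearMap.smulRight_apply, map_sum, map_smul, LinearMap.smul_apply, smul_eq_mul]
    exact Fin.sum_univ_eq_sum_range (fun k => ((r : ℂ) ^ k * taylorCoeff k f) •
      T ⟨monom k, monom_mem hp hq hϕ k⟩) n

/-- Taylor polynomials of dilations approximate the unit ball uniformly on compact subsets of the
disc, and do not exceed the growth function by more than a constant factor. -/
lemma exists_taylorDilation_approx (hp : 0 < p) (hq : 0 < q) (hϕ : IsNormal ϕ) :
    ∃ K : ℝ, 0 < K ∧ ∀ δ ε : ℝ, 0 ≤ δ → δ < 1 → 0 < ε →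
      ∃ (n : ℕ) (r : ℝ), 0 < r ∧ r < 1 ∧
        ∀ f : MixedNormSpace hp hq hϕ, mixedNorm p q ϕ f.1 ≤ 1 →
          (∀ z ∈ disc, ‖(f - taylorDilation n r f).1 z‖ ≤ K * growth q ϕ 0 ‖z‖) ∧
          (∀ z, ‖z‖ ≤ δ → ‖(f - taylorDilation n r f).1 z‖ ≤ ε) := by
  obtain ⟨C, hC, hgrow⟩ := exists_growth hp hq hϕ
  obtain ⟨c, hc, hder⟩ := exists_deriv_growth hq hϕ
  refine ⟨3 * C, by positivity, fun δ ε hδ0 hδ1 hε => ?_⟩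
  set D := c * C * growth q ϕ 1 δ with hD
  have hD0 : 0 < D := mul_pos (mul_pos hc hC) (growth_pos hϕ 1 hδ0 hδ1)
  obtain ⟨r, hr, hr0, hr1⟩ : ∃ r : ℝ, D * (1 - r) ≤ ε / 2 ∧ 0 < r ∧ r < 1 := by
    refine ⟨1 - min (1 / 2) (ε / (2 * D)), ?_, ?_, ?_⟩
    · calc D * (1 - (1 - min (1 / 2) (ε / (2 * D)))) ≤ D * (ε / (2 * D)) := by
            rw [sub_sub_cancel]; gcongr; exact min_le_right _ _
        _ = ε / 2 := by field_simp
    · linarith [min_le_left (1 / 2) (ε / (2 * D))]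
    · have : 0 < min (1 / 2) (ε / (2 * D)) := by positivity
      linarith
  set R := (1 + r) / 2 with hR
  have hR0 : 0 < R := by positivity
  have hR1 : R < 1 := by rw [hR]; linarith
  set B := C * growth q ϕ 0 R with hB
  have hB0 : 0 < B := mul_pos hC (growth_pos hϕ 0 hR0.le hR1)
  set θ := r / R with hθ
  have hθ0 : 0 < θ := by positivity
  have hθ1 : θ < 1 := by rw [hθ, div_lt_one hR0, hR]; linarith
  have hg00 : 0 < growth q ϕ 0 0 := growth_pos hϕ 0 le_rfl one_pos
  set η := min (ε / 2) (C * growth q ϕ 0 0) with hη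
  have hη0 : 0 < η := lt_min (by positivity) (by positivity)
  obtain ⟨n, hn⟩ : ∃ n : ℕ, B * θ ^ n / (1 - θ) ≤ η := by
    have ht : Tendsto (fun n : ℕ => B * θ ^ n / (1 - θ)) atTop (𝓝 0) := by
      have := ((tendsto_pow_atTop_nhds_zero_of_lt_one hθ0.le hθ1).const_mul B).div_const (1 - θ)
      simpa using this
    exact (ht.eventually (ge_mem_nhds hη0)).exists
  refine ⟨n, r, hr0, hr1, fun f hf => ?_⟩
  have hrz : ∀ z : ℂ, ‖(r : ℂ) * z‖ = r * ‖z‖ := fun z => by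
    rw [norm_mul, Complex.norm_real, Real.norm_of_nonneg hr0.le]
  have hrd : ∀ z ∈ disc, (r : ℂ) * z ∈ disc := fun z hz => by
    rw [mem_ball_zero_iff] at hz ⊢
    rw [hrz]; nlinarith [norm_nonneg z]
  have htail : ∀ z ∈ disc, ‖f.1 (r * z) - (taylorDilation n r f).1 z‖ ≤ η := by
    intro z hz
    have hs := Complex.hasSum_taylorSeries_on_ball f.2.1.1 (hrd z hz)
    have hterm : ∀ k : ℕ, ‖(k.factorial : ℂ)⁻¹ • ((r : ℂ) * z - 0) ^ k • iteratedDeriv k f.1 0‖ ≤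
        B * θ ^ k := by
      intro k
      have h1 := norm_iteratedDeriv_zero_le f.2.1.1 hR0 hR1 (B := B) (fun z hz => by
        have := hgrow f.1 f.2.1 hf z (by rw [mem_ball_zero_iff, hz]; exact hR1)
        rwa [hz] at this) k
      rw [smul_smul, mul_comm (k.factorial : ℂ)⁻¹, smul_eq_mul, mul_assoc, norm_mul, norm_pow,
        sub_zero, hrz]
      calc (r * ‖z‖) ^ k * ‖(k.factorial : ℂ)⁻¹ * iteratedDeriv k f.1 0‖
          ≤ (r * 1) ^ k * (B / R ^ k) := by
            gcongr
            exact (mem_ball_zero_iff.1 hz).le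
        _ = B * θ ^ k := by rw [hθ, div_pow r R, mul_one, mul_div_left_comm]
    have h := norm_sub_le_of_geometric_bound_of_hasSum hθ1 hterm hs n
    rw [norm_sub_rev, taylorDilation_apply n r f hz]
    exact h.trans hn
  have hsplit : ∀ z, (f - taylorDilation n r f).1 z =
      (f.1 z - f.1 (r * z)) + (f.1 (r * z) - (taylorDilation n r f).1 z) := by
    intro z
    change f.1 z - (taylorDilation n r f).1 z = _
    ring
  constructor
  · intro z hz
    have hz1 := mem_ball_zero_iff.1 hz
    have h1 := hgrow f.1 f.2.1 hf z hz
    have h2 := hgrow f.1 f.2.1 hf _ (hrd z hz)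
    have h3 := htail z hz
    have h4 : growth q ϕ 0 ‖(r : ℂ) * z‖ ≤ growth q ϕ 0 ‖z‖ := by
      refine growth_mono hq hϕ le_rfl (norm_nonneg _) ?_ hz1
      rw [hrz]; nlinarith [norm_nonneg z]
    have h5 : growth q ϕ 0 0 ≤ growth q ϕ 0 ‖z‖ :=
      growth_mono hq hϕ le_rfl le_rfl (norm_nonneg _) hz1
    have h6 : η ≤ C * growth q ϕ 0 ‖z‖ :=
      (min_le_right _ _).trans (mul_le_mul_of_nonneg_left h5 hC.le)
    have h7 := mul_le_mul_of_nonneg_left h4 hC.le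
    rw [hsplit]
    calc _ ≤ ‖f.1 z‖ + ‖f.1 (r * z)‖ + ‖f.1 (r * z) - (taylorDilation n r f).1 z‖ :=
          (norm_add_le _ _).trans (add_le_add_left (norm_sub_le _ _) _)
      _ ≤ _ := by linarith
  · intro z hz
    have hzd : z ∈ disc := by rw [mem_ball_zero_iff]; linarith
    have hmv : ‖f.1 z - f.1 (r * z)‖ ≤ D * ‖z - r * z‖ := by
      refine (convex_closedBall (0 : ℂ) δ).norm_image_sub_le_of_norm_deriv_le (𝕜 := ℂ)
        (fun x hx => ?_) (fun x hx => ?_) ?_ ?_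
      · exact f.2.1.1.differentiableAt (Metric.isOpen_ball.mem_nhds
          (Metric.closedBall_subset_ball hδ1 hx))
      · have hx' := mem_closedBall_zero_iff.1 hx
        refine ((hder f.1 C f.2.1.1 (hgrow f.1 f.2.1 hf) x
          (Metric.closedBall_subset_ball hδ1 hx)).1).trans ?_
        rw [hD]
        exact mul_le_mul_of_nonneg_left
          (growth_mono hq hϕ zero_le_one (norm_nonneg _) hx' hδ1) (by positivity)
      · rw [mem_closedBall_zero_iff, hrz]
        nlinarith [norm_nonneg z]
      · rwa [mem_closedBall_zero_iff]
    have hnz : ‖z - r * z‖ ≤ 1 - r := by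
      have e : z - r * z = ((1 - r : ℝ) : ℂ) * z := by push_cast; ring
      rw [e, norm_mul, Complex.norm_real, Real.norm_of_nonneg (by linarith)]
      nlinarith [norm_nonneg z]
    rw [hsplit]
    calc _ ≤ ‖f.1 z - f.1 (r * z)‖ + ‖f.1 (r * z) - (taylorDilation n r f).1 z‖ := norm_add_le _ _
      _ ≤ D * (1 - r) + η := by
          refine add_le_add (hmv.trans ?_) (htail z hzd)
          gcongr
      _ ≤ ε := by linarith [min_le_left (ε / 2) (C * growth q ϕ 0 0)]

end FiniteRank

/-! ### Upper bound for the essential norm -/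

/-- Composition with `φ` sends `z` and `z²` into `Z_μ`, so `μ|φ'|²` and `μ|φ''|` are bounded. -/
lemma exists_symbol_bound {p q : ℝ} {hp : 0 < p} {hq : 0 < q} {ϕ : ℝ → ℝ} {hϕ : IsNormal ϕ}
    {μ : ℂ → ℝ} {hμ : IsWeight μ} {φ : ℂ → ℂ}
    (hφ : DifferentiableOn ℂ φ disc) (hmaps : Set.MapsTo φ disc disc)
    (h : ∀ f ∈ MixedNormSpace hp hq hϕ, comp φ f ∈ zygmundSubmodule hμ) :
    ∃ Q : ℝ, ∀ z ∈ disc, μ (‖z‖ : ℂ) * ‖deriv φ z‖ ^ 2 ≤ Q ∧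
      μ (‖z‖ : ℂ) * ‖deriv (deriv φ) z‖ ≤ Q := by
  obtain ⟨Q1, hQ1⟩ := (h _ (monom_mem hp hq hϕ 1)).2
  obtain ⟨Q2, hQ2⟩ := (h _ (monom_mem hp hq hϕ 2)).2
  refine ⟨Q1 + Q2, fun z hz => ?_⟩
  have hμz := hμ.pos_norm hz
  have h1 : μ (‖z‖ : ℂ) * ‖deriv (deriv φ) z‖ ≤ Q1 := by
    have := hQ1 ⟨⟨z, hz⟩, rfl⟩
    unfold zygFun at this
    rw [deriv2_comp_symbol (monom_mem hp hq hϕ 1).1.1 hφ hmaps hz, deriv_monom _ (hmaps hz),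
      deriv2_monom _ (hmaps hz)] at this
    simpa using this
  have h2 : μ (‖z‖ : ℂ) * ‖2 * deriv φ z ^ 2 + 2 * φ z * deriv (deriv φ) z‖ ≤ Q2 := by
    have := hQ2 ⟨⟨z, hz⟩, rfl⟩
    unfold zygFun at this
    rw [deriv2_comp_symbol (monom_mem hp hq hϕ 2).1.1 hφ hmaps hz, deriv_monom _ (hmaps hz),
      deriv2_monom _ (hmaps hz)] at this
    simpa using this
  have hφz : ‖φ z‖ ≤ 1 := (mem_ball_zero_iff.1 (hmaps hz)).le
  have h3 : 2 * ‖deriv φ z‖ ^ 2 ≤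
      ‖2 * deriv φ z ^ 2 + 2 * φ z * deriv (deriv φ) z‖ + 2 * ‖deriv (deriv φ) z‖ := by
    have e : 2 * deriv φ z ^ 2 = (2 * deriv φ z ^ 2 + 2 * φ z * deriv (deriv φ) z) -
      2 * φ z * deriv (deriv φ) z := by ring
    have e2 : ‖2 * deriv φ z ^ 2‖ = 2 * ‖deriv φ z‖ ^ 2 := by
      rw [norm_mul, norm_pow]; norm_num
    rw [← e2]
    conv_lhs => rw [e]
    refine (norm_sub_le _ _).trans (add_le_add_right ?_ _)
    rw [norm_mul, norm_mul, Complex.norm_ofNat]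
    nlinarith [norm_nonneg (deriv (deriv φ) z)]
  have h4 := mul_le_mul_of_nonneg_left h3 hμz.le
  have h5 : 0 ≤ μ (‖z‖ : ℂ) * ‖deriv (deriv φ) z‖ := by positivity
  have h6 : 0 ≤ μ (‖z‖ : ℂ) * ‖deriv φ z‖ ^ 2 := by positivity
  have h7 : 0 ≤ Q2 := le_trans (by positivity) h2
  constructor <;> nlinarith

/-- A bound near the boundary for the two quotients in the limits superior. -/
lemma exists_radius_of_limsup_lt {q : ℝ} {ϕ : ℝ → ℝ} {μ : ℂ → ℝ} {φ : ℂ → ℂ} {M : ℝ}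
    (h1 : limsupFirst q ϕ μ φ < ENNReal.ofReal M)
    (h2 : limsupSecond q ϕ μ φ < ENNReal.ofReal M) :
    ∃ δ : ℝ, 0 ≤ δ ∧ δ < 1 ∧ ∀ z ∈ disc, ‖φ z‖ < 1 → δ < ‖φ z‖ →
      μ (‖z‖ : ℂ) * ‖deriv φ z‖ ^ 2 * growth q ϕ 2 ‖φ z‖ ≤ M ∧
      μ (‖z‖ : ℂ) * ‖deriv (deriv φ) z‖ * growth q ϕ 1 ‖φ z‖ ≤ M := by
  have e1 := eventually_lt_of_limsup_lt h1
  have e2 := eventually_lt_of_limsup_lt h2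
  have e := e1.and e2
  unfold toBoundary at e
  rw [eventually_inf_principal, eventually_comap] at e
  obtain ⟨η, hη, hball⟩ := Metric.eventually_nhds_iff.1 e
  refine ⟨max 0 (1 - η), le_max_left _ _, max_lt one_pos (by linarith), fun z hz hz1 hzδ => ?_⟩
  have hd : dist ‖φ z‖ 1 < η := by
    rw [Real.dist_eq, abs_sub_lt_iff]
    have := (le_max_right 0 (1 - η)).trans_lt hzδ
    constructor <;> linarith
  obtain ⟨a1, a2⟩ := hball hd z rfl hz
  exact ⟨(ENNReal.ofReal_lt_ofReal_iff'.1 a1).1.le, (ENNReal.ofReal_lt_ofReal_iff'.1 a2).1.le⟩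

/-- The upper bound for the essential norm. -/
lemma exists_essNorm_le {p q : ℝ} (hp : 0 < p) (hq : 0 < q) {ϕ : ℝ → ℝ} (hϕ : IsNormal ϕ) :
    ∃ C : ℝ, 0 < C ∧ ∀ (μ : ℂ → ℝ) (hμ : IsWeight μ) (φ : ℂ → ℂ), DifferentiableOn ℂ φ disc →
      Set.MapsTo φ disc disc →
      ∀ h : ∀ f ∈ MixedNormSpace hp hq hϕ, comp φ f ∈ zygmundSubmodule hμ,
        essNorm (compositionOperator hp hq hϕ hμ φ h) ≤
          ENNReal.ofReal C * max (limsupFirst q ϕ μ φ) (limsupSecond q ϕ μ φ) := by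
  obtain ⟨K, hK, happrox⟩ := exists_taylorDilation_approx hp hq hϕ
  obtain ⟨c, hc, hder⟩ := exists_deriv_growth hq hϕ
  refine ⟨1 + 2 * (c * K), by positivity, fun μ hμ φ hφ hmaps h => ?_⟩
  set T := compositionOperator hp hq hϕ hμ φ h with hT
  have hC0 : 0 < 1 + 2 * (c * K) := by positivity
  have m0 : (0 : ℂ) ∈ disc := by simp
  have main : ∀ M : ℝ, max (limsupFirst q ϕ μ φ) (limsupSecond q ϕ μ φ) < ENNReal.ofReal M →
      essNorm T ≤ ENNReal.ofReal ((1 + 2 * (c * K)) * M) := by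
    intro M hM
    have hM0 : 0 < M := ENNReal.ofReal_pos.1 (zero_le.trans_lt hM)
    obtain ⟨δ₀, hδ₀0, hδ₀1, hnear⟩ := exists_radius_of_limsup_lt
      ((le_max_left _ _).trans_lt hM) ((le_max_right _ _).trans_lt hM)
    obtain ⟨Q, hQ⟩ := exists_symbol_bound hφ hmaps h
    have hQ0 : 0 ≤ Q := le_trans (mul_nonneg (hμ.pos_norm m0).le (by positivity)) (hQ 0 m0).1
    set δ := max δ₀ ‖φ 0‖ with hδ
    have hδ0 : 0 ≤ δ := hδ₀0.trans (le_max_left _ _)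
    have hδ1 : δ < 1 := max_lt hδ₀1 (mem_ball_zero_iff.1 (hmaps m0))
    set d := (1 - δ) / 2 with hd
    have hd0 : 0 < d := by rw [hd]; linarith
    have hδd : δ + d < 1 := by rw [hd]; linarith
    -- chosen so that the part of the norm coming from `|φ| ≤ δ` is at most `M`
    set Y := (1 + 1 / d + 2 / d ^ 2) * (1 + ‖deriv φ 0‖ + 2 * Q) with hY
    have hY0 : 0 < Y := by positivity
    obtain ⟨n, r, hr0, hr1, hE⟩ := happrox (δ + d) (M / Y) (by positivity) hδd (by positivity)
    refine iInf₂_le_of_le (T ∘ₗ taylorDilation n r)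
      (isCompactOp_comp_taylorDilation T n hr0 hr1) ?_
    refine iSup₂_le fun f hf => ?_
    obtain ⟨hE1, hE2⟩ := hE f hf
    set E := f - taylorDilation n r f with hEdef
    have hTE : (T - T ∘ₗ taylorDilation n r) f = T E := by
      rw [LinearMap.sub_apply, LinearMap.comp_apply, ← map_sub]
    rw [hTE, ← ofReal_norm]
    refine ENNReal.ofReal_le_ofReal ?_
    set κ := M / Y * (1 + 1 / d + 2 / d ^ 2) with hκ
    have hκ0 : 0 < κ := by positivity
    have hMY : 0 < M / Y := by positivity
    have hsmall : ∀ w, ‖w‖ ≤ δ → ‖E.1 w‖ ≤ κ ∧ ‖deriv E.1 w‖ ≤ κ ∧ ‖deriv (deriv E.1) w‖ ≤ κ := by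
      intro w hw
      obtain ⟨h1, h2⟩ := norm_deriv_le_of_forall_closedBall E.2.1.1 (w := w) hd0
        (by linarith) (M := M / Y) fun z hz => hE2 z (by linarith)
      have p1 : 0 < 1 / d := by positivity
      have p2 : 0 < 2 / d ^ 2 := by positivity
      have e1 : M / Y / d = M / Y * (1 / d) := by ring
      have e2 : 2 * (M / Y) / d ^ 2 = M / Y * (2 / d ^ 2) := by ring
      rw [e1] at h1
      rw [e2] at h2
      refine ⟨(hE2 w (by linarith)).trans ?_, h1.trans ?_, h2.trans ?_⟩ <;> rw [hκ] <;> nlinarith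
    have hφ0 : ‖φ 0‖ ≤ δ := le_max_right _ _
    obtain ⟨s0, s1, -⟩ := hsmall (φ 0) hφ0
    have hTf : (T E).toFun = comp φ E.1 := rfl
    have hv0 : ‖(T E).toFun 0‖ ≤ κ := by
      rw [hTf, comp, Set.indicator_of_mem m0]
      exact s0
    have hv1 : ‖deriv (T E).toFun 0‖ ≤ κ * ‖deriv φ 0‖ := by
      rw [hTf, deriv_comp_symbol E.2.1.1 hφ hmaps m0, norm_mul]
      gcongr
    have hv2 : ∀ z : disc, μ (‖(z : ℂ)‖ : ℂ) * ‖deriv (deriv (T E).toFun) z‖ ≤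
        κ * (2 * Q) + 2 * (c * K) * M := by
      rintro ⟨z, hz⟩
      simp only
      have hμz := hμ.pos_norm hz
      obtain ⟨q1, q2⟩ := hQ z hz
      have hz1 := mem_ball_zero_iff.1 (hmaps hz)
      rw [hTf, deriv2_comp_symbol E.2.1.1 hφ hmaps hz]
      have hn : μ (‖z‖ : ℂ) * ‖deriv (deriv E.1) (φ z) * deriv φ z ^ 2 +
          deriv E.1 (φ z) * deriv (deriv φ) z‖ ≤
          ‖deriv (deriv E.1) (φ z)‖ * (μ (‖z‖ : ℂ) * ‖deriv φ z‖ ^ 2) +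
          ‖deriv E.1 (φ z)‖ * (μ (‖z‖ : ℂ) * ‖deriv (deriv φ) z‖) := by
        calc _ ≤ μ (‖z‖ : ℂ) * (‖deriv (deriv E.1) (φ z)‖ * ‖deriv φ z‖ ^ 2 +
              ‖deriv E.1 (φ z)‖ * ‖deriv (deriv φ) z‖) := by
              gcongr
              refine (norm_add_le _ _).trans_eq ?_
              rw [norm_mul, norm_mul, norm_pow]
          _ = _ := by ring
      refine hn.trans ?_
      rcases le_or_gt ‖φ z‖ δ with hle | hgt
      · obtain ⟨-, t1, t2⟩ := hsmall (φ z) hle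
        have b1 := mul_le_mul t2 q1 (by positivity) hκ0.le
        have b2 := mul_le_mul t1 q2 (by positivity) hκ0.le
        have b3 : 0 ≤ 2 * (c * K) * M := by positivity
        linarith
      · obtain ⟨n1, n2⟩ := hnear z hz hz1 ((le_max_left _ _).trans_lt hgt)
        obtain ⟨g1, g2⟩ := hder E.1 K E.2.1.1 hE1 (φ z) (hmaps hz)
        have p1 : 0 ≤ μ (‖z‖ : ℂ) * ‖deriv φ z‖ ^ 2 := by positivity
        have p2 : 0 ≤ μ (‖z‖ : ℂ) * ‖deriv (deriv φ) z‖ := by positivity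
        have b1 := mul_le_mul_of_nonneg_right g2 p1
        have b2 := mul_le_mul_of_nonneg_right g1 p2
        have b3 := mul_le_mul_of_nonneg_left n1 (mul_pos hc hK).le
        have b4 := mul_le_mul_of_nonneg_left n2 (mul_pos hc hK).le
        have b5 : 0 ≤ κ * (2 * Q) := by positivity
        calc _ ≤ c * K * growth q ϕ 2 ‖φ z‖ * (μ (‖z‖ : ℂ) * ‖deriv φ z‖ ^ 2) +
              c * K * growth q ϕ 1 ‖φ z‖ * (μ (‖z‖ : ℂ) * ‖deriv (deriv φ) z‖) :=
              add_le_add b1 b2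
          _ = c * K * (μ (‖z‖ : ℂ) * ‖deriv φ z‖ ^ 2 * growth q ϕ 2 ‖φ z‖) +
              c * K * (μ (‖z‖ : ℂ) * ‖deriv (deriv φ) z‖ * growth q ϕ 1 ‖φ z‖) := by ring
          _ ≤ c * K * M + c * K * M := add_le_add b3 b4
          _ ≤ _ := by linarith
    have hne : Nonempty disc := ⟨⟨0, m0⟩⟩
    rw [ZygmundSpace.norm_def]
    have hsup := ciSup_le hv2
    have hsum : κ * (1 + ‖deriv φ 0‖ + 2 * Q) = M := by
      rw [hκ, mul_assoc, ← hY, div_mul_cancel₀ _ hY0.ne']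
    linarith
  rw [mul_comm, ← ENNReal.div_le_iff_le_mul (Or.inl (by simpa using hC0))
    (Or.inl ENNReal.ofReal_ne_top)]
  refine le_of_forall_gt_imp_ge_of_dense fun x hx => ?_
  rcases eq_or_ne x ⊤ with rfl | hxt
  · exact le_top
  · rw [← ENNReal.ofReal_toReal hxt] at hx ⊢
    rw [ENNReal.div_le_iff_le_mul (Or.inl (by simpa using hC0)) (Or.inl ENNReal.ofReal_ne_top),
      ← ENNReal.ofReal_mul ENNReal.toReal_nonneg, mul_comm]
    exact main _ hx

/-! ### Completeness of the Zygmund-type space, and limits of compact operators -/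

section Complete

variable {μ : ℂ → ℝ} {hμ : IsWeight μ}

lemma IsWeight.exists_lower_bound (hμ : IsWeight μ) {r : ℝ} (hr0 : 0 ≤ r) (hr1 : r < 1) :
    ∃ m : ℝ, 0 < m ∧ ∀ z : ℂ, ‖z‖ ≤ r → m ≤ μ (‖z‖ : ℂ) := by
  have hsub : Metric.closedBall (0 : ℂ) r ⊆ disc := Metric.closedBall_subset_ball hr1
  obtain ⟨x, hx, hmin⟩ := (isCompact_closedBall (0 : ℂ) r).exists_isMinOn
    ⟨0, by simpa using hr0⟩ (hμ.cont.mono hsub)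
  refine ⟨μ x, hμ.pos x (hsub hx), fun z hz => ?_⟩
  exact hmin (by simpa using hz)

/-- Convergence in `Z_μ` controls uniform convergence on compact subsets of the disc. -/
lemma ZygmundSpace.exists_norm_apply_le (hμ : IsWeight μ) {r : ℝ} (hr0 : 0 ≤ r) (hr1 : r < 1) :
    ∃ K : ℝ, 0 < K ∧ ∀ (f : ZygmundSpace hμ) (z : ℂ), ‖z‖ ≤ r → ‖f.toFun z‖ ≤ K * ‖f‖ := by
  obtain ⟨m, hm, hmz⟩ := hμ.exists_lower_bound hr0 hr1
  refine ⟨2 + 1 / m, by positivity, fun f z hz => ?_⟩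
  have hsub : Metric.closedBall (0 : ℂ) r ⊆ disc := Metric.closedBall_subset_ball hr1
  have hsup : 0 ≤ ⨆ z : disc, μ (‖(z : ℂ)‖ : ℂ) * ‖deriv (deriv f.toFun) z‖ :=
    Real.iSup_nonneg fun z => zygFun_nonneg hμ f.toFun z
  have h0 : ‖f.toFun 0‖ ≤ ‖f‖ := by
    rw [ZygmundSpace.norm_def]; linarith [norm_nonneg (deriv f.toFun 0)]
  have h1 : ‖deriv f.toFun 0‖ ≤ ‖f‖ := by
    rw [ZygmundSpace.norm_def]; linarith [norm_nonneg (f.toFun 0)]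
  have h2 : ∀ x ∈ Metric.closedBall (0 : ℂ) r, ‖deriv (deriv f.toFun) x‖ ≤ ‖f‖ / m := by
    intro x hx
    rw [le_div_iff₀ hm, mul_comm]
    refine le_trans ?_ (f.zygFun_le_norm ⟨x, hsub hx⟩)
    exact mul_le_mul_of_nonneg_right (hmz x (by simpa using hx)) (norm_nonneg _)
  have hc := convex_closedBall (0 : ℂ) r
  have h0m : (0 : ℂ) ∈ Metric.closedBall (0 : ℂ) r := by simpa using hr0
  have hfd : ∀ x ∈ Metric.closedBall (0 : ℂ) r, DifferentiableAt ℂ f.toFun x := fun x hx =>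
    f.2.1.1.differentiableAt (Metric.isOpen_ball.mem_nhds (hsub hx))
  have hfd2 : ∀ x ∈ Metric.closedBall (0 : ℂ) r, DifferentiableAt ℂ (deriv f.toFun) x :=
    fun x hx => (hol_deriv f.2.1).differentiableAt (Metric.isOpen_ball.mem_nhds (hsub hx))
  have hdiv : 0 ≤ ‖f‖ / m := by positivity
  have h3 : ∀ x ∈ Metric.closedBall (0 : ℂ) r, ‖deriv f.toFun x‖ ≤ ‖f‖ + ‖f‖ / m := by
    intro x hx
    have h := hc.norm_image_sub_le_of_norm_deriv_le hfd2 h2 h0m hx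
    have hx1 : ‖x - 0‖ ≤ 1 := by
      rw [sub_zero]; exact (mem_closedBall_zero_iff.1 hx).trans hr1.le
    have h4 := norm_le_norm_add_norm_sub' (deriv f.toFun x) (deriv f.toFun 0)
    nlinarith [norm_nonneg (x - 0)]
  have hz' : z ∈ Metric.closedBall (0 : ℂ) r := by simpa using hz
  have h := hc.norm_image_sub_le_of_norm_deriv_le hfd h3 h0m hz'
  have hx1 : ‖z - 0‖ ≤ 1 := by rw [sub_zero]; linarith
  have h4 := norm_le_norm_add_norm_sub' (f.toFun z) (f.toFun 0)
  have e : (2 + 1 / m) * ‖f‖ = ‖f‖ + (‖f‖ + ‖f‖ / m) := by ring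
  rw [e]
  nlinarith [norm_nonneg (z - 0), norm_nonneg f]

lemma ZygmundSpace.sub_toFun (f g : ZygmundSpace hμ) : (f - g).toFun = f.toFun - g.toFun := rfl

lemma deriv_sub_of_mem {f g : ℂ → ℂ} (hf : f ∈ holDisc) (hg : g ∈ holDisc) {z : ℂ}
    (hz : z ∈ disc) : deriv (f - g) z = deriv f z - deriv g z := by
  have hn := Metric.isOpen_ball.mem_nhds hz
  exact deriv_sub (hf.1.differentiableAt hn) (hg.1.differentiableAt hn)

lemma deriv2_sub_of_mem {f g : ℂ → ℂ} (hf : f ∈ holDisc) (hg : g ∈ holDisc) {z : ℂ}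
    (hz : z ∈ disc) : deriv (deriv (f - g)) z = deriv (deriv f) z - deriv (deriv g) z := by
  have h := deriv2_add_of_mem hf (holDisc.smul_mem (-1) hg) hz
  rw [deriv2_smul, neg_one_smul, ← sub_eq_add_neg] at h
  rw [h]; ring

instance ZygmundSpace.instCompleteSpace : CompleteSpace (ZygmundSpace hμ) := by
  refine Metric.complete_of_cauchySeq_tendsto fun u hu => ?_
  have m0 : (0 : ℂ) ∈ disc := by simp
  set f : ℕ → ℂ → ℂ := fun n => (u n).toFun with hf
  have hhol : ∀ n, f n ∈ holDisc := fun n => (u n).2.1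
  have hunif : ∀ r : ℝ, 0 ≤ r → r < 1 → UniformCauchySeqOn f atTop (Metric.closedBall 0 r) := by
    intro r hr0 hr1
    obtain ⟨K, hK, hKf⟩ := ZygmundSpace.exists_norm_apply_le hμ hr0 hr1
    rw [Metric.uniformCauchySeqOn_iff]
    intro ε hε
    obtain ⟨n₀, hn₀⟩ := Metric.cauchySeq_iff.1 hu (ε / K) (by positivity)
    refine ⟨n₀, fun j hj k hk z hz => ?_⟩
    have h1 := hKf (u j - u k) z (by simpa using hz)
    have h2 := hn₀ j hj k hk
    rw [dist_eq_norm] at h2 ⊢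
    rw [ZygmundSpace.sub_toFun] at h1
    refine h1.trans_lt ?_
    rw [lt_div_iff₀ hK] at h2
    linarith
  have hpt : ∀ z : ℂ, ∃ y, Tendsto (fun n => f n z) atTop (𝓝 y) := by
    intro z
    by_cases hz : z ∈ disc
    · refine cauchySeq_tendsto_of_complete ?_
      exact (hunif ‖z‖ (norm_nonneg z) (mem_ball_zero_iff.1 hz)).cauchySeq (by simp)
    · exact ⟨0, by simp only [(hhol _).2 z hz]; exact tendsto_const_nhds⟩
  choose F hF using hpt
  have hloc : TendstoLocallyUniformlyOn f F atTop disc := by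
    rw [tendstoLocallyUniformlyOn_iff_forall_isCompact Metric.isOpen_ball]
    intro A hA hAc
    rcases A.eq_empty_or_nonempty with rfl | hne
    · exact tendstoUniformlyOn_empty
    obtain ⟨x, hx, hmax⟩ := hAc.exists_isMaxOn hne continuous_norm.continuousOn
    have h1 := (hunif ‖x‖ (norm_nonneg x)
      (mem_ball_zero_iff.1 (hA hx))).tendstoUniformlyOn_of_tendsto fun z _ => hF z
    exact h1.mono fun z hz => by simpa using hmax hz
  have hd : ∀ᶠ n in atTop, DifferentiableOn ℂ (f n) disc := Eventually.of_forall fun n => (hhol n).1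
  have hFhol : F ∈ holDisc := by
    refine ⟨hloc.differentiableOn hd Metric.isOpen_ball, fun z hz => ?_⟩
    refine tendsto_nhds_unique (hF z) ?_
    simp only [(hhol _).2 z hz]
    exact tendsto_const_nhds
  have hloc1 := hloc.deriv hd Metric.isOpen_ball
  have hd1 : ∀ᶠ n in atTop, DifferentiableOn ℂ ((deriv ∘ f) n) disc :=
    Eventually.of_forall fun n => hol_deriv (hhol n)
  have hloc2 := hloc1.deriv hd1 Metric.isOpen_ball
  have hlim : ∀ ε > 0, ∃ n₀, ∀ k ≥ n₀, ∀ z : disc,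
      ‖(f k - F) 0‖ + ‖deriv (f k - F) 0‖ + zygFun μ (f k - F) z ≤ ε := by
    intro ε hε
    obtain ⟨n₀, hn₀⟩ := Metric.cauchySeq_iff.1 hu ε hε
    refine ⟨n₀, fun k hk z => ?_⟩
    have hT : Tendsto (fun j => ‖(f k - f j) 0‖ + ‖deriv (f k - f j) 0‖ + zygFun μ (f k - f j) z)
        atTop (𝓝 (‖(f k - F) 0‖ + ‖deriv (f k - F) 0‖ + zygFun μ (f k - F) z)) := by
      unfold zygFun
      simp only [deriv_sub_of_mem (hhol k) (hhol _) m0, deriv_sub_of_mem (hhol k) hFhol m0,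
        deriv2_sub_of_mem (hhol k) (hhol _) z.2, deriv2_sub_of_mem (hhol k) hFhol z.2,
        Pi.sub_apply]
      exact (((hF 0).const_sub _).norm.add (((hloc1.tendsto_at m0).const_sub _).norm)).add
        ((((hloc2.tendsto_at z.2).const_sub _).norm).const_mul _)
    refine le_of_tendsto hT ?_
    filter_upwards [eventually_ge_atTop n₀] with j hj
    have h1 := (hn₀ k hk j hj).le
    rw [dist_eq_norm, ZygmundSpace.norm_def] at h1
    refine le_trans (add_le_add_right ?_ _) h1
    exact le_ciSup (u k - u j).2.2 z
  have hsubmem : ∀ k, f k - F ∈ holDisc := fun k => holDisc.sub_mem (hhol k) hFhol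
  have hFz : F ∈ zygmundSubmodule hμ := by
    obtain ⟨n₀, hn₀⟩ := hlim 1 one_pos
    have h1 : f n₀ - F ∈ zygmundSubmodule hμ := by
      refine ⟨hsubmem n₀, 1, ?_⟩
      rintro _ ⟨z, rfl⟩
      have := hn₀ n₀ le_rfl z
      linarith [norm_nonneg ((f n₀ - F) 0), norm_nonneg (deriv (f n₀ - F) 0)]
    have h2 := (zygmundSubmodule hμ).sub_mem (u n₀).2 h1
    have e : (u n₀).1 - (f n₀ - F) = F := sub_sub_cancel (f n₀) F
    rwa [e] at h2
  obtain ⟨G, hG⟩ : ∃ G : ZygmundSpace hμ, G.toFun = F := ⟨⟨F, hFz⟩, rfl⟩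
  refine ⟨G, Metric.tendsto_atTop.2 fun ε hε => ?_⟩
  obtain ⟨n₀, hn₀⟩ := hlim (ε / 2) (by positivity)
  refine ⟨n₀, fun k hk => ?_⟩
  have hne : Nonempty disc := ⟨⟨0, m0⟩⟩
  have h1 : ⨆ z : disc, zygFun μ (f k - F) z ≤
      ε / 2 - (‖(f k - F) 0‖ + ‖deriv (f k - F) 0‖) :=
    ciSup_le fun z => by linarith [hn₀ k hk z]
  rw [dist_eq_norm, ZygmundSpace.norm_def, ZygmundSpace.sub_toFun, hG]
  change ‖(f k - F) 0‖ + ‖deriv (f k - F) 0‖ + (⨆ z : disc, zygFun μ (f k - F) z) < ε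
  linarith

variable {p q : ℝ} {hp : 0 < p} {hq : 0 < q} {ϕ : ℝ → ℝ} {hϕ : IsNormal ϕ}

/-- The compact operators are closed in the operator norm. -/
lemma isCompactOp_of_essNorm_eq_zero {T : MixedNormSpace hp hq hϕ →ₗ[ℂ] ZygmundSpace hμ}
    (hT : essNorm T = 0) : IsCompactOp T := by
  refine TotallyBounded.isCompact_of_isClosed ?_ isClosed_closure
  refine TotallyBounded.closure (Metric.totallyBounded_iff.2 fun ε hε => ?_)
  have h1 : essNorm T < ENNReal.ofReal (ε / 2) := by
    rw [hT]; simpa using hε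
  unfold essNorm at h1
  simp only [iInf_lt_iff] at h1
  obtain ⟨S, hS, hTS⟩ := h1
  have hSt : TotallyBounded (S '' {f | mixedNorm p q ϕ f.1 ≤ 1}) :=
    hS.totallyBounded.subset subset_closure
  obtain ⟨t, ht, hcov⟩ := Metric.totallyBounded_iff.1 hSt (ε / 2) (by positivity)
  refine ⟨t, ht, ?_⟩
  rintro _ ⟨f, hf, rfl⟩
  obtain ⟨y, hy, hfy⟩ := Set.mem_iUnion₂.1 (hcov ⟨f, hf, rfl⟩)
  refine Set.mem_iUnion₂.2 ⟨y, hy, ?_⟩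
  have h2 : ‖(T - S) f‖ₑ < ENNReal.ofReal (ε / 2) :=
    (le_iSup₂_of_le (f := fun (f : MixedNormSpace hp hq hϕ) (_ : mixedNorm p q ϕ f.1 ≤ 1) =>
      ‖(T - S) f‖ₑ) f hf le_rfl).trans_lt hTS
  rw [← ofReal_norm, ENNReal.ofReal_lt_ofReal_iff (by positivity), LinearMap.sub_apply,
    ← dist_eq_norm] at h2
  rw [Metric.mem_ball] at hfy ⊢
  linarith [dist_triangle (T f) (S f) y]

lemma essNorm_eq_zero_of_isCompactOp {T : MixedNormSpace hp hq hϕ →ₗ[ℂ] ZygmundSpace hμ}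
    (hT : IsCompactOp T) : essNorm T = 0 := by
  refine le_antisymm (iInf₂_le_of_le T hT ?_) zero_le
  simp [opNorm]

end Complete

end CompOp

theorem corollary2p6 {p q : ℝ} (hp : 0 < p) (hq : 0 < q) {ϕ : ℝ → ℝ} (hϕ : CompOp.IsNormal ϕ) :
    ∃ c C : ℝ, 0 < c ∧ 0 < C ∧
      ∀ (μ : ℂ → ℝ) (hμ : CompOp.IsWeight μ) (φ : ℂ → ℂ),
        DifferentiableOn ℂ φ (Metric.ball 0 1) →
        Set.MapsTo φ (Metric.ball 0 1) (Metric.ball 0 1) →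
        ∀ h : ∀ f ∈ CompOp.MixedNormSpace hp hq hϕ,
            CompOp.comp φ f ∈ CompOp.zygmundSubmodule hμ,
          CompOp.IsBoundedOp (CompOp.compositionOperator hp hq hϕ hμ φ h) →
          (ENNReal.ofReal c * max (CompOp.limsupFirst q ϕ μ φ) (CompOp.limsupSecond q ϕ μ φ) ≤
              CompOp.essNorm (CompOp.compositionOperator hp hq hϕ hμ φ h) ∧
            CompOp.essNorm (CompOp.compositionOperator hp hq hϕ hμ φ h) ≤
              ENNReal.ofReal C *
                max (CompOp.limsupFirst q ϕ μ φ) (CompOp.limsupSecond q ϕ μ φ)) ∧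
          (CompOp.IsCompactOp (CompOp.compositionOperator hp hq hϕ hμ φ h) ↔
            CompOp.limsupFirst q ϕ μ φ = 0 ∧ CompOp.limsupSecond q ϕ μ φ = 0) := by
  obtain ⟨c, hc, hlower⟩ := CompOp.exists_le_essNorm hp hq hϕ
  obtain ⟨C, hC, hupper⟩ := CompOp.exists_essNorm_le hp hq hϕ
  refine ⟨c, C, hc, hC, fun μ hμ φ hφ hmaps h _ => ?_⟩
  have h1 := hlower μ hμ φ hφ hmaps h
  have h2 := hupper μ hμ φ hφ hmaps h
  refine ⟨⟨h1, h2⟩, fun hT => ?_, fun hAB => ?_⟩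
  · rw [CompOp.essNorm_eq_zero_of_isCompactOp hT, nonpos_iff_eq_zero, mul_eq_zero] at h1
    have h3 := h1.resolve_left (by simpa using hc)
    constructor
    · exact le_antisymm ((le_max_left _ _).trans h3.le) zero_le
    · exact le_antisymm ((le_max_right _ _).trans h3.le) zero_le
  · rw [hAB.1, hAB.2, max_self, mul_zero] at h2
    exact CompOp.isCompactOp_of_essNorm_eq_zero (le_antisymm h2 zero_le)
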